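/- Let $A=-\partial_x^2-\partial_y^2+y^2$ on $L^2(\mathbb R^2)$, and let $\hat u(\xi,j)$, $\xi\in\mathbb R$, $j\in\mathbb N=\{0,1,2,\dots\}$, be the transform of $u$ given by the unitary Fourier transform in $x$ and the expansion in normalised Hermite functions $h_j$ in $y$, so that $\widehat{Au}(\xi,j)=\lambda(\xi,j)\hat u(\xi,j)$ with $\lambda(\xi,j)=\xi^2+2j+1$. For $\rho\in\mathbb R$ put $\|u\|_{\mathcal H^\rho}=\|A^{\rho/2}u\|_{L^2}=\big(\sum_j\int\lambda^\rho|\hat u|^2\,d\xi\big)^{1/2}$. For $\rho\ge0$ and $b>\frac12$ let $X^{\rho,b}$ be the space of $u\in L^2(\mathbb R;L^2(\mathbb R^2))$ with $\sum_j\iint\langle\lambda\rangle^{\rho}\langle\tau-\lambda\rangle^{2b}|\hat u(\tau,\xi,j)|^2\,d\tau\,d\xi<\infty$, where $\tau$ is the frequency dual to $t$ (kernel $e^{-it\tau}$), and let $X^{\rho,b}_T$ be the space of restrictions of its elements to $(-T,T)\times\mathbb R^2$; elements of $X_T^{\rho,b}$ are identified with their representatives that are continuous in time. Let $k,s\in\mathbb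 N$ and $R>0$. There is a constant $C>0$, depending only on $k,s,R$, such that the following holds for each sign $\sigma\in\{1,-1\}$, every $T>0$ and every $b>\frac12$. Let $\varphi\in\mathcal H^{2k+s}$ with $\|\varphi\|_{\mathcal H^1}<R$, and let $u\in X^{2k+s,b}_T$ be a solution on $(-T,T)$ of $$i\partial_tu+Au+\sigma|u|^2u=0,\qquad u(0)=\varphi,$$ in the sense of the integral equation $u(t)=e^{itA}\varphi+\sigma i\int_0^te^{i(t-\tau)A}(|u|^2u)(\tau)\,d\tau$, such that $\sup_{t\in(-T,T)}\|u(t)\|_{\mathcal H^1}<R$. Then $u$ is $k$ times continuously differentiable from $(-T,T)$ to $L^2(\mathbb R^2)$, and for all $t\in(-T,T)$ one has $u(t)\in\mathcal H^{2k+s}$ and $$\big\|\partial_t^ku(t)-i^kA^ku(t)\big\|_{\mathcal H^s}\le C\|u(t)\|_{\mathcal H^{s+2k-1}}.$$ Moreover, the $\mathcal H^{2k}$ norm of $u(t)$ and $\|\partial_t^ku(t)\|_{L^2}$ are comparable up to the $L^2$ norm of $u(t)$: for all $t\in(-T,T)$, $$\|\partial_t^ku(t)\|_{L^2}\le C\|u(t)\|_{\mathcal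 H^{2k}},\qquad \|u(t)\|_{\mathcal H^{2k}}\le C\big(\|\partial_t^ku(t)\|_{L^2}+\|u(t)\|_{L^2}\big).$$ -/

import Mathlib

open MeasureTheory Set
open scoped ENNReal FourierTransform

namespace PartialHarmonic

/-- The complex space `L²(ℝ²)`; points of the plane are written `z = (x, y)`. -/
abbrev L2Plane : Type := Lp ℂ 2 (volume : Measure (ℝ × ℝ))

/-- The complex space `L²(ℝ)`. -/
abbrev L2Line : Type := Lp ℂ 2 (volume : Measure ℝ)

/-- The `k`-th normalised Hermite function
`h_k(y) = (2^k k! √π)^(-1/2) H_k(y) exp(-y²/2)`. Mathlib's `Polynomial.hermite` is the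
probabilists' polynomial `He_k`, and `H_k(y) = 2^(k/2) He_k(√2 y)`. -/
noncomputable def hermiteFun (k : ℕ) (y : ℝ) : ℝ :=
  Polynomial.aeval (√2 * y) (Polynomial.hermite k) * Real.exp (-y ^ 2 / 2) /
    √((k.factorial : ℝ) * √Real.pi)

theorem continuous_hermiteFun (k : ℕ) : Continuous (hermiteFun k) := by
  unfold hermiteFun
  fun_prop

theorem integrable_polynomial_mul_gaussian (P : Polynomial ℝ) :
    Integrable (fun y : ℝ => P.eval y * Real.exp (-y ^ 2)) := by
  induction P using Polynomial.induction_on' with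
  | add p q hp hq =>
    exact (hp.add hq).congr (Filter.Eventually.of_forall fun y => by simp [add_mul])
  | monomial n a =>
    have h := (integrable_rpow_mul_exp_neg_mul_sq (b := 1) one_pos (s := (n : ℝ))
      (by have := n.cast_nonneg (α := ℝ); linarith)).const_mul a
    simpa [Real.rpow_natCast, mul_assoc] using h

theorem memLp_hermiteFun (k : ℕ) :
    MemLp (fun y : ℝ => (hermiteFun k y : ℂ)) 2 (volume : Measure ℝ) := by
  have hc : Continuous (fun y : ℝ => (hermiteFun k y : ℂ)) :=
    Complex.continuous_ofReal.comp (continuous_hermiteFun k)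
  rw [memLp_two_iff_integrable_sq_norm hc.aestronglyMeasurable]
  set Q : Polynomial ℝ := ((Polynomial.hermite k).map (Int.castRingHom ℝ)).comp
    (Polynomial.C (√2) * Polynomial.X) with hQ
  have h := (integrable_polynomial_mul_gaussian (Q ^ 2)).const_mul
    ((√((k.factorial : ℝ) * √Real.pi))⁻¹ ^ 2)
  refine h.congr (Filter.Eventually.of_forall fun y => ?_)
  have he : Real.exp (-y ^ 2) = Real.exp (-y ^ 2 / 2) ^ 2 := by
    rw [← Real.exp_nat_mul]; congr 1; push_cast; ring
  have hq : Q.eval y = Polynomial.aeval (√2 * y) (Polynomial.hermite k) := by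
    simp [hQ, Polynomial.eval_comp, Polynomial.aeval_def, Polynomial.eval_map]
  simp only [Polynomial.eval_pow, hq, he, Complex.norm_real, Real.norm_eq_abs, sq_abs, hermiteFun]
  rw [div_eq_mul_inv]
  ring

/-- The Hermite coefficient in the variable `y` of a square integrable function is square
integrable in `x`. -/
theorem memLp_hermiteCoeff (k : ℕ) (u : L2Plane) :
    MemLp (fun x : ℝ => ∫ y : ℝ, u (x, y) * (hermiteFun k y : ℂ)) 2 (volume : Measure ℝ) := by
  have hu : MemLp (u : ℝ × ℝ → ℂ) 2 ((volume : Measure ℝ).prod (volume : Measure ℝ)) := Lp.memLp u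
  have hh := memLp_hermiteFun k
  have hm : AEStronglyMeasurable (fun z : ℝ × ℝ => u z * (hermiteFun k z.2 : ℂ))
      ((volume : Measure ℝ).prod (volume : Measure ℝ)) :=
    hu.1.mul (Complex.continuous_ofReal.comp
      ((continuous_hermiteFun k).comp continuous_snd)).aestronglyMeasurable
  have hm' : AEStronglyMeasurable
      (fun x : ℝ => ∫ y : ℝ, u (x, y) * (hermiteFun k y : ℂ)) (volume : Measure ℝ) :=
    hm.integral_prod_right'
  rw [memLp_two_iff_integrable_sq_norm hm']
  have hint : Integrable (fun z : ℝ × ℝ => ‖u z‖ ^ 2)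
      ((volume : Measure ℝ).prod (volume : Measure ℝ)) :=
    (memLp_two_iff_integrable_sq_norm hu.1).1 hu
  refine (hint.integral_prod_left.mul_const (∫ y : ℝ, ‖(hermiteFun k y : ℂ)‖ ^ 2)).mono'
    (hm'.norm.pow 2) ?_
  filter_upwards [hint.prod_right_ae, hu.1.prodMk_left] with x hx hxm
  have hux : MemLp (fun y : ℝ => u (x, y)) 2 (volume : Measure ℝ) :=
    (memLp_two_iff_integrable_sq_norm hxm).2 hx
  have hux' : MemLp (fun y : ℝ => u (x, y)) (ENNReal.ofReal 2) (volume : Measure ℝ) := by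
    simpa using hux
  have hh' : MemLp (fun y : ℝ => (hermiteFun k y : ℂ)) (ENNReal.ofReal 2)
      (volume : Measure ℝ) := by
    simpa using hh
  have key := integral_mul_norm_le_Lp_mul_Lq (Real.HolderConjugate.two_two) hux' hh'
  have h1 : ‖∫ y : ℝ, u (x, y) * (hermiteFun k y : ℂ)‖ ≤
      ∫ y : ℝ, ‖u (x, y)‖ * ‖(hermiteFun k y : ℂ)‖ :=
    (norm_integral_le_integral_norm _).trans_eq (by simp only [norm_mul])
  have ha : 0 ≤ ∫ y : ℝ, ‖u (x, y)‖ ^ 2 := integral_nonneg fun _ => by positivity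
  have hb : 0 ≤ ∫ y : ℝ, ‖(hermiteFun k y : ℂ)‖ ^ 2 := integral_nonneg fun _ => by positivity
  have h2 := h1.trans key
  simp only [Real.rpow_two, ← Real.sqrt_eq_rpow] at h2
  rw [Real.norm_of_nonneg (by positivity)]
  calc ‖∫ y : ℝ, u (x, y) * (hermiteFun k y : ℂ)‖ ^ 2
      ≤ (√(∫ y : ℝ, ‖u (x, y)‖ ^ 2) * √(∫ y : ℝ, ‖(hermiteFun k y : ℂ)‖ ^ 2)) ^ 2 := by
        gcongr
    _ = _ := by rw [mul_pow, Real.sq_sqrt ha, Real.sq_sqrt hb]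

/-- The Hermite coefficient `x ↦ ∫ u(x, y) h_k(y) dy`; the projection `P_k u` is the product of
this function of `x` with `h_k(y)`. -/
noncomputable def hermiteCoeff (k : ℕ) (u : L2Plane) : L2Line :=
  (memLp_hermiteCoeff k u).toLp _

/-- The Fourier-Hermite transform of `u`: for every `k`, the (`L²`) Fourier transform in `x` of
the `k`-th Hermite coefficient in `y`. The Fourier kernel is Mathlib's `exp(-2πixξ)`. -/
noncomputable def specTransform (u : L2Plane) (k : ℕ) : L2Line :=
  𝓕 (hermiteCoeff k u)

/-- The symbol of `A = -∂_x² - ∂_y² + y²` on the Fourier-Hermite side, which with the kernel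
`exp(-2πixξ)` is `(2πξ)² + 2k + 1`. -/
noncomputable def symbolA (ξ : ℝ) (k : ℕ) : ℝ :=
  (2 * Real.pi * ξ) ^ 2 + 2 * k + 1

/-- The norm `‖u‖_{ℋ^s} = ‖A^{s/2} u‖_{L²}`, with values in `[0, ∞]`; it is finite exactly when
`u` belongs to `ℋ^s = D(A^{s/2})`. -/
noncomputable def sobolevNorm (s : ℝ) (u : L2Plane) : ℝ≥0∞ :=
  (∑' k : ℕ, ∫⁻ ξ : ℝ, ENNReal.ofReal (symbolA ξ k ^ s) * ‖specTransform u k ξ‖ₑ ^ 2) ^ (1 / 2 : ℝ)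

/-- `v = m(A) u` for a Borel function of `A`, or more generally a Fourier-Hermite multiplier
`m(ξ, k)`: the Fourier-Hermite transform of `v` is `m` times that of `u`. -/
def IsMultiplier (m : ℝ → ℕ → ℂ) (u v : L2Plane) : Prop :=
  ∀ k : ℕ, ∀ᵐ ξ : ℝ, specTransform v k ξ = m ξ k * specTransform u k ξ

open Classical in
/-- The element `m(A) u` of `L²(ℝ²)`, for `u` in the domain of the multiplier `m`
(and `0` outside of the domain). -/
noncomputable def multiplier (m : ℝ → ℕ → ℂ) (u : L2Plane) : L2Plane :=
  if h : ∃ v : L2Plane, IsMultiplier m u v then h.choose else 0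

/-- The power `A^k`, with domain `ℋ^{2k}`. -/
noncomputable def powA (k : ℕ) (u : L2Plane) : L2Plane :=
  multiplier (fun ξ j => ((symbolA ξ j : ℝ) : ℂ) ^ k) u

/-- The unitary group `e^{itA}`, the solution operator of `i ∂_t u + A u = 0`. -/
noncomputable def groupA (t : ℝ) (u : L2Plane) : L2Plane :=
  multiplier (fun ξ j => Complex.exp (Complex.I * (t : ℂ) * ((symbolA ξ j : ℝ) : ℂ))) u

/-- The norm of the Bourgain space `X^{s,b}(ℝ × ℝ²)`, with values in `[0, ∞]`, for functions in
`L²(ℝ; L²(ℝ²)) = L²(ℝ × ℝ²)` (for `s, b ≥ 0` these include all elements of the space):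
`‖u‖² = ∑_k ∫∫ ⟨λ⟩^s ⟨τ - λ⟩^{2b} |û(τ, ξ, k)|² dξ dτ`, where `λ` is the symbol of `A`;
up to equivalence this is the norm of `e^{-itA} u(t)` in `H^b_t ℋ^s`. The frequency dual to `t` is `2πτ` for the kernel
`exp(-2πitτ)`. -/
noncomputable def bourgainNorm (s b : ℝ) (U : Lp L2Plane 2 (volume : Measure ℝ)) : ℝ≥0∞ :=
  (∫⁻ τ : ℝ, ∑' k : ℕ, ∫⁻ ξ : ℝ,
    ENNReal.ofReal ((1 + symbolA ξ k ^ 2) ^ (s / 2) *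
      (1 + (2 * Real.pi * τ - symbolA ξ k) ^ 2) ^ b) *
    ‖specTransform ((𝓕 U : Lp L2Plane 2 (volume : Measure ℝ)) τ) k ξ‖ₑ ^ 2) ^ (1 / 2 : ℝ)

/-- `u ∈ X^{s,b}_T(ℝ²)`: on `(-T, T)`, `u` is the restriction of an element of
`X^{s,b}(ℝ × ℝ²)`. -/
def MemBourgain (s b T : ℝ) (u : ℝ → L2Plane) : Prop :=
  ∃ U : Lp L2Plane 2 (volume : Measure ℝ), bourgainNorm s b U < ∞ ∧
    ∀ᵐ t ∂(volume.restrict (Ioo (-T) T)), U t = u t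

/-- `u` is a solution in `X^{s,b}_T(ℝ²)` on the time interval `(-T, T)` of
`i ∂_t u + A u + σ |u|² u = 0`, `u(0) = φ`, in the sense of the integral equation
`u(t) = e^{itA} φ + σ i ∫_0^t e^{i(t-τ)A} (|u|² u)(τ) dτ`. As usual for `b > 1/2`, `u` denotes
the representative that is continuous in time. -/
structure IsLocalSolution (σ s b T : ℝ) (φ : L2Plane) (u : ℝ → L2Plane) : Prop where
  mem : MemBourgain s b T u
  continuousOn : ContinuousOn u (Ioo (-T) T)
  duhamel : ∃ F : ℝ → L2Plane,
    (∀ t ∈ Ioo (-T) T, ∀ᵐ z : ℝ × ℝ, F t z = ((‖u t z‖ ^ 2 : ℝ) : ℂ) * u t z) ∧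
    ∀ t ∈ Ioo (-T) T,
      IntervalIntegrable (fun τ => groupA (t - τ) (F τ)) volume 0 t ∧
      u t = groupA t φ + ((σ : ℂ) * Complex.I) • ∫ τ in (0 : ℝ)..t, groupA (t - τ) (F τ)

end PartialHarmonic

/-!
# Time regularity of solutions of the cubic Schrödinger equation with a partial harmonic potential

The Fourier-Hermite transform is a unitary map `spec` onto `L²(ℕ × ℝ)`, by completeness of the
Hermite functions. It turns `A` into the multiplication by a function `λ ≥ 1`, so that `ℋ^r` is the
range of the bounded injective operator `A^{-r/2}` (`potA`). Continuity and differentiability of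
functions with values in `ℋ^r` are expressed by writing them as `A^{-r/2} w` with `w` in `L²`.

**The solution is continuous with values in `ℋ^ρ`, `ρ = 2k + s`.** On the spectral shell
`n ≤ λ < n + 1` the weight `⟨τ - λ⟩` is comparable to `⟨τ - n⟩`, and `⟨τ - n⟩^{-b}` is square
integrable as `b > 1/2`. By Fourier inversion in time and the Cauchy-Schwarz inequality, the norms
of the shells are bounded uniformly in time by a square summable sequence
(`exists_ae_enorm_shellOp_le`), and continuity in `L²` improves to continuity in `ℋ^ρ`
(`exists_continuousOn_potA`).

**The cubic term.** The Gagliardo-Nirenberg-Sobolev inequality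
`‖v‖²_{L²} ≤ ‖∂_x v‖_{L¹} ‖∂_y v‖_{L¹}` bounds a product of three functions of `ℋ^1` in `L²`. The
operators `∂_x` and `y - ∂_y` together control one order of regularity (`sobolevNorm_succ_le`) and
satisfy product rules, so that induction on `r` gives, for Schwartz functions and then by density
(`exists_cubic`), the tame estimate
`‖u v̄ w‖_{ℋ^r} ≤ C max_{i + j + l = r} ‖u‖_{ℋ^{i+1}} ‖v‖_{ℋ^{j+1}} ‖w‖_{ℋ^{l+1}}`.

**Time derivatives.** Differentiating the integral equation gives `∂_t u = i A u + i σ |u|² u` with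
values in `ℋ^{ρ-2}`. Differentiating this further with the product rule, each time derivative costs
two orders of regularity, and `k` of them exist with values in `ℋ^s`
(`IsLocalSolution.iteratedDeriv_succ_eq`).

**Estimates.** The remainder `∂_t^m u - i^m A^m u` is one order better than `A^m u`. By the
differentiated equation, the remainder of order `m + 1` is `i A` applied to that of order `m`, plus
a sum of products of `∂_t^a u`, the conjugate of `∂_t^b u`, and `∂_t^c u` with `a + b + c = m`. By
the tame estimate and induction on `m`, such a product is bounded in `ℋ^r` by products of the norms
of `u` in `ℋ^{1+p_1}`, `ℋ^{1+p_2}` and `ℋ^{1+p_3}` with `p_1 + p_2 + p_3 = r + 2m`. Interpolation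
`‖u‖_{ℋ^{1+p}} ‖u‖_{ℋ^{1+q}} ≤ ‖u‖_{ℋ^1} ‖u‖_{ℋ^{1+p+q}}` (`sobolevNorm_mul_mul_le`) leaves the
square of the `ℋ^1` norm, which is bounded by `R²`, times `‖u‖_{ℋ^{r+2m+1}}`
(`exists_sobolevNorm_sub_le`). The comparability of `∂_t^k u` and `A^k u` follows from
`‖u‖_{ℋ^{2k-1}} ≤ ε ‖u‖_{ℋ^{2k}} + C_ε ‖u‖_{L²}` by absorption (`exists_le_of_isDerivSequence`).
-/

/-! ### Hermite functions -/

open SchwartzMap Polynomial in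
theorem derivative_hermite_succ (n : ℕ) :
    derivative (hermite (n + 1)) = ((n : ℤ[X]) + 1) * hermite n := by
  induction n with
  | zero => simp
  | succ n ih =>
    rw [hermite_succ (n + 1), derivative_sub, derivative_mul, ih, derivative_mul]
    have h := hermite_succ n
    simp only [derivative_X, one_mul, derivative_add, derivative_natCast, derivative_one, add_zero,
      zero_mul, zero_add, Nat.cast_add, Nat.cast_one]
    linear_combination ((n : ℤ[X]) + 1) * (-h)

namespace PartialHarmonic

open SchwartzMap Polynomial
open scoped ContDiff

/-- The creation operator: `(y - ∂_y) h_k = √(2(k+1)) h_{k+1}`. -/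
theorem hasDerivAt_hermiteFun (k : ℕ) (y : ℝ) :
    HasDerivAt (hermiteFun k) (y * hermiteFun k y - √(2 * (k + 1)) * hermiteFun (k + 1) y) y := by
  have h1 : HasDerivAt (fun y : ℝ => aeval (√2 * y) (hermite k))
      (aeval (√2 * y) (derivative (hermite k)) * √2) y := by
    have := (Polynomial.hasDerivAt_aeval (hermite k) (√2 * y)).comp y
      ((hasDerivAt_id y).const_mul (√2))
    simpa [Function.comp_def] using this
  have h2 : HasDerivAt (fun y : ℝ => Real.exp (-y ^ 2 / 2)) (Real.exp (-y ^ 2 / 2) * (-y)) y := by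
    have h : HasDerivAt (fun y : ℝ => Real.exp (-y ^ 2 / 2)) _ y :=
      ((hasDerivAt_pow 2 y).fun_neg.div_const 2).exp
    convert h using 1
    push_cast
    ring
  have h3 := (h1.mul h2).div_const √((k.factorial : ℝ) * √Real.pi)
  refine h3.congr_deriv ?_
  have hfac : √(((k + 1).factorial : ℝ) * √Real.pi) =
      √(k + 1 : ℝ) * √((k.factorial : ℝ) * √Real.pi) := by
    rw [← Real.sqrt_mul (by positivity), Nat.factorial_succ]
    push_cast
    ring_nf
  have hs : aeval (√2 * y) (hermite (k + 1)) =
      √2 * y * aeval (√2 * y) (hermite k) - aeval (√2 * y) (derivative (hermite k)) := by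
    simp [hermite_succ]
  have h22 : √2 * √2 = (2 : ℝ) := Real.mul_self_sqrt (by norm_num)
  have hk : √(k + 1 : ℝ) ≠ 0 := by positivity
  have hD : √((k.factorial : ℝ) * √Real.pi) ≠ 0 := by positivity
  unfold hermiteFun
  rw [hfac, hs, Real.sqrt_mul (by norm_num : (0 : ℝ) ≤ 2)]
  generalize aeval (√2 * y) (hermite k) = a at *
  generalize aeval (√2 * y) (derivative (hermite k)) = b at *
  field_simp
  linear_combination (y * a) * h22

/-- The three term recurrence of the Hermite functions. Since `2y h = (y - ∂_y) h + (y + ∂_y) h`, it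
says that the annihilation operator `y + ∂_y` maps `h_{k+1}` to `√(2(k+1)) h_k`. -/
theorem hermiteFun_lower (k : ℕ) (y : ℝ) :
    2 * y * hermiteFun (k + 1) y - √(2 * ((k + 1 : ℕ) + 1)) * hermiteFun (k + 1 + 1) y =
      √(2 * (k + 1)) * hermiteFun k y := by
  have hfac : ∀ k : ℕ, √(((k + 1).factorial : ℝ) * √Real.pi) =
      √(k + 1 : ℝ) * √((k.factorial : ℝ) * √Real.pi) := by
    intro k
    rw [← Real.sqrt_mul (by positivity), Nat.factorial_succ]
    push_cast
    ring_nf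
  have hs : aeval (√2 * y) (hermite (k + 1 + 1)) =
      √2 * y * aeval (√2 * y) (hermite (k + 1)) - (k + 1) * aeval (√2 * y) (hermite k) := by
    rw [hermite_succ (k + 1), derivative_hermite_succ]
    simp
  have h22 : √2 * √2 = (2 : ℝ) := Real.mul_self_sqrt (by norm_num)
  have hk : √(k + 1 : ℝ) ≠ 0 := by positivity
  have hk1 : √((k + 1 : ℕ) + 1 : ℝ) ≠ 0 := by positivity
  have hkk : √(k + 1 : ℝ) * √(k + 1 : ℝ) = k + 1 := Real.mul_self_sqrt (by positivity)
  have hD : √((k.factorial : ℝ) * √Real.pi) ≠ 0 := by positivity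
  unfold hermiteFun
  rw [hfac (k + 1), hfac k, hs, Real.sqrt_mul (by norm_num : (0 : ℝ) ≤ 2),
    Real.sqrt_mul (by norm_num : (0 : ℝ) ≤ 2)]
  generalize aeval (√2 * y) (hermite k) = a at *
  generalize aeval (√2 * y) (hermite (k + 1)) = b at *
  field_simp
  linear_combination (-y * b) * h22 - √2 * a * hkk

theorem hermiteFun_lower_zero (y : ℝ) :
    2 * y * hermiteFun 0 y - √2 * hermiteFun 1 y = 0 := by
  have h22 : √2 * √2 = (2 : ℝ) := Real.mul_self_sqrt (by norm_num)
  simp only [hermiteFun, hermite_zero, hermite_one, map_one, aeval_X, Nat.factorial]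
  field_simp
  linear_combination (-y * Real.exp (-(y ^ 2 / 2))) * h22

/-- Multiplication of the `k`-th Hermite function by `y`. -/
theorem mul_hermiteFun (k : ℕ) (y : ℝ) :
    2 * y * hermiteFun k y =
      √(2 * (k + 1)) * hermiteFun (k + 1) y + √(2 * k) * hermiteFun (k - 1) y := by
  cases k with
  | zero => simpa [sub_eq_zero] using hermiteFun_lower_zero y
  | succ k =>
    have := hermiteFun_lower k y
    simp only [Nat.add_sub_cancel]
    push_cast at this ⊢
    linarith

theorem exists_abs_pow_mul_gaussian_le (P : ℝ[X]) :
    ∃ C : ℝ, ∀ y : ℝ, |P.eval y| * Real.exp (-(y ^ 2 / 2)) ≤ C := by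
  induction P using Polynomial.induction_on' with
  | add p q hp hq =>
    obtain ⟨C, hC⟩ := hp
    obtain ⟨D, hD⟩ := hq
    refine ⟨C + D, fun y => ?_⟩
    rw [eval_add]
    calc _ ≤ (|p.eval y| + |q.eval y|) * Real.exp (-(y ^ 2 / 2)) := by
          gcongr; exact abs_add_le _ _
      _ ≤ C + D := by rw [add_mul]; exact add_le_add (hC y) (hD y)
  | monomial n a =>
    refine ⟨|a| * (n.factorial * Real.exp (1 / 2)), fun y => ?_⟩
    rw [eval_monomial, abs_mul, abs_pow, mul_assoc]
    refine mul_le_mul_of_nonneg_left ?_ (abs_nonneg a)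
    have h := Real.pow_div_factorial_le_exp |y| (abs_nonneg y) n
    rw [div_le_iff₀ (by positivity)] at h
    calc |y| ^ n * Real.exp (-(y ^ 2 / 2))
        ≤ Real.exp |y| * n.factorial * Real.exp (-(y ^ 2 / 2)) := by gcongr
      _ = n.factorial * Real.exp (|y| + -(y ^ 2 / 2)) := by rw [Real.exp_add]; ring
      _ ≤ _ := by
        gcongr
        nlinarith [sq_nonneg (|y| - 1), sq_abs y]

/-- The Gaussian `exp(-y²/2)` as a Schwartz function. -/
noncomputable def gaussianSchwartz : 𝓢(ℝ, ℝ) where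
  toFun y := Real.exp (-(y ^ 2 / 2))
  smooth' := by fun_prop
  decay' k n := by
    obtain ⟨C, hC⟩ := exists_abs_pow_mul_gaussian_le
      (X ^ k * (hermite n).map (Int.castRingHom ℝ))
    refine ⟨C, fun x => (le_of_eq ?_).trans (hC x)⟩
    rw [norm_iteratedFDeriv_eq_norm_iteratedDeriv, iteratedDeriv_eq_iterate,
      deriv_gaussian_eq_hermite_mul_gaussian]
    simp [abs_mul, Polynomial.eval_map, Polynomial.aeval_def, abs_of_pos (Real.exp_pos _),
      mul_assoc]

theorem hasTemperateGrowth_aeval (P : ℤ[X]) (c : ℝ) :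
    Function.HasTemperateGrowth (fun y : ℝ => aeval (c * y) P) := by
  induction P using Polynomial.induction_on' with
  | add p q hp hq => simpa [Pi.add_def] using hp.add hq
  | monomial n a =>
    simp only [aeval_monomial, mul_pow]
    fun_prop

/-- The normalised Hermite function as a complex valued Schwartz function. -/
noncomputable def hermiteSchwartz (k : ℕ) : 𝓢(ℝ, ℂ) :=
  postcompCLM (𝕜 := ℝ) Complex.ofRealCLM ((√((k.factorial : ℝ) * √Real.pi))⁻¹ •
    smulLeftCLM ℝ (fun y : ℝ => aeval (√2 * y) (hermite k)) gaussianSchwartz)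

@[simp] theorem hermiteSchwartz_apply (k : ℕ) (y : ℝ) :
    hermiteSchwartz k y = (hermiteFun k y : ℂ) := by
  have : gaussianSchwartz y = Real.exp (-(y ^ 2 / 2)) := rfl
  rw [hermiteSchwartz, postcompCLM_apply]
  simp only [smul_apply, smulLeftCLM_apply_apply (hasTemperateGrowth_aeval _ _), this,
    Complex.ofRealCLM_apply, hermiteFun, smul_eq_mul]
  congr 1
  rw [neg_div]
  ring

theorem integrable_hermiteFun_mul (j k : ℕ) :
    Integrable (fun y => hermiteFun j y * hermiteFun k y) := by
  have h := (memLp_hermiteFun j).integrable_mul (memLp_hermiteFun k)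
  have := h.re
  refine this.congr (Filter.Eventually.of_forall fun y => ?_)
  simp

theorem integral_hermiteFun_zero_sq : ∫ y, hermiteFun 0 y * hermiteFun 0 y = 1 := by
  have h : ∀ y, hermiteFun 0 y * hermiteFun 0 y = (√Real.pi)⁻¹ * Real.exp (-1 * y ^ 2) := by
    intro y
    simp only [hermiteFun, hermite_zero, map_one, one_mul, Nat.factorial_zero, Nat.cast_one]
    rw [div_mul_div_comm, ← Real.exp_add, Real.mul_self_sqrt (by positivity)]
    field_simp
    congr 1
    ring
  simp_rw [h]
  rw [integral_const_mul, integral_gaussian]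
  simp
  field_simp

/-- The creation and annihilation operators are adjoint to each other. -/
theorem integral_hermiteFun_succ_mul (j k : ℕ) :
    √(2 * (k + 1)) * ∫ y, hermiteFun (k + 1) y * hermiteFun j y =
      √(2 * j) * ∫ y, hermiteFun k y * hermiteFun (j - 1) y := by
  have hderiv (k : ℕ) (y : ℝ) : HasDerivAt (hermiteFun k)
      (y * hermiteFun k y - √(2 * (k + 1)) * hermiteFun (k + 1) y) y := hasDerivAt_hermiteFun k y
  have hy (j k : ℕ) : Integrable (fun y : ℝ => y * hermiteFun j y * hermiteFun k y) := by
    have := ((integrable_hermiteFun_mul (j + 1) k).const_mul (√(2 * (j + 1)) / 2)).add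
      ((integrable_hermiteFun_mul (j - 1) k).const_mul (√(2 * j) / 2))
    refine this.congr (Filter.Eventually.of_forall fun y => ?_)
    simp only [Pi.add_apply]
    linear_combination (-hermiteFun k y / 2) * mul_hermiteFun j y
  have hibp := integral_mul_deriv_eq_deriv_mul_of_integrable (u := hermiteFun k)
    (v := hermiteFun j) (u' := fun y => y * hermiteFun k y - √(2 * (k + 1)) * hermiteFun (k + 1) y)
    (v' := fun y => y * hermiteFun j y - √(2 * (j + 1)) * hermiteFun (j + 1) y)
    (fun y _ => hderiv k y) (fun y _ => hderiv j y) ?_ ?_ (integrable_hermiteFun_mul k j)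
  · have e1 : ∀ y, hermiteFun k y * (y * hermiteFun j y - √(2 * (j + 1)) * hermiteFun (j + 1) y) =
        √(2 * j) * (hermiteFun k y * hermiteFun (j - 1) y) -
          y * hermiteFun k y * hermiteFun j y := by
      intro y
      linear_combination (hermiteFun k y) * mul_hermiteFun j y
    have e2 : ∀ y, (y * hermiteFun k y - √(2 * (k + 1)) * hermiteFun (k + 1) y) * hermiteFun j y =
        y * hermiteFun k y * hermiteFun j y -
          √(2 * (k + 1)) * (hermiteFun (k + 1) y * hermiteFun j y) := fun y => by ring
    simp only [e1, e2] at hibp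
    rw [integral_sub ((integrable_hermiteFun_mul _ _).const_mul _) (hy _ _),
      integral_sub (hy _ _) ((integrable_hermiteFun_mul _ _).const_mul _),
      integral_const_mul, integral_const_mul] at hibp
    linarith
  · refine ((hy j k).sub ((integrable_hermiteFun_mul (j + 1) k).const_mul (√(2 * (j + 1))))).congr
      (Filter.Eventually.of_forall fun y => ?_)
    simp only [Pi.sub_apply, Pi.mul_apply]
    ring
  · refine ((hy k j).sub ((integrable_hermiteFun_mul (k + 1) j).const_mul (√(2 * (k + 1))))).congr
      (Filter.Eventually.of_forall fun y => ?_)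
    simp only [Pi.sub_apply, Pi.mul_apply]
    ring

/-- Orthonormality of the Hermite functions, by induction on `j + k`: adjointness of the ladder
operators lowers both indices by one. -/
theorem integral_hermiteFun_mul (j k : ℕ) :
    ∫ y, hermiteFun j y * hermiteFun k y = if j = k then 1 else 0 := by
  have main : ∀ n j k : ℕ, j + k = n → ∫ y, hermiteFun j y * hermiteFun k y =
      if j = k then 1 else 0 := by
    intro n
    induction n using Nat.strong_induction_on with
    | _ n ih =>
      intro j k hn
      match j, k with
      | 0, 0 => simpa using integral_hermiteFun_zero_sq
      | j + 1, 0 =>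
        have h := integral_hermiteFun_succ_mul 0 j
        have hp : √(2 * (j + 1 : ℝ)) ≠ 0 := by positivity
        rw [Nat.cast_zero, mul_zero, Real.sqrt_zero, zero_mul] at h
        simpa using (mul_eq_zero.1 h).resolve_left hp
      | 0, k + 1 =>
        have h := integral_hermiteFun_succ_mul 0 k
        have hp : √(2 * (k + 1 : ℝ)) ≠ 0 := by positivity
        rw [Nat.cast_zero, mul_zero, Real.sqrt_zero, zero_mul] at h
        simpa [mul_comm (hermiteFun 0 _)] using (mul_eq_zero.1 h).resolve_left hp
      | j + 1, k + 1 =>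
        have h := integral_hermiteFun_succ_mul (k + 1) j
        rw [Nat.add_sub_cancel, ih (j + k) (by omega) j k rfl] at h
        have hp : √(2 * (j + 1 : ℝ)) ≠ 0 := by positivity
        by_cases hjk : j = k
        · subst hjk
          simp only [if_true] at h ⊢
          push_cast at h
          exact mul_left_cancel₀ hp h
        · rw [if_neg hjk, mul_zero] at h
          simpa [hjk] using (mul_eq_zero.1 h).resolve_left hp
  exact main _ j k rfl

/-- The weighted Gaussian which dominates the exponential series in the proof of completeness. -/
theorem memLp_exp_mul_hermiteFun_zero (c : ℝ) :
    MemLp (fun y : ℝ => Real.exp (c * |y|) * hermiteFun 0 y) 2 := by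
  have hcont : Continuous (fun y : ℝ => Real.exp (c * |y|) * hermiteFun 0 y) :=
    (by fun_prop : Continuous fun y : ℝ => Real.exp (c * |y|)).mul (continuous_hermiteFun 0)
  rw [memLp_two_iff_integrable_sq_norm hcont.aestronglyMeasurable]
  have hg := (integrable_exp_neg_mul_sq (b := 1 / 2) (by norm_num)).const_mul
    (Real.exp (2 * c ^ 2) * (√(√Real.pi))⁻¹ ^ 2)
  refine hg.mono' (hcont.norm.pow 2).aestronglyMeasurable (Filter.Eventually.of_forall fun y => ?_)
  simp only [hermiteFun, hermite_zero, map_one, one_mul, Nat.factorial_zero, Nat.cast_one,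
    norm_mul, norm_pow, Real.norm_eq_abs, abs_of_pos (Real.exp_pos _), div_eq_mul_inv,
    abs_inv, abs_abs]
  rw [abs_of_nonneg (Real.sqrt_nonneg _), ← mul_assoc, ← Real.exp_add, mul_pow, ← Real.exp_nat_mul,
    mul_right_comm, ← Real.exp_add]
  gcongr
  nlinarith [sq_nonneg (|y| - 2 * c), sq_abs y]

/-- Completeness of the Hermite functions. The Fourier transform of `f h₀` has a power series
expansion whose coefficients are the moments of `f h₀`, and all of these vanish. -/
theorem ae_eq_zero_of_integral_mul_hermiteFun_eq_zero {f : ℝ → ℂ} (hf : MemLp f 2)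
    (h : ∀ k, ∫ y, f y * (hermiteFun k y : ℂ) = 0) : f =ᵐ[volume] 0 := by
  have hint : ∀ n k : ℕ, Integrable (fun y : ℝ => f y * ((y : ℂ) ^ n * (hermiteFun k y : ℂ))) := by
    intro n
    induction n with
    | zero => intro k; simpa [Pi.mul_def] using hf.integrable_mul (memLp_hermiteFun k)
    | succ n ih =>
      intro k
      refine (((ih (k + 1)).const_mul ((√(2 * (k + 1)) / 2 : ℝ) : ℂ)).add
        ((ih (k - 1)).const_mul ((√(2 * k) / 2 : ℝ) : ℂ))).congr
        (Filter.Eventually.of_forall fun y => ?_)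
      have := congrArg (fun x : ℝ => (x : ℂ)) (mul_hermiteFun k y)
      push_cast at this
      simp only [Pi.add_apply]
      push_cast
      linear_combination (-f y * (y : ℂ) ^ n / 2) * this
  have hmom : ∀ n k : ℕ, ∫ y : ℝ, f y * ((y : ℂ) ^ n * (hermiteFun k y : ℂ)) = 0 := by
    intro n
    induction n with
    | zero => intro k; simpa using h k
    | succ n ih =>
      intro k
      have e : ∀ y : ℝ, f y * ((y : ℂ) ^ (n + 1) * (hermiteFun k y : ℂ)) =
          ((√(2 * (k + 1)) / 2 : ℝ) : ℂ) * (f y * ((y : ℂ) ^ n * (hermiteFun (k + 1) y : ℂ))) +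
          ((√(2 * k) / 2 : ℝ) : ℂ) * (f y * ((y : ℂ) ^ n * (hermiteFun (k - 1) y : ℂ))) := by
        intro y
        have := congrArg (fun x : ℝ => (x : ℂ)) (mul_hermiteFun k y)
        push_cast at this ⊢
        linear_combination (f y * (y : ℂ) ^ n / 2) * this
      simp_rw [e]
      rw [integral_add ((hint _ _).const_mul _) ((hint _ _).const_mul _), integral_const_mul,
        integral_const_mul, ih, ih]
      simp
  set G : ℝ → ℂ := fun y => f y * (hermiteFun 0 y : ℂ) with hG
  have hGint : Integrable G := by simpa using hint 0 0
  -- expand the exponential in the Fourier integral of `G` and integrate term by term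
  have hF : ∀ ξ : ℝ, 𝓕 G ξ = 0 := by
    intro ξ
    set c : ℂ := -2 * Real.pi * ξ * Complex.I with hc
    have hs : HasSum (fun n : ℕ => ∫ y : ℝ, ((n.factorial : ℂ)⁻¹ * c ^ n) *
        (f y * ((y : ℂ) ^ n * (hermiteFun 0 y : ℂ)))) (∫ y : ℝ, Complex.exp (c * y) * G y) := by
      have hb : ∀ y : ℝ, HasSum (fun n : ℕ => ‖G y‖ * ((‖c‖ * |y|) ^ n / n.factorial))
          (‖G y‖ * Real.exp (‖c‖ * |y|)) := by
        intro y
        rw [Real.exp_eq_exp_ℝ]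
        exact (NormedSpace.expSeries_div_hasSum_exp (‖c‖ * |y|)).mul_left _
      refine hasSum_integral_of_dominated_convergence
        (fun n y => ‖G y‖ * ((‖c‖ * |y|) ^ n / n.factorial))
        (fun n => ((hint n 0).const_mul _).1) (fun n => ?_) ?_ ?_ ?_
      · refine Filter.Eventually.of_forall fun y => le_of_eq ?_
        simp only [hG, norm_mul, norm_inv, norm_pow, Complex.norm_natCast, Complex.norm_real,
          Real.norm_eq_abs]
        field_simp
        rw [mul_pow]
        ring
      · exact Filter.Eventually.of_forall fun y => (hb y).summable
      · simp_rw [fun y => (hb y).tsum_eq]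
        have := (hf.norm.integrable_mul (memLp_exp_mul_hermiteFun_zero ‖c‖)).norm
        refine this.congr (Filter.Eventually.of_forall fun y => ?_)
        simp [hG]
        ring
      · refine Filter.Eventually.of_forall fun y => ?_
        have := (NormedSpace.expSeries_div_hasSum_exp (c * y)).mul_right (G y)
        rw [← Complex.exp_eq_exp_ℂ] at this
        refine this.congr_fun fun n => ?_
        simp only [hG, mul_pow]
        ring
    have hz : ∀ n : ℕ, ∫ y : ℝ, ((n.factorial : ℂ)⁻¹ * c ^ n) *
        (f y * ((y : ℂ) ^ n * (hermiteFun 0 y : ℂ))) = 0 := by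
      intro n
      rw [integral_const_mul, hmom, mul_zero]
    simp_rw [hz] at hs
    have h0 := hs.unique hasSum_zero
    rw [Real.fourier_real_eq_integral_exp_smul, ← h0]
    refine integral_congr_ae (Filter.Eventually.of_forall fun y => ?_)
    simp only [smul_eq_mul, hc]
    congr 2
    push_cast
    ring
  -- an integrable function with vanishing Fourier transform is zero
  have hG0 : G =ᵐ[volume] 0 := by
    refine ae_eq_zero_of_integral_contDiff_smul_eq_zero hGint.locallyIntegrable ?_
    intro g hg hgc
    have hgc' : HasCompactSupport (fun x => (g x : ℂ)) := hgc.comp_left Complex.ofReal_zero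
    have hg' : ContDiff ℝ ∞ (fun x => (g x : ℂ)) := Complex.ofRealCLM.contDiff.comp hg
    set ψ : 𝓢(ℝ, ℂ) := 𝓕⁻ (hgc'.toSchwartzMap hg') with hψ
    have hgψ : ∀ x, (g x : ℂ) = 𝓕 (ψ : ℝ → ℂ) x := by
      intro x
      rw [← fourier_coe, hψ, FourierTransform.fourier_fourierInv_eq]
      rfl
    have := VectorFourier.integral_fourierIntegral_smul_eq_flip (L := innerₗ ℝ)
      (f := (ψ : ℝ → ℂ)) (g := G) (μ := volume) (ν := volume)
      Real.continuous_fourierChar continuous_inner ψ.integrable hGint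
    calc ∫ x, g x • G x = ∫ x, 𝓕 (ψ : ℝ → ℂ) x • G x := by
          simp_rw [← hgψ]; simp
      _ = ∫ x, ψ x • 𝓕 G x := by
          rw [flip_innerₗ] at this
          exact this
      _ = 0 := by simp [hF]
  filter_upwards [hG0] with y hy
  have h0 : hermiteFun 0 y ≠ 0 := by
    simp only [hermiteFun, hermite_zero, map_one, one_mul]
    positivity
  simpa [hG, h0] using hy

end PartialHarmonic

namespace PartialHarmonic

open scoped InnerProductSpace

/-! ### The Fourier-Hermite transform as a unitary map -/

theorem memLp_mul_hermiteFun (k : ℕ) (φ : L2Line) :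
    MemLp (fun z : ℝ × ℝ => φ z.1 * (hermiteFun k z.2 : ℂ)) 2 volume := by
  have hm : AEStronglyMeasurable (fun z : ℝ × ℝ => φ z.1 * (hermiteFun k z.2 : ℂ)) volume :=
    ((Lp.stronglyMeasurable φ).comp_measurable measurable_fst).aestronglyMeasurable.mul
      (Complex.continuous_ofReal.comp
        ((continuous_hermiteFun k).comp continuous_snd)).aestronglyMeasurable
  rw [memLp_two_iff_integrable_sq_norm hm]
  have h1 := (memLp_two_iff_integrable_sq_norm (Lp.memLp φ).1).1 (Lp.memLp φ)
  have h2 := (memLp_two_iff_integrable_sq_norm (memLp_hermiteFun k).1).1 (memLp_hermiteFun k)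
  refine (h1.mul_prod h2).congr (Filter.Eventually.of_forall fun z => ?_)
  simp [mul_pow]

/-- The map `φ ↦ φ(x) h_k(y)`. -/
noncomputable def tensorHermiteLM (k : ℕ) : L2Line →ₗ[ℂ] L2Plane where
  toFun φ := (memLp_mul_hermiteFun k φ).toLp _
  map_add' φ ψ := by
    rw [← MemLp.toLp_add]
    refine MemLp.toLp_congr _ _ ?_
    have h := (Measure.quasiMeasurePreserving_fst (μ := (volume : Measure ℝ))
      (ν := (volume : Measure ℝ))).ae (Lp.coeFn_add φ ψ)
    filter_upwards [h] with z hz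
    simp only [Pi.add_apply] at hz ⊢
    rw [hz, add_mul]
  map_smul' c φ := by
    rw [RingHom.id_apply, ← MemLp.toLp_const_smul]
    refine MemLp.toLp_congr _ _ ?_
    have h := (Measure.quasiMeasurePreserving_fst (μ := (volume : Measure ℝ))
      (ν := (volume : Measure ℝ))).ae (Lp.coeFn_smul c φ)
    filter_upwards [h] with z hz
    simp only [Pi.smul_apply, smul_eq_mul] at hz ⊢
    rw [hz, mul_assoc]

theorem coeFn_tensorHermiteLM (k : ℕ) (φ : L2Line) :
    tensorHermiteLM k φ =ᵐ[volume] fun z => φ z.1 * (hermiteFun k z.2 : ℂ) :=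
  (memLp_mul_hermiteFun k φ).coeFn_toLp

theorem inner_tensorHermiteLM (k : ℕ) (φ : L2Line) (u : L2Plane) :
    ⟪tensorHermiteLM k φ, u⟫_ℂ = ⟪φ, hermiteCoeff k u⟫_ℂ := by
  rw [L2.inner_def, L2.inner_def]
  have h1 := coeFn_tensorHermiteLM k φ
  have hint : Integrable (fun z : ℝ × ℝ => (u z * (hermiteFun k z.2 : ℂ)) * (starRingEnd ℂ) (φ z.1))
      ((volume : Measure ℝ).prod (volume : Measure ℝ)) := by
    have := L2.integrable_inner (𝕜 := ℂ) (tensorHermiteLM k φ) u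
    refine this.congr ?_
    filter_upwards [h1] with z hz
    simp only [RCLike.inner_apply, hz, map_mul, Complex.conj_ofReal]
    ring
  calc ∫ z, ⟪tensorHermiteLM k φ z, u z⟫_ℂ
      = ∫ z : ℝ × ℝ, (u z * (hermiteFun k z.2 : ℂ)) * (starRingEnd ℂ) (φ z.1) := by
        refine integral_congr_ae ?_
        filter_upwards [h1] with z hz
        simp only [RCLike.inner_apply, hz, map_mul, Complex.conj_ofReal]
        ring
    _ = ∫ x, ∫ y, (u (x, y) * (hermiteFun k y : ℂ)) * (starRingEnd ℂ) (φ x) :=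
        integral_prod _ hint
    _ = _ := by
        refine integral_congr_ae ?_
        filter_upwards [(memLp_hermiteCoeff k u).coeFn_toLp] with x hx
        rw [hermiteCoeff, RCLike.inner_apply, hx, integral_mul_const]

theorem hermiteCoeff_tensorHermiteLM (j k : ℕ) (φ : L2Line) :
    hermiteCoeff j (tensorHermiteLM k φ) = if j = k then φ else 0 := by
  have h : ∀ᵐ x : ℝ,
      hermiteCoeff j (tensorHermiteLM k φ) x = (if j = k then (1 : ℂ) else 0) * φ x := by
    have h1 := Measure.ae_ae_of_ae_prod (μ := (volume : Measure ℝ)) (ν := (volume : Measure ℝ))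
      (coeFn_tensorHermiteLM k φ)
    filter_upwards [(memLp_hermiteCoeff j (tensorHermiteLM k φ)).coeFn_toLp, h1] with x hx hx1
    rw [hermiteCoeff, hx]
    have : ∫ y : ℝ, tensorHermiteLM k φ (x, y) * (hermiteFun j y : ℂ) =
        ∫ y : ℝ, φ x * ((hermiteFun j y * hermiteFun k y : ℝ) : ℂ) := by
      refine integral_congr_ae ?_
      filter_upwards [hx1] with y hy
      rw [hy]
      push_cast
      ring
    rw [this, integral_const_mul, integral_complex_ofReal, integral_hermiteFun_mul]
    split_ifs <;> simp
  refine Lp.ext ?_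
  split_ifs with hjk
  · filter_upwards [h] with x hx
    simpa [hjk] using hx
  · filter_upwards [h, Lp.coeFn_zero ℂ 2 (volume : Measure ℝ)] with x hx h0
    rw [h0]
    simpa [hjk] using hx

/-- The isometry which maps `c` to the function whose Fourier-Hermite transform is `c(ξ)` for the
index `k` and `0` for all other indices. -/
noncomputable def specEmbed (k : ℕ) : L2Line →ₗᵢ[ℂ] L2Plane where
  toLinearMap := tensorHermiteLM k ∘ₗ
    (Lp.fourierTransformₗᵢ ℝ ℂ).symm.toLinearEquiv.toLinearMap
  norm_map' c := by
    have h : ∀ φ : L2Line, ‖tensorHermiteLM k φ‖ = ‖φ‖ := by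
      intro φ
      have := inner_tensorHermiteLM k φ (tensorHermiteLM k φ)
      rw [hermiteCoeff_tensorHermiteLM, if_pos rfl, inner_self_eq_norm_sq_to_K,
        inner_self_eq_norm_sq_to_K] at this
      have h2 : ‖tensorHermiteLM k φ‖ ^ 2 = ‖φ‖ ^ 2 := by exact_mod_cast this
      exact (pow_left_inj₀ (norm_nonneg _) (norm_nonneg _) two_ne_zero).1 h2
    exact (h _).trans ((Lp.fourierTransformₗᵢ ℝ ℂ).symm.norm_map c)

theorem specEmbed_apply (k : ℕ) (c : L2Line) : specEmbed k c = tensorHermiteLM k (𝓕⁻ c) := rfl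

theorem inner_specEmbed (k : ℕ) (c : L2Line) (u : L2Plane) :
    ⟪specEmbed k c, u⟫_ℂ = ⟪c, specTransform u k⟫_ℂ := by
  rw [specEmbed_apply, inner_tensorHermiteLM, specTransform, ← Lp.inner_fourier_eq (𝓕⁻ c),
    FourierTransform.fourier_fourierInv_eq]

theorem specTransform_specEmbed (j k : ℕ) (c : L2Line) :
    specTransform (specEmbed k c) j = if j = k then c else 0 := by
  rw [specTransform, specEmbed_apply, hermiteCoeff_tensorHermiteLM]
  split_ifs
  · exact FourierTransform.fourier_fourierInv_eq c
  · exact (Lp.fourierTransformₗᵢ ℝ ℂ).map_zero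

/-- The Fourier-Hermite transform is injective: for almost every `x` the slice `u(x, ·)` is
orthogonal to all Hermite functions. -/
theorem eq_zero_of_hermiteCoeff_eq_zero {u : L2Plane} (h : ∀ k, hermiteCoeff k u = 0) : u = 0 := by
  have hu : MemLp (u : ℝ × ℝ → ℂ) 2 ((volume : Measure ℝ).prod (volume : Measure ℝ)) := Lp.memLp u
  have hint : Integrable (fun z : ℝ × ℝ => ‖u z‖ ^ 2)
      ((volume : Measure ℝ).prod (volume : Measure ℝ)) :=
    (memLp_two_iff_integrable_sq_norm hu.1).1 hu
  have hc : ∀ᵐ x : ℝ, ∀ k, ∫ y : ℝ, u (x, y) * (hermiteFun k y : ℂ) = 0 := by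
    rw [ae_all_iff]
    intro k
    have hk := h k
    rw [hermiteCoeff] at hk
    filter_upwards [(memLp_hermiteCoeff k u).coeFn_toLp, Lp.coeFn_zero ℂ 2 (volume : Measure ℝ)]
      with x hx h0
    rw [← hx, hk, h0]
    rfl
  have h0 : ∀ᵐ x : ℝ, ∀ᵐ y : ℝ, u (x, y) = 0 := by
    filter_upwards [hc, hint.prod_right_ae, hu.1.prodMk_left] with x hx hx2 hxm
    exact ae_eq_zero_of_integral_mul_hermiteFun_eq_zero
      ((memLp_two_iff_integrable_sq_norm hxm).2 hx2) hx
  refine Lp.ext ?_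
  have hms : MeasurableSet {z : ℝ × ℝ | u z = 0} :=
    (Lp.stronglyMeasurable u).measurable (measurableSet_singleton 0)
  have h1 : ∀ᵐ z ∂((volume : Measure ℝ).prod (volume : Measure ℝ)), u z = 0 :=
    (Measure.ae_prod_iff_ae_ae hms).2 h0
  have h2 : ∀ᵐ z : ℝ × ℝ, u z = 0 := h1
  filter_upwards [h2, Lp.coeFn_zero ℂ 2 (volume : Measure (ℝ × ℝ))] with z hz hz0
  rw [hz, hz0]
  rfl

/-- `L²(ℝ²)` is the Hilbert sum of the images of the isometries `specEmbed k`. This makes the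
transform unitary, and gives its surjectivity. -/
theorem isHilbertSum_specEmbed : IsHilbertSum ℂ (fun _ : ℕ => L2Line) specEmbed := by
  refine IsHilbertSum.mk ?_ ?_
  · intro i j hij v w
    rw [inner_specEmbed, specTransform_specEmbed, if_neg hij, inner_zero_right]
  · rw [top_le_iff, Submodule.topologicalClosure_eq_top_iff, Submodule.eq_bot_iff]
    intro u hu
    refine eq_zero_of_hermiteCoeff_eq_zero fun k => ?_
    have h0 : specTransform u k = 0 := by
      rw [← inner_self_eq_zero (𝕜 := ℂ), ← inner_specEmbed]
      exact (Submodule.mem_orthogonal _ _).1 hu _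
        (Submodule.mem_iSup_of_mem k ⟨_, rfl⟩)
    exact (Lp.fourierTransformₗᵢ ℝ ℂ).map_eq_zero_iff.1 h0

theorem specTransform_eq (u : L2Plane) (k : ℕ) :
    specTransform u k = isHilbertSum_specEmbed.linearIsometryEquiv u k := by
  refine ext_inner_left ℂ fun c => ?_
  rw [← inner_specEmbed, ← isHilbertSum_specEmbed.linearIsometryEquiv.inner_map_map,
    ← isHilbertSum_specEmbed.linearIsometryEquiv_symm_apply_single,
    LinearIsometryEquiv.apply_symm_apply, lp.inner_single_left]

theorem specTransform_add (u v : L2Plane) (k : ℕ) :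
    specTransform (u + v) k = specTransform u k + specTransform v k := by
  simp [specTransform_eq]

theorem specTransform_smul (c : ℂ) (u : L2Plane) (k : ℕ) :
    specTransform (c • u) k = c • specTransform u k := by
  simp [specTransform_eq]

/-- The measure on the Fourier-Hermite side: counting measure in the Hermite index and Lebesgue
measure in the frequency of `x`. -/
noncomputable abbrev specMeasure : Measure (ℕ × ℝ) :=
  (Measure.count : Measure ℕ).prod (volume : Measure ℝ)

theorem ae_specMeasure_iff {P : ℕ × ℝ → Prop} :
    (∀ᵐ p ∂specMeasure, P p) ↔ ∀ k, ∀ᵐ ξ : ℝ, P (k, ξ) := by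
  constructor
  · intro h k
    have h1 := Measure.ae_ae_of_ae_prod h
    rw [Measure.ae_count_iff] at h1
    exact h1 k
  · intro h
    rw [ae_iff]
    have hsub : {p : ℕ × ℝ | ¬ P p} ⊆ ⋃ k : ℕ, ({k} : Set ℕ) ×ˢ {ξ : ℝ | ¬ P (k, ξ)} := by
      rintro ⟨k, ξ⟩ hp
      exact mem_iUnion.2 ⟨k, rfl, hp⟩
    refine measure_mono_null hsub (measure_iUnion_null fun k => ?_)
    rw [Measure.prod_prod, ae_iff.1 (h k), mul_zero]

theorem lintegral_specMeasure {f : ℕ × ℝ → ℝ≥0∞} (hf : AEMeasurable f specMeasure) :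
    ∫⁻ p, f p ∂specMeasure = ∑' k : ℕ, ∫⁻ ξ : ℝ, f (k, ξ) := by
  rw [lintegral_prod _ hf, lintegral_count]

theorem measurable_specTransform (u : L2Plane) :
    Measurable (fun p : ℕ × ℝ => specTransform u p.1 p.2) :=
  measurable_from_prod_countable_right fun k =>
    (Lp.stronglyMeasurable (specTransform u k)).measurable

theorem enorm_sq_L2 {α : Type*} [MeasurableSpace α] {μ : Measure α} {f : α → ℂ} :
    eLpNorm f 2 μ ^ 2 = ∫⁻ x, ‖f x‖ₑ ^ 2 ∂μ := by
  rw [eLpNorm_eq_lintegral_rpow_enorm_toReal two_ne_zero ENNReal.ofNat_ne_top]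
  simp only [ENNReal.toReal_ofNat, ENNReal.rpow_two]
  rw [← ENNReal.rpow_natCast, ← ENNReal.rpow_mul]
  simp

theorem tsum_enorm_lp_sq (w : lp (fun _ : ℕ => L2Line) 2) :
    ∑' k, ‖w k‖ₑ ^ 2 = ‖w‖ₑ ^ 2 := by
  have h := lp.hasSum_norm (p := 2) (by norm_num) w
  simp only [ENNReal.toReal_ofNat, Real.rpow_two] at h
  have h1 : ∀ k, ‖w k‖ₑ ^ 2 = ENNReal.ofReal (‖w k‖ ^ 2) := fun k => by
    rw [ENNReal.ofReal_pow (norm_nonneg _), ofReal_norm]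
  simp_rw [h1]
  rw [← ENNReal.ofReal_tsum_of_nonneg (fun k => by positivity) h.summable, h.tsum_eq,
    ENNReal.ofReal_pow (norm_nonneg _), ofReal_norm]

/-- Plancherel's formula for the Fourier-Hermite transform. -/
theorem eLpNorm_specTransform (u : L2Plane) :
    eLpNorm (fun p : ℕ × ℝ => specTransform u p.1 p.2) 2 specMeasure = ‖u‖ₑ := by
  have h : eLpNorm (fun p : ℕ × ℝ => specTransform u p.1 p.2) 2 specMeasure ^ 2 = ‖u‖ₑ ^ 2 := by
    rw [enorm_sq_L2,
      lintegral_specMeasure ((measurable_specTransform u).enorm.pow_const 2).aemeasurable,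
      ← isHilbertSum_specEmbed.linearIsometryEquiv.enorm_map u, ← tsum_enorm_lp_sq]
    refine tsum_congr fun k => ?_
    rw [← specTransform_eq, Lp.enorm_def, enorm_sq_L2]
  exact (ENNReal.pow_right_strictMono two_ne_zero).injective h

theorem memLp_specTransform (u : L2Plane) :
    MemLp (fun p : ℕ × ℝ => specTransform u p.1 p.2) 2 specMeasure :=
  ⟨(measurable_specTransform u).aestronglyMeasurable, by
    rw [eLpNorm_specTransform]; exact enorm_lt_top⟩

/-- The Fourier-Hermite transform as a linear isometry into `L²(ℕ × ℝ)`. -/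
noncomputable def specIsometry : L2Plane →ₗᵢ[ℂ] Lp ℂ 2 specMeasure where
  toFun u := (memLp_specTransform u).toLp _
  map_add' u v := by
    rw [← MemLp.toLp_add]
    refine MemLp.toLp_congr _ _ (ae_specMeasure_iff.2 fun k => ?_)
    simp only [specTransform_add]
    exact Lp.coeFn_add _ _
  map_smul' c u := by
    rw [RingHom.id_apply, ← MemLp.toLp_const_smul]
    refine MemLp.toLp_congr _ _ (ae_specMeasure_iff.2 fun k => ?_)
    simp only [specTransform_smul]
    exact Lp.coeFn_smul _ _
  norm_map' u := by
    rw [LinearMap.coe_mk, AddHom.coe_mk, Lp.norm_toLp, eLpNorm_specTransform, toReal_enorm]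

theorem coeFn_specIsometry (u : L2Plane) :
    specIsometry u =ᵐ[specMeasure] fun p => specTransform u p.1 p.2 :=
  (memLp_specTransform u).coeFn_toLp

theorem specIsometry_surjective : Function.Surjective specIsometry := by
  intro F
  have hF := (enorm_sq_L2 (f := F) (μ := specMeasure)).symm
  have hmF : Measurable (F : ℕ × ℝ → ℂ) := (Lp.stronglyMeasurable F).measurable
  rw [lintegral_specMeasure (hmF.enorm.pow_const 2).aemeasurable] at hF
  have hk : ∀ k : ℕ, eLpNorm (fun ξ => F (k, ξ)) 2 (volume : Measure ℝ) ^ 2 =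
      ∫⁻ ξ : ℝ, ‖F (k, ξ)‖ₑ ^ 2 := fun k => enorm_sq_L2
  have hfin : ∑' k : ℕ, eLpNorm (fun ξ => F (k, ξ)) 2 (volume : Measure ℝ) ^ 2 ≠ ∞ := by
    simp_rw [hk, hF]
    exact ENNReal.pow_ne_top (Lp.memLp F).2.ne
  have hmem : ∀ k : ℕ, MemLp (fun ξ => F (k, ξ)) 2 (volume : Measure ℝ) := fun k =>
    ⟨(hmF.comp measurable_prodMk_left).aestronglyMeasurable, by
      have := ENNReal.ne_top_of_tsum_ne_top hfin k
      exact lt_top_iff_ne_top.2 fun h => this (by rw [h]; simp)⟩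
  let w : ℕ → L2Line := fun k => (hmem k).toLp _
  have hw : Memℓp w 2 := by
    refine memℓp_gen ?_
    simp only [ENNReal.toReal_ofNat, Real.rpow_two]
    refine (ENNReal.summable_toReal hfin).congr fun k => ?_
    rw [Lp.norm_toLp, ENNReal.toReal_pow]
  refine ⟨isHilbertSum_specEmbed.linearIsometryEquiv.symm ⟨w, hw⟩, Lp.ext ?_⟩
  refine (coeFn_specIsometry _).trans (ae_specMeasure_iff.2 fun k => ?_)
  have h : specTransform (isHilbertSum_specEmbed.linearIsometryEquiv.symm ⟨w, hw⟩) k = w k := by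
    rw [specTransform_eq, LinearIsometryEquiv.apply_symm_apply]
  simp only [h]
  exact (hmem k).coeFn_toLp

/-- The Fourier-Hermite transform as a unitary map onto `L²(ℕ × ℝ)`. -/
noncomputable def spec : L2Plane ≃ₗᵢ[ℂ] Lp ℂ 2 specMeasure :=
  LinearIsometryEquiv.ofSurjective specIsometry specIsometry_surjective

theorem coeFn_spec (u : L2Plane) :
    spec u =ᵐ[specMeasure] fun p => specTransform u p.1 p.2 :=
  coeFn_specIsometry u

/-! ### Sobolev norms and Fourier-Hermite multipliers -/

/-- The symbol of `A` as a function on `ℕ × ℝ`. -/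
noncomputable def lam (p : ℕ × ℝ) : ℝ := symbolA p.2 p.1

theorem one_le_lam (p : ℕ × ℝ) : 1 ≤ lam p := by
  unfold lam symbolA
  have := p.1.cast_nonneg (α := ℝ)
  nlinarith [sq_nonneg (2 * Real.pi * p.2)]

theorem lam_pos (p : ℕ × ℝ) : 0 < lam p := zero_lt_one.trans_le (one_le_lam p)

theorem measurable_lam : Measurable lam := by
  refine measurable_from_prod_countable_right fun k => ?_
  unfold lam symbolA
  fun_prop

theorem sobolevNorm_eq (s : ℝ) (u : L2Plane) :
    sobolevNorm s u = eLpNorm (fun p => ((lam p ^ (s / 2) : ℝ) : ℂ) * spec u p) 2 specMeasure := by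
  have hcongr : (fun p => ((lam p ^ (s / 2) : ℝ) : ℂ) * spec u p) =ᵐ[specMeasure]
      fun p => ((lam p ^ (s / 2) : ℝ) : ℂ) * specTransform u p.1 p.2 := by
    filter_upwards [coeFn_spec u] with p hp
    rw [hp]
  rw [eLpNorm_congr_ae hcongr, eLpNorm_eq_lintegral_rpow_enorm_toReal two_ne_zero
    ENNReal.ofNat_ne_top, sobolevNorm, lintegral_specMeasure]
  · simp only [ENNReal.toReal_ofNat, ENNReal.rpow_two]
    congr 1
    refine tsum_congr fun k => lintegral_congr fun ξ => ?_
    have hpos := lam_pos (k, ξ)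
    rw [enorm_mul, mul_pow]
    congr 1
    rw [← ofReal_norm, Complex.norm_real, Real.norm_of_nonneg (by positivity),
      ← ENNReal.ofReal_pow (by positivity), ← Real.rpow_natCast, ← Real.rpow_mul hpos.le]
    simp [lam]
  · have h1 : Measurable fun p => ((lam p ^ (s / 2) : ℝ) : ℂ) :=
      Complex.measurable_ofReal.comp (measurable_lam.pow_const _)
    exact ((h1.mul (measurable_specTransform u)).enorm.pow_const _).aemeasurable

theorem sobolevNorm_zero (u : L2Plane) : sobolevNorm 0 u = ‖u‖ₑ := by
  rw [sobolevNorm_eq, ← spec.enorm_map, Lp.enorm_def]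
  simp

theorem measurable_lam_rpow (s : ℝ) : Measurable fun p => ((lam p ^ s : ℝ) : ℂ) :=
  Complex.measurable_ofReal.comp (measurable_lam.pow_const _)

theorem sobolevNorm_add_le (s : ℝ) (u v : L2Plane) :
    sobolevNorm s (u + v) ≤ sobolevNorm s u + sobolevNorm s v := by
  simp only [sobolevNorm_eq]
  have h (u : L2Plane) : AEStronglyMeasurable
      (fun p => ((lam p ^ (s / 2) : ℝ) : ℂ) * spec u p) specMeasure :=
    (measurable_lam_rpow _).aestronglyMeasurable.mul (Lp.aestronglyMeasurable _)
  refine le_trans (le_of_eq (eLpNorm_congr_ae ?_)) (eLpNorm_add_le (h u) (h v) one_le_two)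
  rw [map_add]
  filter_upwards [Lp.coeFn_add (spec u) (spec v)] with p hp
  rw [hp]
  simp [mul_add]

theorem sobolevNorm_smul (s : ℝ) (c : ℂ) (u : L2Plane) :
    sobolevNorm s (c • u) = ‖c‖ₑ * sobolevNorm s u := by
  simp only [sobolevNorm_eq]
  rw [← eLpNorm_const_smul, map_smul]
  refine eLpNorm_congr_ae ?_
  filter_upwards [Lp.coeFn_smul c (spec u)] with p hp
  rw [hp]
  simp only [Pi.smul_apply, smul_eq_mul]
  ring

theorem sobolevNorm_neg (s : ℝ) (u : L2Plane) : sobolevNorm s (-u) = sobolevNorm s u := by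
  rw [← neg_one_smul ℂ, sobolevNorm_smul]
  simp

theorem sobolevNorm_sub_le (s : ℝ) (u v : L2Plane) :
    sobolevNorm s (u - v) ≤ sobolevNorm s u + sobolevNorm s v := by
  rw [sub_eq_add_neg, ← sobolevNorm_neg s v]
  exact sobolevNorm_add_le s u (-v)

theorem sobolevNorm_mono {s t : ℝ} (hst : s ≤ t) (u : L2Plane) :
    sobolevNorm s u ≤ sobolevNorm t u := by
  simp only [sobolevNorm_eq]
  refine eLpNorm_mono fun p => ?_
  have := one_le_lam p
  have := lam_pos p
  simp only [norm_mul, Complex.norm_real]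
  rw [Real.norm_of_nonneg (by positivity), Real.norm_of_nonneg (by positivity)]
  gcongr

/-- Measurable and bounded functions on `ℕ × ℝ`. -/
def IsBddSymbol (m : ℕ × ℝ → ℂ) : Prop := Measurable m ∧ ∃ C : ℝ, ∀ p, ‖m p‖ ≤ C

theorem IsBddSymbol.memLp_mul {m : ℕ × ℝ → ℂ} (hm : IsBddSymbol m) (f : Lp ℂ 2 specMeasure) :
    MemLp (fun p => m p * f p) 2 specMeasure := by
  obtain ⟨C, hC⟩ := hm.2
  refine MemLp.of_le_mul (c := C) (Lp.memLp f)
    (hm.1.aestronglyMeasurable.mul (Lp.aestronglyMeasurable f)) ?_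
  refine Filter.Eventually.of_forall fun p => ?_
  rw [norm_mul]
  gcongr
  exact hC p

open Classical in
/-- The bounded operator on `L²(ℝ²)` with the Fourier-Hermite multiplier `m` (and `0` if `m` is not
bounded and measurable). -/
noncomputable def mulOp (m : ℕ × ℝ → ℂ) : L2Plane →L[ℂ] L2Plane :=
  if hm : IsBddSymbol m then
    spec.symm.toContinuousLinearEquiv.toContinuousLinearMap ∘L
      (LinearMap.mkContinuous
        { toFun := fun f : Lp ℂ 2 specMeasure => (hm.memLp_mul f).toLp _
          map_add' := fun f g => by
            rw [← MemLp.toLp_add]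
            refine MemLp.toLp_congr _ _ ?_
            filter_upwards [Lp.coeFn_add f g] with p hp
            rw [hp]
            simp [mul_add]
          map_smul' := fun c f => by
            rw [RingHom.id_apply, ← MemLp.toLp_const_smul]
            refine MemLp.toLp_congr _ _ ?_
            filter_upwards [Lp.coeFn_smul c f] with p hp
            rw [hp]
            simp only [Pi.smul_apply, smul_eq_mul]
            ring } hm.2.choose (fun f => by
          rw [LinearMap.coe_mk, AddHom.coe_mk]
          refine Lp.norm_le_mul_norm_of_ae_le_mul ?_
          filter_upwards [(hm.memLp_mul f).coeFn_toLp] with p hp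
          rw [hp, norm_mul]
          gcongr
          exact hm.2.choose_spec p)) ∘L
      spec.toContinuousLinearEquiv.toContinuousLinearMap
  else 0

theorem spec_mulOp {m : ℕ × ℝ → ℂ} (hm : IsBddSymbol m) (u : L2Plane) :
    spec (mulOp m u) =ᵐ[specMeasure] fun p => m p * spec u p := by
  rw [mulOp, dif_pos hm]
  have := (hm.memLp_mul (spec u)).coeFn_toLp
  refine Filter.EventuallyEq.trans (Filter.EventuallyEq.of_eq ?_) this
  simp

theorem spec_ext {u v : L2Plane} (h : spec u =ᵐ[specMeasure] spec v) : u = v :=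
  spec.injective (Lp.ext h)

end PartialHarmonic

namespace PartialHarmonic

open scoped InnerProductSpace Topology
open Filter

/-! ### Calculus of multipliers and negative powers of `A` -/

theorem IsBddSymbol.mul {m n : ℕ × ℝ → ℂ} (hm : IsBddSymbol m) (hn : IsBddSymbol n) :
    IsBddSymbol fun p => m p * n p := by
  obtain ⟨C, hC⟩ := hm.2
  obtain ⟨D, hD⟩ := hn.2
  refine ⟨hm.1.mul hn.1, C * D, fun p => ?_⟩
  rw [norm_mul]
  exact mul_le_mul (hC p) (hD p) (norm_nonneg _) ((norm_nonneg _).trans (hC p))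

theorem IsBddSymbol.sub {m n : ℕ × ℝ → ℂ} (hm : IsBddSymbol m) (hn : IsBddSymbol n) :
    IsBddSymbol fun p => m p - n p := by
  obtain ⟨C, hC⟩ := hm.2
  obtain ⟨D, hD⟩ := hn.2
  exact ⟨hm.1.sub hn.1, C + D, fun p => (norm_sub_le _ _).trans (add_le_add (hC p) (hD p))⟩

theorem mulOp_mulOp {m n : ℕ × ℝ → ℂ} (hm : IsBddSymbol m) (hn : IsBddSymbol n) (u : L2Plane) :
    mulOp m (mulOp n u) = mulOp (fun p => m p * n p) u := by
  refine spec_ext ?_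
  filter_upwards [spec_mulOp hm (mulOp n u), spec_mulOp hn u, spec_mulOp (hm.mul hn) u]
    with p h1 h2 h3
  rw [h1, h2, h3, mul_assoc]

theorem mulOp_comm {m n : ℕ × ℝ → ℂ} (hm : IsBddSymbol m) (hn : IsBddSymbol n) (u : L2Plane) :
    mulOp m (mulOp n u) = mulOp n (mulOp m u) := by
  rw [mulOp_mulOp hm hn, mulOp_mulOp hn hm]
  simp_rw [mul_comm]

theorem mulOp_sub {m n : ℕ × ℝ → ℂ} (hm : IsBddSymbol m) (hn : IsBddSymbol n) (u : L2Plane) :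
    mulOp m u - mulOp n u = mulOp (fun p => m p - n p) u := by
  refine spec_ext ?_
  rw [map_sub]
  filter_upwards [spec_mulOp hm u, spec_mulOp hn u, spec_mulOp (hm.sub hn) u,
    Lp.coeFn_sub (spec (mulOp m u)) (spec (mulOp n u))] with p h1 h2 h3 h4
  rw [h4, Pi.sub_apply, h1, h2, h3, sub_mul]

theorem mulOp_one (u : L2Plane) : mulOp (fun _ => 1) u = u := by
  have h : IsBddSymbol fun _ => 1 := ⟨measurable_const, 1, fun p => by simp⟩
  refine spec_ext ?_
  filter_upwards [spec_mulOp h u] with p hp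
  rw [hp, one_mul]

theorem enorm_mulOp {m : ℕ × ℝ → ℂ} (hm : IsBddSymbol m) (u : L2Plane) :
    ‖mulOp m u‖ₑ = eLpNorm (fun p => m p * spec u p) 2 specMeasure := by
  rw [← spec.enorm_map, Lp.enorm_def, eLpNorm_congr_ae (spec_mulOp hm u)]

theorem norm_mulOp_le {m : ℕ × ℝ → ℂ} (hm : IsBddSymbol m) {C : ℝ} (hC : ∀ p, ‖m p‖ ≤ C)
    (u : L2Plane) : ‖mulOp m u‖ ≤ C * ‖u‖ := by
  rw [← spec.norm_map, ← spec.norm_map u]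
  refine Lp.norm_le_mul_norm_of_ae_le_mul ?_
  filter_upwards [spec_mulOp hm u] with p hp
  rw [hp, norm_mul]
  gcongr
  exact hC p

theorem tendsto_of_sq_tendsto_zero {ι : Type*} {l : Filter ι} {f : ι → ℝ≥0∞}
    (h : Tendsto (fun i => f i ^ 2) l (𝓝 0)) : Tendsto f l (𝓝 0) := by
  have h2 := (ENNReal.continuous_rpow_const (y := 1 / 2)).tendsto 0 |>.comp h
  rw [ENNReal.zero_rpow_of_pos (by norm_num)] at h2
  refine h2.congr fun i => ?_
  simp only [Function.comp_apply]
  rw [← ENNReal.rpow_natCast, ← ENNReal.rpow_mul]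
  simp

/-- Dominated convergence for Fourier-Hermite multipliers. -/
theorem tendsto_mulOp {ι : Type*} {l : Filter ι} [l.IsCountablyGenerated] {m : ι → ℕ × ℝ → ℂ}
    {m₀ : ℕ × ℝ → ℂ} {C : ℝ} (hm : ∀ i, Measurable (m i)) (hm₀ : Measurable m₀)
    (hC : ∀ i p, ‖m i p‖ ≤ C) (hC₀ : ∀ p, ‖m₀ p‖ ≤ C)
    (h : ∀ p, Tendsto (fun i => m i p) l (𝓝 (m₀ p))) (u : L2Plane) :
    Tendsto (fun i => mulOp (m i) u) l (𝓝 (mulOp m₀ u)) := by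
  have hb : ∀ i, IsBddSymbol (m i) := fun i => ⟨hm i, C, hC i⟩
  have hb₀ : IsBddSymbol m₀ := ⟨hm₀, C, hC₀⟩
  rw [tendsto_iff_edist_tendsto_0]
  refine tendsto_of_sq_tendsto_zero ?_
  have he : ∀ i, edist (mulOp (m i) u) (mulOp m₀ u) ^ 2 =
      ∫⁻ p, ‖(m i p - m₀ p) * spec u p‖ₑ ^ 2 ∂specMeasure := fun i => by
    rw [edist_eq_enorm_sub, mulOp_sub (hb i) hb₀, enorm_mulOp ((hb i).sub hb₀), enorm_sq_L2]
  simp_rw [he]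
  have hu : Measurable (spec u) := (Lp.stronglyMeasurable (spec u)).measurable
  have h0 : ∫⁻ _ : ℕ × ℝ, (0 : ℝ≥0∞) ∂specMeasure = 0 := lintegral_zero
  rw [← h0]
  refine tendsto_lintegral_filter_of_dominated_convergence
    (fun p => ENNReal.ofReal (2 * C) ^ 2 * ‖spec u p‖ₑ ^ 2) ?_ ?_ ?_ ?_
  · exact Eventually.of_forall fun i => ((((hm i).sub hm₀).mul hu).enorm.pow_const 2)
  · refine Eventually.of_forall fun i => Eventually.of_forall fun p => ?_
    rw [enorm_mul, mul_pow]
    gcongr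
    rw [← ofReal_norm]
    refine ENNReal.ofReal_le_ofReal ((norm_sub_le _ _).trans ?_)
    linarith [hC i p, hC₀ p]
  · rw [lintegral_const_mul _ (hu.enorm.pow_const 2), ← enorm_sq_L2]
    exact ENNReal.mul_ne_top (ENNReal.pow_ne_top ENNReal.ofReal_ne_top)
      (ENNReal.pow_ne_top (Lp.memLp (spec u)).2.ne)
  · refine Eventually.of_forall fun p => ?_
    have h1 : Tendsto (fun i => (m i p - m₀ p) * spec u p) l (𝓝 0) := by
      have := ((h p).sub_const (m₀ p)).mul_const (spec u p)
      simpa using this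
    have h2 := (ENNReal.continuous_pow 2).tendsto _ |>.comp h1.enorm
    simpa [Function.comp_def] using h2

theorem isBddSymbol_lam_rpow {s : ℝ} (hs : s ≤ 0) :
    IsBddSymbol fun p => ((lam p ^ s : ℝ) : ℂ) := by
  refine ⟨measurable_lam_rpow s, 1, fun p => ?_⟩
  have := lam_pos p
  rw [Complex.norm_real, Real.norm_of_nonneg (by positivity)]
  exact Real.rpow_le_one_of_one_le_of_nonpos (one_le_lam p) hs

/-- The bounded operator `A^{-r/2}`, for `0 ≤ r`. It maps `L²` isometrically onto `ℋ^r`. -/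
noncomputable def potA (r : ℝ) : L2Plane →L[ℂ] L2Plane :=
  mulOp fun p => ((lam p ^ (-(r / 2)) : ℝ) : ℂ)

theorem isBddSymbol_potA {r : ℝ} (hr : 0 ≤ r) :
    IsBddSymbol fun p => ((lam p ^ (-(r / 2)) : ℝ) : ℂ) :=
  isBddSymbol_lam_rpow (by linarith)

theorem spec_potA {r : ℝ} (hr : 0 ≤ r) (u : L2Plane) :
    spec (potA r u) =ᵐ[specMeasure] fun p => ((lam p ^ (-(r / 2)) : ℝ) : ℂ) * spec u p :=
  spec_mulOp (isBddSymbol_potA hr) u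

theorem sobolevNorm_potA {r : ℝ} (hr : 0 ≤ r) (s : ℝ) (w : L2Plane) :
    sobolevNorm s (potA r w) = sobolevNorm (s - r) w := by
  rw [sobolevNorm_eq, sobolevNorm_eq]
  refine eLpNorm_congr_ae ?_
  filter_upwards [spec_potA hr w] with p hp
  rw [hp, ← mul_assoc, ← Complex.ofReal_mul, ← Real.rpow_add (lam_pos p)]
  congr 4
  ring

theorem sobolevNorm_potA_self {r : ℝ} (hr : 0 ≤ r) (w : L2Plane) :
    sobolevNorm r (potA r w) = ‖w‖ₑ := by
  rw [sobolevNorm_potA hr, sub_self, sobolevNorm_zero]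

theorem potA_potA {r s : ℝ} (hr : 0 ≤ r) (hs : 0 ≤ s) (w : L2Plane) :
    potA r (potA s w) = potA (r + s) w := by
  rw [potA, potA, mulOp_mulOp (isBddSymbol_potA hr) (isBddSymbol_potA hs), potA]
  congr 2
  funext p
  rw [← Complex.ofReal_mul, ← Real.rpow_add (lam_pos p)]
  congr 2
  ring

theorem potA_zero (w : L2Plane) : potA 0 w = w := by
  rw [potA]
  simpa using mulOp_one w

theorem lam_rpow_mul_neg (p : ℕ × ℝ) (s : ℝ) :
    ((lam p ^ s : ℝ) : ℂ) * ((lam p ^ (-s) : ℝ) : ℂ) = 1 := by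
  rw [← Complex.ofReal_mul, ← Real.rpow_add (lam_pos p)]
  simp

theorem potA_injective {r : ℝ} (hr : 0 ≤ r) : Function.Injective (potA r) := by
  rw [injective_iff_map_eq_zero]
  intro w hw
  have h := sobolevNorm_potA_self hr w
  rw [hw, sobolevNorm_eq, map_zero] at h
  have h0 : eLpNorm (fun p => ((lam p ^ (r / 2) : ℝ) : ℂ) * (0 : Lp ℂ 2 specMeasure) p) 2
      specMeasure = 0 := by
    rw [eLpNorm_congr_ae (g := 0)]
    · exact eLpNorm_zero
    · filter_upwards [Lp.coeFn_zero ℂ 2 specMeasure] with p hp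
      rw [hp]
      simp
  rw [h0] at h
  exact enorm_eq_zero.1 h.symm

/-- The elements of `ℋ^r` are the `A^{-r/2} w` with `w ∈ L²`; this replaces functions with values in
`ℋ^r` by functions with values in `L²`. -/
theorem exists_potA_eq {r : ℝ} (hr : 0 ≤ r) {u : L2Plane} (hu : sobolevNorm r u < ∞) :
    ∃ w, potA r w = u := by
  rw [sobolevNorm_eq] at hu
  have hmem : MemLp (fun p => ((lam p ^ (r / 2) : ℝ) : ℂ) * spec u p) 2 specMeasure :=
    ⟨(measurable_lam_rpow _).aestronglyMeasurable.mul (Lp.aestronglyMeasurable _), hu⟩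
  refine ⟨spec.symm (hmem.toLp _), spec_ext ?_⟩
  filter_upwards [spec_potA hr (spec.symm (hmem.toLp _)), hmem.coeFn_toLp] with p hp hp2
  rw [hp, LinearIsometryEquiv.apply_symm_apply, hp2, ← mul_assoc, mul_comm (Complex.ofReal _),
    lam_rpow_mul_neg, one_mul]

theorem sobolevNorm_potA_lt_top {r s : ℝ} (hr : 0 ≤ r) (hs : s ≤ r) (w : L2Plane) :
    sobolevNorm s (potA r w) < ∞ := by
  refine (sobolevNorm_mono hs _).trans_lt ?_
  rw [sobolevNorm_potA_self hr]
  exact enorm_lt_top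

/-! ### The operators of the statement as multipliers -/

theorem isMultiplier_iff {m : ℝ → ℕ → ℂ} {u v : L2Plane} :
    IsMultiplier m u v ↔ spec v =ᵐ[specMeasure] fun p => m p.2 p.1 * spec u p := by
  have h : IsMultiplier m u v ↔ ∀ᵐ p ∂specMeasure,
      specTransform v p.1 p.2 = m p.2 p.1 * specTransform u p.1 p.2 := by
    rw [ae_specMeasure_iff]
    rfl
  rw [h]
  constructor
  · intro h1
    filter_upwards [h1, coeFn_spec u, coeFn_spec v] with p h2 h3 h4
    rw [h3, h4, h2]
  · intro h1
    filter_upwards [h1, coeFn_spec u, coeFn_spec v] with p h2 h3 h4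
    rw [← h3, ← h4, h2]

theorem multiplier_eq {m : ℝ → ℕ → ℂ} {u v : L2Plane}
    (h : spec v =ᵐ[specMeasure] fun p => m p.2 p.1 * spec u p) : multiplier m u = v := by
  have hex : ∃ v, IsMultiplier m u v := ⟨v, isMultiplier_iff.2 h⟩
  rw [multiplier, dif_pos hex]
  exact spec_ext ((isMultiplier_iff.1 hex.choose_spec).trans h.symm)

theorem powA_potA (k : ℕ) {r : ℝ} (hr : 0 ≤ r) (w : L2Plane) :
    powA k (potA (r + 2 * k) w) = potA r w := by
  refine multiplier_eq ?_
  filter_upwards [spec_potA hr w, spec_potA (r := r + 2 * k) (by positivity) w] with p h1 h2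
  rw [h1, h2, ← mul_assoc]
  congr 1
  change _ = ((lam p : ℝ) : ℂ) ^ k * _
  rw [← Complex.ofReal_pow, ← Complex.ofReal_mul, ← Real.rpow_natCast,
    ← Real.rpow_add (lam_pos p)]
  congr 2
  ring

/-- The unitary group `e^{itA}` as a family of bounded operators. -/
noncomputable def expA (t : ℝ) : L2Plane →L[ℂ] L2Plane :=
  mulOp fun p => Complex.exp (Complex.I * (t : ℂ) * ((lam p : ℝ) : ℂ))

theorem norm_exp_lam (t : ℝ) (p : ℕ × ℝ) :
    ‖Complex.exp (Complex.I * (t : ℂ) * ((lam p : ℝ) : ℂ))‖ = 1 := by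
  rw [Complex.norm_exp]
  simp

theorem measurable_exp_lam (t : ℝ) :
    Measurable fun p => Complex.exp (Complex.I * (t : ℂ) * ((lam p : ℝ) : ℂ)) :=
  Complex.measurable_exp.comp ((Complex.measurable_ofReal.comp measurable_lam).const_mul _)

theorem isBddSymbol_expA (t : ℝ) :
    IsBddSymbol fun p => Complex.exp (Complex.I * (t : ℂ) * ((lam p : ℝ) : ℂ)) :=
  ⟨measurable_exp_lam t, 1, fun p => (norm_exp_lam t p).le⟩

theorem groupA_eq (t : ℝ) (u : L2Plane) : groupA t u = expA t u :=
  multiplier_eq (spec_mulOp (isBddSymbol_expA t) u)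

theorem expA_add (s t : ℝ) (u : L2Plane) : expA (s + t) u = expA s (expA t u) := by
  rw [expA, expA, expA, mulOp_mulOp (isBddSymbol_expA s) (isBddSymbol_expA t)]
  congr 2
  funext p
  rw [← Complex.exp_add]
  congr 1
  push_cast
  ring

theorem expA_zero (u : L2Plane) : expA 0 u = u := by
  rw [expA]
  simpa using mulOp_one u

theorem norm_expA_le (t : ℝ) (u : L2Plane) : ‖expA t u‖ ≤ ‖u‖ :=
  (norm_mulOp_le (isBddSymbol_expA t) (fun p => (norm_exp_lam t p).le) u).trans_eq (one_mul _)

theorem expA_potA {r : ℝ} (hr : 0 ≤ r) (t : ℝ) (u : L2Plane) :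
    expA t (potA r u) = potA r (expA t u) :=
  mulOp_comm (isBddSymbol_expA t) (isBddSymbol_potA hr) u

theorem continuous_expA (u : L2Plane) : Continuous fun t => expA t u := by
  rw [continuous_iff_continuousAt]
  intro t
  refine tendsto_mulOp (C := 1) (fun s => measurable_exp_lam s) (measurable_exp_lam t)
    (fun s p => (norm_exp_lam s p).le) (fun p => (norm_exp_lam t p).le) (fun p => ?_) u
  have : Continuous fun s : ℝ => Complex.exp (Complex.I * (s : ℂ) * ((lam p : ℝ) : ℂ)) := by
    fun_prop
  exact this.tendsto t

theorem continuous_expA_uncurry : Continuous fun q : ℝ × L2Plane => expA q.1 q.2 := by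
  rw [continuous_iff_continuousAt]
  rintro ⟨t, u⟩
  rw [ContinuousAt, tendsto_iff_norm_sub_tendsto_zero]
  have h1 : Tendsto (fun q : ℝ × L2Plane => ‖q.2 - u‖ + ‖expA q.1 u - expA t u‖) (𝓝 (t, u))
      (𝓝 (‖u - u‖ + ‖expA t u - expA t u‖)) := by
    have : Continuous fun q : ℝ × L2Plane => ‖q.2 - u‖ + ‖expA q.1 u - expA t u‖ :=
      (continuous_snd.sub continuous_const).norm.add
        ((((continuous_expA u).comp continuous_fst).sub continuous_const).norm)
    exact this.tendsto (t, u)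
  simp only [sub_self, norm_zero, add_zero] at h1
  refine squeeze_zero (fun _ => norm_nonneg _) (fun q => ?_) h1
  calc ‖expA q.1 q.2 - expA t u‖ = ‖expA q.1 (q.2 - u) + (expA q.1 u - expA t u)‖ := by
        rw [map_sub]; abel_nf
    _ ≤ _ := (norm_add_le _ _).trans (by gcongr; exact norm_expA_le _ _)

/-- `i A` generates the group `e^{itA}`, on the domain `ℋ² = A^{-1} L²`. -/
theorem hasDerivAt_expA_zero (w : L2Plane) :
    HasDerivAt (fun t => expA t (potA 2 w)) (Complex.I • w) 0 := by
  rw [hasDerivAt_iff_tendsto_slope_zero]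
  simp only [zero_add, expA_zero]
  -- the difference quotients are multipliers applied to `w`, bounded by `1` since
  -- `|e^{itλ} - 1| ≤ |t| λ`, so that dominated convergence applies
  set m : ℝ → ℕ × ℝ → ℂ := fun t p => (t : ℂ)⁻¹ *
    (Complex.exp (Complex.I * (t : ℂ) * ((lam p : ℝ) : ℂ)) - 1) * ((lam p ^ (-(1 : ℝ)) : ℝ) : ℂ)
    with hm
  have hmeas : ∀ t, Measurable (m t) := fun t =>
    (((measurable_exp_lam t).sub_const 1).const_mul _).mul (measurable_lam_rpow _)
  have hbd : ∀ t p, ‖m t p‖ ≤ 1 := by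
    intro t p
    have hl := lam_pos p
    rw [hm]
    simp only [norm_mul, norm_inv, Complex.norm_real, Real.norm_eq_abs]
    have h1 : ‖Complex.exp (Complex.I * (t : ℂ) * ((lam p : ℝ) : ℂ)) - 1‖ ≤ |t * lam p| := by
      have := Real.norm_exp_I_mul_ofReal_sub_one_le (x := t * lam p)
      rw [Real.norm_eq_abs] at this
      convert this using 4
      push_cast
      ring
    rw [Real.rpow_neg hl.le, Real.rpow_one, abs_of_pos (inv_pos.2 hl)]
    rcases eq_or_ne t 0 with rfl | ht
    · simp
    · calc |t|⁻¹ * ‖Complex.exp (Complex.I * (t : ℂ) * ((lam p : ℝ) : ℂ)) - 1‖ * (lam p)⁻¹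
          ≤ |t|⁻¹ * |t * lam p| * (lam p)⁻¹ := by gcongr
        _ = 1 := by
          rw [abs_mul, abs_of_pos hl]
          field_simp
  have hconv : ∀ t : ℝ, t⁻¹ • (expA t (potA 2 w) - potA 2 w) = mulOp (m t) w := by
    intro t
    refine spec_ext ?_
    have e : spec (t⁻¹ • (expA t (potA 2 w) - potA 2 w)) =
        ((t : ℂ)⁻¹) • (spec (expA t (potA 2 w)) - spec (potA 2 w)) := by
      rw [← map_sub, ← map_smul]
      congr 1
      rw [← Complex.ofReal_inv]
      rfl
    rw [e]
    filter_upwards [spec_mulOp ⟨hmeas t, 1, hbd t⟩ w, spec_potA (r := 2) (by norm_num) w,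
      spec_mulOp (isBddSymbol_expA t) (potA 2 w),
      Lp.coeFn_smul ((t : ℂ)⁻¹) (spec (expA t (potA 2 w)) - spec (potA 2 w)),
      Lp.coeFn_sub (spec (expA t (potA 2 w))) (spec (potA 2 w))] with p h1 h2 h3 h4 h5
    rw [h4, Pi.smul_apply, h5, Pi.sub_apply, h1]
    rw [expA, h3, h2, hm]
    norm_num
    ring
  simp_rw [hconv]
  have hlim : mulOp (fun _ => Complex.I) w = Complex.I • w := by
    refine spec_ext ?_
    rw [map_smul]
    filter_upwards [spec_mulOp (m := fun _ => Complex.I) ⟨measurable_const, 1, fun p => by simp⟩ w,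
      Lp.coeFn_smul Complex.I (spec w)] with p h1 h2
    rw [h1, h2]
    rfl
  rw [← hlim]
  refine tendsto_mulOp (C := 1) hmeas measurable_const hbd (fun p => by simp) (fun p => ?_) w
  have hl := lam_pos p
  have hd : HasDerivAt (fun t : ℝ => Complex.exp (Complex.I * (t : ℂ) * ((lam p : ℝ) : ℂ)))
      (Complex.I * ((lam p : ℝ) : ℂ)) 0 := by
    have h1 : HasDerivAt (fun t : ℝ => Complex.I * (t : ℂ) * ((lam p : ℝ) : ℂ))
        (Complex.I * ((lam p : ℝ) : ℂ)) 0 := by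
      have := ((hasDerivAt_id (0 : ℝ)).ofReal_comp.const_mul Complex.I).mul_const ((lam p : ℝ) : ℂ)
      simpa using this
    simpa using h1.cexp
  rw [hasDerivAt_iff_tendsto_slope_zero] at hd
  have := hd.mul_const ((lam p ^ (-(1 : ℝ)) : ℝ) : ℂ)
  have e1 : Complex.I * ((lam p : ℝ) : ℂ) * ((lam p ^ (-(1 : ℝ)) : ℝ) : ℂ) = Complex.I := by
    rw [mul_assoc]
    have := lam_rpow_mul_neg p 1
    rw [Real.rpow_one] at this
    rw [this, mul_one]
  rw [e1] at this
  refine this.congr fun t => ?_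
  simp [hm]

theorem hasDerivAt_expA (w : L2Plane) (t : ℝ) :
    HasDerivAt (fun t => expA t (potA 2 w)) (expA t (Complex.I • w)) t := by
  have h0 := hasDerivAt_expA_zero w
  have h1 : HasDerivAt (fun s => expA (s - t) (potA 2 w)) (Complex.I • w) t := by
    have : HasDerivAt (fun s => expA s (potA 2 w)) (Complex.I • w) (t - t) := by
      simpa using h0
    exact this.comp_sub_const t t
  have h2 := ((expA t).restrictScalars ℝ).hasFDerivAt.comp_hasDerivAt t h1
  refine h2.congr_of_eventuallyEq (Eventually.of_forall fun s => ?_)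
  simp only [Function.comp_apply, ContinuousLinearMap.coe_restrictScalars']
  rw [← expA_add]
  ring_nf

end PartialHarmonic

namespace PartialHarmonic

open scoped InnerProductSpace Topology SchwartzMap LineDeriv ContDiff
open Filter SchwartzMap

/-! ### Schwartz functions in the plane -/

/-- The tensor product `φ(x) g(y)` of two Schwartz functions of one variable. -/
noncomputable def tensorSchwartz (φ g : 𝓢(ℝ, ℂ)) : 𝓢(ℝ × ℝ, ℂ) where
  toFun z := φ z.1 * g z.2
  smooth' := ((φ.smooth ⊤).comp contDiff_fst).mul ((g.smooth ⊤).comp contDiff_snd)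
  decay' k n := by
    have hb : ∀ (f : 𝓢(ℝ, ℂ)) (L : ℝ × ℝ →L[ℝ] ℝ), ‖L‖ ≤ 1 → ∀ i z,
        ‖iteratedFDeriv ℝ i (fun z => f (L z)) z‖ ≤ ‖iteratedFDeriv ℝ i f (L z)‖ := by
      intro f L hL i z
      have h1 := L.iteratedFDeriv_comp_right (f.smooth ⊤) z (i := i) (by exact_mod_cast le_top)
      have h2 : iteratedFDeriv ℝ i (fun z => f (L z)) z = iteratedFDeriv ℝ i (f ∘ L) z := rfl
      rw [h2, h1]
      refine (ContinuousMultilinearMap.norm_compContinuousLinearMap_le _ _).trans ?_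
      refine mul_le_of_le_one_right (norm_nonneg _) ?_
      exact Finset.prod_le_one (fun _ _ => norm_nonneg _) fun _ _ => hL
    have hd : ∀ f : 𝓢(ℝ, ℂ), ∃ C, ∀ i ≤ n, ∀ x,
        (1 + ‖x‖) ^ k * ‖iteratedFDeriv ℝ i f x‖ ≤ C := fun f =>
      ⟨_, fun i hi x => f.one_add_le_sup_seminorm_apply (𝕜 := ℝ) (m := (k, n)) le_rfl hi x⟩
    obtain ⟨C, hC⟩ := hd φ
    obtain ⟨D, hD⟩ := hd g
    have hC0 : 0 ≤ C := le_trans (by positivity) (hC 0 (Nat.zero_le _) 0)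
    refine ⟨∑ i ∈ Finset.range (n + 1), n.choose i * C * D, fun z => ?_⟩
    have hφ := (φ.smooth ⊤).comp (contDiff_fst (𝕜 := ℝ) (E := ℝ) (F := ℝ))
    have hg := (g.smooth ⊤).comp (contDiff_snd (𝕜 := ℝ) (E := ℝ) (F := ℝ))
    have h := norm_iteratedFDeriv_mul_le hφ hg z (n := n) (by exact_mod_cast le_top)
    refine (mul_le_mul_of_nonneg_left h (by positivity)).trans ?_
    rw [Finset.mul_sum]
    refine Finset.sum_le_sum fun i hi => ?_
    have hi' : i ≤ n := by simpa [Nat.lt_succ_iff] using hi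
    have e1 := hb φ (ContinuousLinearMap.fst ℝ ℝ ℝ) (ContinuousLinearMap.norm_fst_le ..) i z
    have e2 := hb g (ContinuousLinearMap.snd ℝ ℝ ℝ) (ContinuousLinearMap.norm_snd_le ..) (n - i) z
    have e3 := hC i hi' z.1
    have e4 := hD (n - i) (Nat.sub_le _ _) z.2
    have e5 : ‖z‖ ≤ (1 + ‖z.1‖) * (1 + ‖z.2‖) := by
      rw [Prod.norm_def]
      refine max_le ?_ ?_ <;> nlinarith [norm_nonneg z.1, norm_nonneg z.2]
    calc ‖z‖ ^ k * (n.choose i * ‖iteratedFDeriv ℝ i (φ ∘ Prod.fst) z‖ *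
          ‖iteratedFDeriv ℝ (n - i) (g ∘ Prod.snd) z‖)
        ≤ ((1 + ‖z.1‖) * (1 + ‖z.2‖)) ^ k * (n.choose i * ‖iteratedFDeriv ℝ i φ z.1‖ *
          ‖iteratedFDeriv ℝ (n - i) g z.2‖) := by
          gcongr
          · exact e1
          · exact e2
      _ = n.choose i * ((1 + ‖z.1‖) ^ k * ‖iteratedFDeriv ℝ i φ z.1‖) *
          ((1 + ‖z.2‖) ^ k * ‖iteratedFDeriv ℝ (n - i) g z.2‖) := by rw [mul_pow]; ring
      _ ≤ n.choose i * C * D := by gcongr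

@[simp] theorem tensorSchwartz_apply (φ g : 𝓢(ℝ, ℂ)) (z : ℝ × ℝ) :
    tensorSchwartz φ g z = φ z.1 * g z.2 := rfl

/-- The product of two Schwartz functions. -/
noncomputable def mulSchwartz (f g : 𝓢(ℝ × ℝ, ℂ)) : 𝓢(ℝ × ℝ, ℂ) :=
  pairing (ContinuousLinearMap.mul ℂ ℂ) f g

@[simp] theorem mulSchwartz_apply (f g : 𝓢(ℝ × ℝ, ℂ)) (z : ℝ × ℝ) :
    mulSchwartz f g z = f z * g z := rfl

/-- The partial derivative in `x`. -/
noncomputable def derivX (f : 𝓢(ℝ × ℝ, ℂ)) : 𝓢(ℝ × ℝ, ℂ) := ∂_{((1 : ℝ), (0 : ℝ))} f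

/-- The partial derivative in `y`. -/
noncomputable def derivY (f : 𝓢(ℝ × ℝ, ℂ)) : 𝓢(ℝ × ℝ, ℂ) := ∂_{((0 : ℝ), (1 : ℝ))} f

/-- Multiplication by `y`. -/
noncomputable def mulY (f : 𝓢(ℝ × ℝ, ℂ)) : 𝓢(ℝ × ℝ, ℂ) :=
  smulLeftCLM ℂ (fun z : ℝ × ℝ => z.2) f

/-- The creation operator `y - ∂_y`. -/
noncomputable def create (f : 𝓢(ℝ × ℝ, ℂ)) : 𝓢(ℝ × ℝ, ℂ) := mulY f - derivY f

/-- The annihilation operator `y + ∂_y`. -/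
noncomputable def annihilate (f : 𝓢(ℝ × ℝ, ℂ)) : 𝓢(ℝ × ℝ, ℂ) := mulY f + derivY f

theorem mulY_apply (f : 𝓢(ℝ × ℝ, ℂ)) (z : ℝ × ℝ) : mulY f z = (z.2 : ℂ) * f z := by
  have h : Function.HasTemperateGrowth fun z : ℝ × ℝ => z.2 :=
    (ContinuousLinearMap.snd ℝ ℝ ℝ).hasTemperateGrowth
  rw [mulY, smulLeftCLM_apply_apply h]
  simp

theorem hasDerivAt_derivX (f : 𝓢(ℝ × ℝ, ℂ)) (x y : ℝ) :
    HasDerivAt (fun x => f (x, y)) (derivX f (x, y)) x := by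
  have h1 : HasDerivAt (fun x : ℝ => (x, y)) ((1 : ℝ), (0 : ℝ)) x :=
    (hasDerivAt_id x).prodMk (hasDerivAt_const x y)
  have := (f.hasFDerivAt (x, y)).comp_hasDerivAt x h1
  rwa [← lineDerivOp_apply_eq_fderiv] at this

theorem hasDerivAt_derivY (f : 𝓢(ℝ × ℝ, ℂ)) (x y : ℝ) :
    HasDerivAt (fun y => f (x, y)) (derivY f (x, y)) y := by
  have h1 : HasDerivAt (fun y : ℝ => (x, y)) ((0 : ℝ), (1 : ℝ)) y :=
    (hasDerivAt_const y x).prodMk (hasDerivAt_id y)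
  have := (f.hasFDerivAt (x, y)).comp_hasDerivAt y h1
  rwa [← lineDerivOp_apply_eq_fderiv] at this

theorem derivX_mul (f g : 𝓢(ℝ × ℝ, ℂ)) :
    derivX (mulSchwartz f g) = mulSchwartz (derivX f) g + mulSchwartz f (derivX g) := by
  ext ⟨x, y⟩
  exact (hasDerivAt_derivX _ x y).unique ((hasDerivAt_derivX f x y).mul (hasDerivAt_derivX g x y))

theorem derivY_mul (f g : 𝓢(ℝ × ℝ, ℂ)) :
    derivY (mulSchwartz f g) = mulSchwartz (derivY f) g + mulSchwartz f (derivY g) := by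
  ext ⟨x, y⟩
  exact (hasDerivAt_derivY _ x y).unique ((hasDerivAt_derivY f x y).mul (hasDerivAt_derivY g x y))

theorem create_mul (f g : 𝓢(ℝ × ℝ, ℂ)) :
    create (mulSchwartz f g) = mulSchwartz (create f) g - mulSchwartz f (derivY g) := by
  ext z
  simp only [create, derivY_mul, sub_apply, add_apply, mulSchwartz_apply, mulY_apply]
  ring

theorem derivX_tensorSchwartz (φ g : 𝓢(ℝ, ℂ)) :
    derivX (tensorSchwartz φ g) = tensorSchwartz (∂_{(1 : ℝ)} φ) g := by
  ext ⟨x, y⟩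
  have h1 : HasDerivAt φ (∂_{(1 : ℝ)} φ x) x := by
    rw [lineDerivOp_apply_eq_fderiv]
    exact (φ.hasFDerivAt x).hasDerivAt
  exact (hasDerivAt_derivX _ x y).unique (h1.mul_const (g y))

theorem derivY_tensorSchwartz_apply (φ : 𝓢(ℝ, ℂ)) (k : ℕ) (z : ℝ × ℝ) :
    derivY (tensorSchwartz φ (hermiteSchwartz k)) z = φ z.1 *
      ((z.2 * hermiteFun k z.2 - √(2 * (k + 1)) * hermiteFun (k + 1) z.2 : ℝ) : ℂ) := by
  obtain ⟨x, y⟩ := z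
  refine (hasDerivAt_derivY _ x y).unique ?_
  have := (hasDerivAt_hermiteFun k y).ofReal_comp.const_mul (φ x)
  simpa using this

theorem integral_mul_derivX (f g : 𝓢(ℝ × ℝ, ℂ)) :
    ∫ z, f z * derivX g z = -∫ z, derivX f z * g z :=
  integral_mul_lineDerivOp_right_eq_neg_left f g _

theorem integral_mul_derivY (f g : 𝓢(ℝ × ℝ, ℂ)) :
    ∫ z, f z * derivY g z = -∫ z, derivY f z * g z :=
  integral_mul_lineDerivOp_right_eq_neg_left f g _

theorem integrable_mul (f g : 𝓢(ℝ × ℝ, ℂ)) : Integrable fun z => f z * g z :=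
  (mulSchwartz f g).integrable

/-- The pointwise complex conjugate of a Schwartz function. -/
noncomputable def conjSchwartz {E : Type*} [NormedAddCommGroup E] [NormedSpace ℝ E]
    (f : 𝓢(E, ℂ)) : 𝓢(E, ℂ) :=
  postcompCLM (𝕜 := ℝ) Complex.conjCLE.toContinuousLinearMap f

@[simp] theorem conjSchwartz_apply {E : Type*} [NormedAddCommGroup E] [NormedSpace ℝ E]
    (f : 𝓢(E, ℂ)) (x : E) : conjSchwartz f x = (starRingEnd ℂ) (f x) := rfl

/-- The element of `L²(ℝ²)` given by a Schwartz function. -/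
noncomputable def toL2 (f : 𝓢(ℝ × ℝ, ℂ)) : L2Plane := f.toLp 2 volume

theorem coeFn_toL2 (f : 𝓢(ℝ × ℝ, ℂ)) : toL2 f =ᵐ[volume] f := f.coeFn_toLp 2 volume

theorem toL2_add (f g : 𝓢(ℝ × ℝ, ℂ)) : toL2 (f + g) = toL2 f + toL2 g :=
  (toLpCLM ℂ ℂ 2 (volume : Measure (ℝ × ℝ))).map_add f g

theorem toL2_sub (f g : 𝓢(ℝ × ℝ, ℂ)) : toL2 (f - g) = toL2 f - toL2 g :=
  (toLpCLM ℂ ℂ 2 (volume : Measure (ℝ × ℝ))).map_sub f g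

theorem toL2_smul (c : ℂ) (f : 𝓢(ℝ × ℝ, ℂ)) : toL2 (c • f) = c • toL2 f :=
  (toLpCLM ℂ ℂ 2 (volume : Measure (ℝ × ℝ))).map_smul c f

theorem tensorHermiteLM_toLp (k : ℕ) (φ : 𝓢(ℝ, ℂ)) :
    tensorHermiteLM k (φ.toLp 2 volume) = toL2 (tensorSchwartz φ (hermiteSchwartz k)) := by
  refine Lp.ext ?_
  have h := (Measure.quasiMeasurePreserving_fst (μ := (volume : Measure ℝ))
      (ν := (volume : Measure ℝ))).ae (φ.coeFn_toLp 2 volume)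
  filter_upwards [coeFn_tensorHermiteLM k (φ.toLp 2 volume), coeFn_toL2
    (tensorSchwartz φ (hermiteSchwartz k)), h] with z h1 h2 h3
  rw [h1, h2, h3]
  simp

/-- Testing a Hermite coefficient of `f` against `φ` amounts to testing `f` against the Schwartz
function `φ(x) h_k(y)`, where one can integrate by parts. -/
theorem integral_mul_hermiteCoeff (k : ℕ) (φ : 𝓢(ℝ, ℂ)) (f : 𝓢(ℝ × ℝ, ℂ)) :
    ∫ x, φ x * hermiteCoeff k (toL2 f) x =
      ∫ z, tensorSchwartz φ (hermiteSchwartz k) z * f z := by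
  have h := inner_tensorHermiteLM k ((conjSchwartz φ).toLp 2 volume) (toL2 f)
  rw [L2.inner_def, L2.inner_def, tensorHermiteLM_toLp] at h
  refine Eq.trans (integral_congr_ae ?_) (h.symm.trans (integral_congr_ae ?_))
  · filter_upwards [(conjSchwartz φ).coeFn_toLp 2 volume] with x hx
    rw [hx]
    simp [mul_comm]
  · filter_upwards [coeFn_toL2 f, coeFn_toL2 (tensorSchwartz (conjSchwartz φ) (hermiteSchwartz k))]
      with z h1 h2
    rw [h1, h2]
    simp [mul_comm]

theorem L2Line.locallyIntegrable (c : L2Line) : LocallyIntegrable (c : ℝ → ℂ) volume :=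
  (Lp.memLp c).locallyIntegrable one_le_two

theorem ae_eq_of_integral_schwartz_mul {c d : ℝ → ℂ} (hc : LocallyIntegrable c volume)
    (hd : LocallyIntegrable d volume)
    (h : ∀ φ : 𝓢(ℝ, ℂ), ∫ x, φ x * c x = ∫ x, φ x * d x) : c =ᵐ[volume] d := by
  refine ae_eq_of_integral_contDiff_smul_eq hc hd fun g hg hgc => ?_
  have hgc' : HasCompactSupport (fun x => (g x : ℂ)) := hgc.comp_left Complex.ofReal_zero
  have hg' : ContDiff ℝ ∞ (fun x => (g x : ℂ)) := Complex.ofRealCLM.contDiff.comp hg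
  have := h (hgc'.toSchwartzMap hg')
  simpa using this

/-- The creation operator on Hermite coefficients. For `k = 0` the truncated index `k - 1` is
harmless, since its factor `√(2k)` vanishes. -/
theorem hermiteCoeff_create (k : ℕ) (f : 𝓢(ℝ × ℝ, ℂ)) :
    hermiteCoeff k (toL2 (create f)) =
      ((√(2 * k) : ℝ) : ℂ) • hermiteCoeff (k - 1) (toL2 f) := by
  refine Lp.ext (ae_eq_of_integral_schwartz_mul (L2Line.locallyIntegrable _)
    (L2Line.locallyIntegrable _) fun φ => ?_)
  have h1 : ∫ x, φ x * (((√(2 * k) : ℝ) : ℂ) • hermiteCoeff (k - 1) (toL2 f) : L2Line) x =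
      ((√(2 * k) : ℝ) : ℂ) * ∫ x, φ x * hermiteCoeff (k - 1) (toL2 f) x := by
    rw [← integral_const_mul]
    refine integral_congr_ae ?_
    filter_upwards [Lp.coeFn_smul ((√(2 * k) : ℝ) : ℂ) (hermiteCoeff (k - 1) (toL2 f))] with x hx
    rw [hx]
    simp
    ring
  rw [h1, integral_mul_hermiteCoeff, integral_mul_hermiteCoeff]
  set t := tensorSchwartz φ (hermiteSchwartz k) with ht
  have h2 : ∫ z, t z * create f z = (∫ z, t z * mulY f z) - ∫ z, t z * derivY f z := by
    rw [← integral_sub (integrable_mul _ _) (integrable_mul _ _)]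
    simp [create, mul_sub]
  rw [h2, integral_mul_derivY, sub_neg_eq_add, ← integral_add (integrable_mul _ _)
    (integrable_mul _ _), ← integral_const_mul]
  refine integral_congr_ae (Eventually.of_forall fun z => ?_)
  simp only [ht, derivY_tensorSchwartz_apply, tensorSchwartz_apply, hermiteSchwartz_apply,
    mulY_apply]
  have := congrArg (fun x : ℝ => (x : ℂ)) (mul_hermiteFun k z.2)
  push_cast at this ⊢
  linear_combination (φ z.1 * f z) * this

theorem hermiteCoeff_annihilate (k : ℕ) (f : 𝓢(ℝ × ℝ, ℂ)) :
    hermiteCoeff k (toL2 (annihilate f)) =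
      ((√(2 * (k + 1)) : ℝ) : ℂ) • hermiteCoeff (k + 1) (toL2 f) := by
  refine Lp.ext (ae_eq_of_integral_schwartz_mul (L2Line.locallyIntegrable _)
    (L2Line.locallyIntegrable _) fun φ => ?_)
  have h1 : ∫ x, φ x * (((√(2 * (k + 1)) : ℝ) : ℂ) • hermiteCoeff (k + 1) (toL2 f) : L2Line) x =
      ((√(2 * (k + 1)) : ℝ) : ℂ) * ∫ x, φ x * hermiteCoeff (k + 1) (toL2 f) x := by
    rw [← integral_const_mul]
    refine integral_congr_ae ?_
    filter_upwards [Lp.coeFn_smul ((√(2 * (k + 1)) : ℝ) : ℂ) (hermiteCoeff (k + 1) (toL2 f))]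
      with x hx
    rw [hx]
    simp
    ring
  rw [h1, integral_mul_hermiteCoeff, integral_mul_hermiteCoeff]
  set t := tensorSchwartz φ (hermiteSchwartz k) with ht
  have h2 : ∫ z, t z * annihilate f z = (∫ z, t z * mulY f z) + ∫ z, t z * derivY f z := by
    rw [← integral_add (integrable_mul _ _) (integrable_mul _ _)]
    simp [annihilate, mul_add]
  rw [h2, integral_mul_derivY, ← sub_eq_add_neg, ← integral_sub (integrable_mul _ _)
    (integrable_mul _ _), ← integral_const_mul]
  refine integral_congr_ae (Eventually.of_forall fun z => ?_)
  simp only [ht, derivY_tensorSchwartz_apply, tensorSchwartz_apply, hermiteSchwartz_apply,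
    mulY_apply]
  push_cast
  ring

theorem integral_schwartz_mul_fourier (φ : 𝓢(ℝ, ℂ)) (c : L2Line) :
    ∫ x, φ x * (𝓕 c : L2Line) x = ∫ x, 𝓕 φ x * c x := by
  have h := DFunLike.congr_fun (Lp.fourier_toTemperedDistribution_eq c) φ
  rw [TemperedDistribution.fourier_apply, Lp.toTemperedDistribution_apply,
    Lp.toTemperedDistribution_apply] at h
  simpa using h.symm

/-- `∂_x` is the Fourier multiplier `2πiξ`, because the frequency dual to `x` is `2πξ` for the
kernel of `𝓕`. -/
theorem specTransform_derivX (k : ℕ) (f : 𝓢(ℝ × ℝ, ℂ)) :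
    specTransform (toL2 (derivX f)) k =ᵐ[volume]
      fun ξ => (2 * Real.pi * ξ * Complex.I) * specTransform (toL2 f) k ξ := by
  have hl : LocallyIntegrable
      (fun ξ : ℝ => (2 * Real.pi * ξ * Complex.I) * specTransform (toL2 f) k ξ) volume := by
    have hcont : Continuous fun ξ : ℝ => (2 * Real.pi * ξ * Complex.I) := by fun_prop
    have := (L2Line.locallyIntegrable (specTransform (toL2 f) k)).locallyIntegrableOn univ
    exact locallyIntegrableOn_univ.1
      (this.continuousOn_mul hcont.continuousOn isOpen_univ.isLocallyClosed)
  refine ae_eq_of_integral_schwartz_mul (L2Line.locallyIntegrable _) hl fun φ => ?_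
  set χ : 𝓢(ℝ, ℂ) := (2 * Real.pi * Complex.I) • smulLeftCLM ℂ (inner ℝ · (1 : ℝ)) φ with hχ
  have hχa : ∀ x, χ x = 2 * Real.pi * Complex.I * (x * φ x) := by
    intro x
    rw [hχ, smul_apply, smulLeftCLM_apply_apply (by fun_prop)]
    simp
  have hD : ∂_{(1 : ℝ)} (𝓕 φ) = -𝓕 χ := by
    rw [lineDerivOp_fourier_eq, neg_smul, FourierTransform.fourier_neg]
  calc ∫ ξ, φ ξ * specTransform (toL2 (derivX f)) k ξ
      = ∫ x, 𝓕 φ x * hermiteCoeff k (toL2 (derivX f)) x := integral_schwartz_mul_fourier _ _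
    _ = ∫ x, 𝓕 χ x * hermiteCoeff k (toL2 f) x := by
        rw [integral_mul_hermiteCoeff, integral_mul_derivX, derivX_tensorSchwartz, hD,
          integral_mul_hermiteCoeff, ← integral_neg]
        simp
    _ = ∫ ξ, χ ξ * specTransform (toL2 f) k ξ := (integral_schwartz_mul_fourier _ _).symm
    _ = _ := by
        refine integral_congr_ae (Eventually.of_forall fun ξ => ?_)
        simp only [hχa]
        ring

end PartialHarmonic

namespace PartialHarmonic

open scoped InnerProductSpace Topology SchwartzMap LineDeriv
open Filter SchwartzMap

/-! ### Derivatives and ladder operators between Sobolev spaces -/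

theorem sobolevNorm_sq (r : ℝ) (u : L2Plane) :
    sobolevNorm r u ^ 2 =
      ∑' k : ℕ, ∫⁻ ξ : ℝ, ENNReal.ofReal (lam (k, ξ) ^ r) * ‖specTransform u k ξ‖ₑ ^ 2 := by
  rw [sobolevNorm, ← ENNReal.rpow_natCast, ← ENNReal.rpow_mul]
  norm_num
  rfl

theorem enorm_sq_smul {c : L2Line} {a : ℝ} (ha : 0 ≤ a) :
    ∀ᵐ ξ : ℝ, ‖(((√a : ℝ) : ℂ) • c : L2Line) ξ‖ₑ ^ 2 = ENNReal.ofReal a * ‖c ξ‖ₑ ^ 2 := by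
  filter_upwards [Lp.coeFn_smul ((√a : ℝ) : ℂ) c] with ξ hξ
  rw [hξ, Pi.smul_apply, smul_eq_mul, enorm_mul, mul_pow]
  congr 1
  rw [← ofReal_norm, Complex.norm_real, Real.norm_of_nonneg (Real.sqrt_nonneg _),
    ← ENNReal.ofReal_pow (Real.sqrt_nonneg _), Real.sq_sqrt ha]

theorem fourier_smul_L2Line (a : ℂ) (c : L2Line) : 𝓕 (a • c) = a • 𝓕 c :=
  (Lp.fourierTransformₗᵢ ℝ ℂ).map_smul a c

theorem specTransform_create (k : ℕ) (f : 𝓢(ℝ × ℝ, ℂ)) :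
    specTransform (toL2 (create f)) k =
      ((√(2 * k) : ℝ) : ℂ) • specTransform (toL2 f) (k - 1) := by
  rw [specTransform, hermiteCoeff_create, fourier_smul_L2Line]
  rfl

theorem specTransform_annihilate (k : ℕ) (f : 𝓢(ℝ × ℝ, ℂ)) :
    specTransform (toL2 (annihilate f)) k =
      ((√(2 * (k + 1)) : ℝ) : ℂ) • specTransform (toL2 f) (k + 1) := by
  rw [specTransform, hermiteCoeff_annihilate, fourier_smul_L2Line]
  rfl

theorem sobolevNorm_create_sq (r : ℝ) (f : 𝓢(ℝ × ℝ, ℂ)) :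
    sobolevNorm r (toL2 (create f)) ^ 2 = ∑' k : ℕ, ∫⁻ ξ : ℝ,
      ENNReal.ofReal (lam (k + 1, ξ) ^ r * (2 * (k + 1))) * ‖specTransform (toL2 f) k ξ‖ₑ ^ 2 := by
  rw [sobolevNorm_sq, tsum_eq_zero_add' ENNReal.summable]
  have h0 : ∫⁻ ξ : ℝ, ENNReal.ofReal (lam (0, ξ) ^ r) *
      ‖specTransform (toL2 (create f)) 0 ξ‖ₑ ^ 2 = 0 := by
    rw [specTransform_create]
    have : ∀ᵐ ξ : ℝ, ENNReal.ofReal (lam (0, ξ) ^ r) *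
        ‖(((√(2 * (0 : ℕ)) : ℝ) : ℂ) • specTransform (toL2 f) (0 - 1) : L2Line) ξ‖ₑ ^ 2 = 0 := by
      filter_upwards [enorm_sq_smul (c := specTransform (toL2 f) (0 - 1))
        (a := 2 * (0 : ℕ)) (by simp)] with ξ hξ
      rw [hξ]
      simp
    rw [lintegral_congr_ae this, lintegral_zero]
  rw [h0, zero_add]
  refine tsum_congr fun k => lintegral_congr_ae ?_
  rw [specTransform_create]
  filter_upwards [enorm_sq_smul (c := specTransform (toL2 f) (k + 1 - 1))
    (a := 2 * (k + 1 : ℕ)) (by positivity)] with ξ hξ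
  have hl := lam_pos (k + 1, ξ)
  rw [hξ, ← mul_assoc, ← ENNReal.ofReal_mul (by positivity)]
  push_cast
  rfl

theorem sobolevNorm_annihilate_sq (r : ℝ) (f : 𝓢(ℝ × ℝ, ℂ)) :
    sobolevNorm r (toL2 (annihilate f)) ^ 2 = ∑' k : ℕ, ∫⁻ ξ : ℝ,
      ENNReal.ofReal (lam (k, ξ) ^ r * (2 * (k + 1))) *
        ‖specTransform (toL2 f) (k + 1) ξ‖ₑ ^ 2 := by
  rw [sobolevNorm_sq]
  refine tsum_congr fun k => lintegral_congr_ae ?_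
  rw [specTransform_annihilate]
  filter_upwards [enorm_sq_smul (c := specTransform (toL2 f) (k + 1))
    (a := 2 * ((k : ℝ) + 1)) (by positivity)] with ξ hξ
  have hl := lam_pos (k, ξ)
  rw [hξ, ← mul_assoc, ← ENNReal.ofReal_mul (by positivity)]

theorem sobolevNorm_derivX_sq (r : ℝ) (f : 𝓢(ℝ × ℝ, ℂ)) :
    sobolevNorm r (toL2 (derivX f)) ^ 2 = ∑' k : ℕ, ∫⁻ ξ : ℝ,
      ENNReal.ofReal (lam (k, ξ) ^ r * (2 * Real.pi * ξ) ^ 2) *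
        ‖specTransform (toL2 f) k ξ‖ₑ ^ 2 := by
  rw [sobolevNorm_sq]
  refine tsum_congr fun k => lintegral_congr_ae ?_
  filter_upwards [specTransform_derivX k f] with ξ hξ
  have hl := lam_pos (k, ξ)
  have h : ‖(2 * Real.pi * ξ * Complex.I : ℂ)‖ₑ ^ 2 = ENNReal.ofReal ((2 * Real.pi * ξ) ^ 2) := by
    rw [← ofReal_norm, ← ENNReal.ofReal_pow (norm_nonneg _)]
    congr 1
    simp [mul_pow]
  rw [hξ, enorm_mul, mul_pow, h, ← mul_assoc, ← ENNReal.ofReal_mul (by positivity)]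

theorem lam_mk (k : ℕ) (ξ : ℝ) : lam (k, ξ) = (2 * Real.pi * ξ) ^ 2 + 2 * k + 1 := rfl

theorem le_of_sq_le_mul {a b c : ℝ≥0∞} (h : a ^ 2 ≤ c ^ 2 * b ^ 2) : a ≤ c * b := by
  rw [← mul_pow] at h
  exact (ENNReal.pow_right_strictMono two_ne_zero).le_iff_le.1 h

theorem sobolevNorm_derivX_le (r : ℝ) (f : 𝓢(ℝ × ℝ, ℂ)) :
    sobolevNorm r (toL2 (derivX f)) ≤ sobolevNorm (r + 1) (toL2 f) := by
  rw [← one_mul (sobolevNorm (r + 1) _)]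
  refine le_of_sq_le_mul ?_
  rw [one_pow, one_mul, sobolevNorm_derivX_sq, sobolevNorm_sq]
  gcongr with k ξ
  have hl := lam_pos (k, ξ)
  rw [Real.rpow_add hl, Real.rpow_one]
  gcongr
  rw [lam_mk]
  have := k.cast_nonneg (α := ℝ)
  linarith

theorem lam_succ (k : ℕ) (ξ : ℝ) : lam (k + 1, ξ) = lam (k, ξ) + 2 := by
  rw [lam_mk, lam_mk]
  push_cast
  ring

theorem sobolevNorm_annihilate_le {r : ℝ} (hr : 0 ≤ r) (f : 𝓢(ℝ × ℝ, ℂ)) :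
    sobolevNorm r (toL2 (annihilate f)) ≤ sobolevNorm (r + 1) (toL2 f) := by
  rw [← one_mul (sobolevNorm (r + 1) _)]
  refine le_of_sq_le_mul ?_
  rw [one_pow, one_mul, sobolevNorm_annihilate_sq, sobolevNorm_sq]
  refine le_trans ?_ (ENNReal.tsum_comp_le_tsum_of_injective (add_left_injective 1) _)
  gcongr with k ξ
  have hl := lam_pos (k, ξ)
  have hs := lam_succ k ξ
  have hl' := lam_pos (k + 1, ξ)
  rw [Real.rpow_add (by linarith), Real.rpow_one]
  gcongr
  · linarith
  · rw [hs, lam_mk]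
    nlinarith [sq_nonneg (2 * Real.pi * ξ)]

/-- Here `3^r` accounts for the shift of the Hermite index:
`λ(ξ, k + 1) = λ(ξ, k) + 2 ≤ 3 λ(ξ, k)`. -/
theorem sobolevNorm_create_le {r : ℝ} (hr : 0 ≤ r) (f : 𝓢(ℝ × ℝ, ℂ)) :
    sobolevNorm r (toL2 (create f)) ≤
      ENNReal.ofReal (√(2 * 3 ^ r)) * sobolevNorm (r + 1) (toL2 f) := by
  refine le_of_sq_le_mul ?_
  rw [sobolevNorm_create_sq, sobolevNorm_sq, ← ENNReal.ofReal_pow (Real.sqrt_nonneg _),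
    Real.sq_sqrt (by positivity), ← ENNReal.tsum_mul_left]
  gcongr with k
  rw [← lintegral_const_mul' _ _ ENNReal.ofReal_ne_top]
  refine lintegral_mono fun ξ => ?_
  have hl := lam_pos (k, ξ)
  have hl1 := one_le_lam (k, ξ)
  rw [← mul_assoc (ENNReal.ofReal (2 * 3 ^ r)), ← ENNReal.ofReal_mul (by positivity)]
  refine mul_le_mul_left (ENNReal.ofReal_le_ofReal ?_) _
  rw [Real.rpow_add hl, Real.rpow_one, lam_succ]
  calc (lam (k, ξ) + 2) ^ r * (2 * (k + 1)) ≤ (3 * lam (k, ξ)) ^ r * (2 * lam (k, ξ)) := by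
        gcongr
        · linarith
        · rw [lam_mk]
          nlinarith [sq_nonneg (2 * Real.pi * ξ), k.cast_nonneg (α := ℝ)]
    _ = _ := by
        rw [Real.mul_rpow (by norm_num) hl.le]
        ring

/-- `∂_y` is half the difference of the annihilation and the creation operator. -/
theorem sobolevNorm_derivY_le {r : ℝ} (hr : 0 ≤ r) :
    ∃ C : ℝ≥0∞, C ≠ ∞ ∧ ∀ f : 𝓢(ℝ × ℝ, ℂ),
      sobolevNorm r (toL2 (derivY f)) ≤ C * sobolevNorm (r + 1) (toL2 f) := by
  refine ⟨1 + ENNReal.ofReal (√(2 * 3 ^ r)), by finiteness, fun f => ?_⟩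
  have h : derivY f = (1 / 2 : ℂ) • (annihilate f - create f) := by
    ext z
    simp only [annihilate, create, smul_apply, sub_apply, add_apply, smul_eq_mul]
    ring
  rw [h, toL2_smul, toL2_sub, sobolevNorm_smul]
  have h2 : ‖(1 / 2 : ℂ)‖ₑ ≤ 1 := by
    rw [← ofReal_norm, ← ENNReal.ofReal_one]
    refine ENNReal.ofReal_le_ofReal ?_
    norm_num
  calc _ ≤ 1 * (sobolevNorm r (toL2 (annihilate f)) + sobolevNorm r (toL2 (create f))) := by
        gcongr
        exact sobolevNorm_sub_le _ _ _
    _ ≤ 1 * (sobolevNorm (r + 1) (toL2 f) +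
        ENNReal.ofReal (√(2 * 3 ^ r)) * sobolevNorm (r + 1) (toL2 f)) := by
        gcongr
        · exact sobolevNorm_annihilate_le hr f
        · exact sobolevNorm_create_le hr f
    _ = _ := by ring

/-- The norm of `ℋ^{r+1}` is controlled by the norms in `ℋ^r` of `∂_x f` and `(y - ∂_y) f`. -/
theorem sobolevNorm_succ_le {r : ℝ} (hr : 0 ≤ r) (f : 𝓢(ℝ × ℝ, ℂ)) :
    sobolevNorm (r + 1) (toL2 f) ≤
      sobolevNorm r (toL2 (derivX f)) + sobolevNorm r (toL2 (create f)) := by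
  have h : sobolevNorm (r + 1) (toL2 f) ^ 2 ≤
      sobolevNorm r (toL2 (derivX f)) ^ 2 + sobolevNorm r (toL2 (create f)) ^ 2 := by
    rw [sobolevNorm_create_sq, sobolevNorm_sq, sobolevNorm_derivX_sq, ← ENNReal.tsum_add]
    gcongr with k
    have hmeas : Measurable fun ξ : ℝ =>
        ENNReal.ofReal (lam (k, ξ) ^ r * (2 * Real.pi * ξ) ^ 2) *
          ‖specTransform (toL2 f) k ξ‖ₑ ^ 2 := by
      have h1 : Measurable fun ξ : ℝ => lam (k, ξ) ^ r * (2 * Real.pi * ξ) ^ 2 :=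
        ((measurable_lam.comp measurable_prodMk_left).pow_const r).mul (by fun_prop)
      exact h1.ennreal_ofReal.mul
        ((Lp.stronglyMeasurable (specTransform (toL2 f) k)).measurable.enorm.pow_const 2)
    rw [← lintegral_add_left hmeas]
    gcongr with ξ
    have hl := lam_pos (k, ξ)
    have hs := lam_succ k ξ
    have hl' := lam_pos (k + 1, ξ)
    rw [← add_mul, ← ENNReal.ofReal_add (by positivity) (by positivity)]
    gcongr
    rw [Real.rpow_add hl, Real.rpow_one]
    have h1 : lam (k, ξ) ^ r ≤ lam (k + 1, ξ) ^ r := by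
      gcongr
      linarith
    have h2 : lam (k, ξ) ≤ (2 * Real.pi * ξ) ^ 2 + 2 * (k + 1) := by
      rw [lam_mk]; linarith
    have hp : (0 : ℝ) ≤ lam (k, ξ) ^ r := by positivity
    have hk := k.cast_nonneg (α := ℝ)
    nlinarith [mul_le_mul_of_nonneg_left h2 hp,
      mul_le_mul_of_nonneg_right h1 (by linarith : (0 : ℝ) ≤ 2 * (k + 1))]
  refine (ENNReal.pow_right_strictMono two_ne_zero).le_iff_le.1 (h.trans ?_)
  rw [add_sq]
  gcongr
  exact le_self_add

end PartialHarmonic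

namespace PartialHarmonic

open scoped InnerProductSpace Topology SchwartzMap LineDeriv
open Filter SchwartzMap

/-! ### Product estimates for Schwartz functions -/

theorem exists_sliceX (v : 𝓢(ℝ × ℝ, ℂ)) (y : ℝ) : ∃ w : 𝓢(ℝ, ℂ), ∀ x, w x = v (x, y) := by
  have hg : Function.HasTemperateGrowth fun x : ℝ => (x, y) := by
    have h1 := (ContinuousLinearMap.inl ℝ ℝ ℝ).hasTemperateGrowth
    have h2 := Function.HasTemperateGrowth.const (E := ℝ) ((0 : ℝ), y)
    simpa [Pi.add_def] using h1.add h2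
  refine ⟨compCLM ℝ hg ⟨1, 1, fun x => ?_⟩ v, fun x => rfl⟩
  have : ‖x‖ ≤ ‖((x, y) : ℝ × ℝ)‖ := le_max_left _ _
  linarith

theorem exists_sliceY (v : 𝓢(ℝ × ℝ, ℂ)) (x : ℝ) : ∃ w : 𝓢(ℝ, ℂ), ∀ y, w y = v (x, y) := by
  have hg : Function.HasTemperateGrowth fun y : ℝ => (x, y) := by
    have h1 := (ContinuousLinearMap.inr ℝ ℝ ℝ).hasTemperateGrowth
    have h2 := Function.HasTemperateGrowth.const (E := ℝ) (x, (0 : ℝ))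
    simpa [Pi.add_def] using h1.add h2
  refine ⟨compCLM ℝ hg ⟨1, 1, fun y => ?_⟩ v, fun x => rfl⟩
  have : ‖y‖ ≤ ‖((x, y) : ℝ × ℝ)‖ := le_max_right _ _
  linarith

theorem enorm_le_lintegral_deriv (w w' : 𝓢(ℝ, ℂ)) (h : ∀ x, HasDerivAt w (w' x) x) (x : ℝ) :
    ‖w x‖ₑ ≤ ∫⁻ t, ‖w' t‖ₑ := by
  have h1 : ∫ t in Iic x, w' t = w x - 0 :=
    integral_Iic_of_hasDerivAt_of_tendsto w.continuous.continuousWithinAt (fun t _ => h t)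
      w'.integrable.integrableOn
      (w.tendsto_cocompact.mono_left atBot_le_cocompact)
  rw [sub_zero] at h1
  rw [← h1]
  exact (enorm_integral_le_lintegral_enorm _).trans (setLIntegral_le_lintegral _ _)

/-- The Gagliardo-Nirenberg-Sobolev inequality in the plane: the square of the `L²` norm is bounded
by the product of the `L¹` norms of the two partial derivatives. -/
theorem lintegral_sq_le_mul (v : 𝓢(ℝ × ℝ, ℂ)) :
    ∫⁻ z, ‖v z‖ₑ ^ 2 ≤ (∫⁻ z, ‖derivX v z‖ₑ) * ∫⁻ z, ‖derivY v z‖ₑ := by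
  have hX : Measurable fun z => ‖derivX v z‖ₑ := (derivX v).continuous.enorm.measurable
  have hY : Measurable fun z => ‖derivY v z‖ₑ := (derivY v).continuous.enorm.measurable
  have h1 : ∀ z : ℝ × ℝ, ‖v z‖ₑ ^ 2 ≤
      (∫⁻ t, ‖derivY v (z.1, t)‖ₑ) * ∫⁻ t, ‖derivX v (t, z.2)‖ₑ := by
    rintro ⟨x, y⟩
    obtain ⟨w, hw⟩ := exists_sliceX v y
    obtain ⟨w', hw'⟩ := exists_sliceX (derivX v) y
    obtain ⟨q, hq⟩ := exists_sliceY v x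
    obtain ⟨q', hq'⟩ := exists_sliceY (derivY v) x
    have e1 := enorm_le_lintegral_deriv w w' (fun t => by
      rw [hw', funext hw]; exact hasDerivAt_derivX v t y) x
    have e2 := enorm_le_lintegral_deriv q q' (fun t => by
      rw [hq', funext hq]; exact hasDerivAt_derivY v x t) y
    rw [hw] at e1
    rw [hq] at e2
    simp_rw [hw'] at e1
    simp_rw [hq'] at e2
    rw [sq]
    exact mul_le_mul' e2 e1
  have hm1 : Measurable fun x : ℝ => ∫⁻ t, ‖derivY v (x, t)‖ₑ := hY.lintegral_prod_right'
  have hm2 : Measurable fun y : ℝ => ∫⁻ t, ‖derivX v (t, y)‖ₑ := hX.lintegral_prod_left'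
  calc ∫⁻ z, ‖v z‖ₑ ^ 2
      ≤ ∫⁻ z : ℝ × ℝ, (∫⁻ t, ‖derivY v (z.1, t)‖ₑ) * ∫⁻ t, ‖derivX v (t, z.2)‖ₑ :=
        lintegral_mono h1
    _ = (∫⁻ x, ∫⁻ t, ‖derivY v (x, t)‖ₑ) * ∫⁻ y, ∫⁻ t, ‖derivX v (t, y)‖ₑ :=
        lintegral_prod_mul hm1.aemeasurable hm2.aemeasurable
    _ = (∫⁻ z, ‖derivY v z‖ₑ) * ∫⁻ z, ‖derivX v z‖ₑ := by
        congr 1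
        · exact (lintegral_prod _ hY.aemeasurable).symm
        · exact (lintegral_prod_symm' _ hX).symm
    _ = _ := mul_comm _ _

theorem enorm_toL2 (f : 𝓢(ℝ × ℝ, ℂ)) : ‖toL2 f‖ₑ = eLpNorm f 2 volume := by
  rw [Lp.enorm_def, eLpNorm_congr_ae (coeFn_toL2 f)]

theorem enorm_toL2_sq_le (v : 𝓢(ℝ × ℝ, ℂ)) :
    ‖toL2 v‖ₑ ^ 2 ≤ (∫⁻ z, ‖derivX v z‖ₑ) * ∫⁻ z, ‖derivY v z‖ₑ := by
  rw [enorm_toL2, enorm_sq_L2]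
  exact lintegral_sq_le_mul v

theorem lintegral_mulSchwartz_le (f g : 𝓢(ℝ × ℝ, ℂ)) :
    ∫⁻ z, ‖mulSchwartz f g z‖ₑ ≤ ‖toL2 f‖ₑ * ‖toL2 g‖ₑ := by
  rw [enorm_toL2, enorm_toL2, ← eLpNorm_one_eq_lintegral_enorm]
  have hf : AEStronglyMeasurable (f : ℝ × ℝ → ℂ) volume := f.continuous.aestronglyMeasurable
  have hg : AEStronglyMeasurable (g : ℝ × ℝ → ℂ) volume := g.continuous.aestronglyMeasurable
  have h := eLpNorm_smul_le_mul_eLpNorm (p := 2) (q := 2) (r := 1) hg hf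
  refine le_trans (le_of_eq ?_) h
  congr 1

theorem lintegral_add_schwartz_le (f g : 𝓢(ℝ × ℝ, ℂ)) :
    ∫⁻ z, ‖(f + g) z‖ₑ ≤ (∫⁻ z, ‖f z‖ₑ) + ∫⁻ z, ‖g z‖ₑ := by
  rw [← lintegral_add_left f.continuous.enorm.measurable]
  exact lintegral_mono fun z => enorm_add_le _ _

theorem enorm_le_sobolevNorm {r : ℝ} (hr : 0 ≤ r) (u : L2Plane) : ‖u‖ₑ ≤ sobolevNorm r u := by
  rw [← sobolevNorm_zero]
  exact sobolevNorm_mono hr u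

theorem exists_enorm_deriv_le : ∃ C : ℝ≥0∞, C ≠ ∞ ∧ ∀ f : 𝓢(ℝ × ℝ, ℂ),
    ‖toL2 (derivX f)‖ₑ ≤ C * sobolevNorm 1 (toL2 f) ∧
    ‖toL2 (derivY f)‖ₑ ≤ C * sobolevNorm 1 (toL2 f) ∧
    ‖toL2 f‖ₑ ≤ C * sobolevNorm 1 (toL2 f) := by
  obtain ⟨C, hC, h⟩ := sobolevNorm_derivY_le le_rfl
  refine ⟨1 + C, by finiteness, fun f => ⟨?_, ?_, ?_⟩⟩
  · have := sobolevNorm_derivX_le 0 f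
    rw [sobolevNorm_zero, zero_add] at this
    exact this.trans (le_mul_of_one_le_left' le_self_add)
  · have := h f
    rw [sobolevNorm_zero, zero_add] at this
    exact this.trans (by gcongr; exact le_add_self)
  · exact (enorm_le_sobolevNorm zero_le_one _).trans (le_mul_of_one_le_left' le_self_add)

theorem exists_enorm_mul_le : ∃ C : ℝ≥0∞, C ≠ ∞ ∧ ∀ f g : 𝓢(ℝ × ℝ, ℂ),
    ‖toL2 (mulSchwartz f g)‖ₑ ≤ C * (sobolevNorm 1 (toL2 f) * sobolevNorm 1 (toL2 g)) := by
  obtain ⟨C, hC, h⟩ := exists_enorm_deriv_le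
  refine ⟨2 * C ^ 2, by finiteness, fun f g => ?_⟩
  have hx : ∫⁻ z, ‖derivX (mulSchwartz f g) z‖ₑ ≤
      2 * C ^ 2 * (sobolevNorm 1 (toL2 f) * sobolevNorm 1 (toL2 g)) := by
    rw [derivX_mul]
    refine (lintegral_add_schwartz_le _ _).trans ((add_le_add (lintegral_mulSchwartz_le _ _)
      (lintegral_mulSchwartz_le _ _)).trans ((add_le_add (mul_le_mul' (h f).1 (h g).2.2)
      (mul_le_mul' (h f).2.2 (h g).1)).trans (le_of_eq (by ring))))
  have hy : ∫⁻ z, ‖derivY (mulSchwartz f g) z‖ₑ ≤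
      2 * C ^ 2 * (sobolevNorm 1 (toL2 f) * sobolevNorm 1 (toL2 g)) := by
    rw [derivY_mul]
    refine (lintegral_add_schwartz_le _ _).trans ((add_le_add (lintegral_mulSchwartz_le _ _)
      (lintegral_mulSchwartz_le _ _)).trans ((add_le_add (mul_le_mul' (h f).2.1 (h g).2.2)
      (mul_le_mul' (h f).2.2 (h g).2.1)).trans (le_of_eq (by ring))))
  refine le_of_sq_le_mul ((enorm_toL2_sq_le _).trans ((mul_le_mul' hx hy).trans ?_))
  exact le_of_eq (by ring)

/-- The pointwise product of three Schwartz functions. -/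
noncomputable def triSchwartz (f g h : 𝓢(ℝ × ℝ, ℂ)) : 𝓢(ℝ × ℝ, ℂ) :=
  mulSchwartz f (mulSchwartz g h)

theorem triSchwartz_apply (f g h : 𝓢(ℝ × ℝ, ℂ)) (z : ℝ × ℝ) :
    triSchwartz f g h z = f z * (g z * h z) := rfl

theorem derivX_triSchwartz (f g h : 𝓢(ℝ × ℝ, ℂ)) :
    derivX (triSchwartz f g h) =
      triSchwartz (derivX f) g h + triSchwartz f (derivX g) h + triSchwartz f g (derivX h) := by
  rw [triSchwartz, derivX_mul, derivX_mul]
  ext z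
  simp only [add_apply, mulSchwartz_apply, triSchwartz_apply]
  ring

theorem derivY_triSchwartz (f g h : 𝓢(ℝ × ℝ, ℂ)) :
    derivY (triSchwartz f g h) =
      triSchwartz (derivY f) g h + triSchwartz f (derivY g) h + triSchwartz f g (derivY h) := by
  rw [triSchwartz, derivY_mul, derivY_mul]
  ext z
  simp only [add_apply, mulSchwartz_apply, triSchwartz_apply]
  ring

theorem create_triSchwartz (f g h : 𝓢(ℝ × ℝ, ℂ)) :
    create (triSchwartz f g h) =
      triSchwartz (create f) g h - triSchwartz f (derivY g) h - triSchwartz f g (derivY h) := by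
  rw [triSchwartz, create_mul, derivY_mul]
  ext z
  simp only [add_apply, sub_apply, mulSchwartz_apply, triSchwartz_apply]
  ring

theorem triSchwartz_comm (f g h : 𝓢(ℝ × ℝ, ℂ)) : triSchwartz f g h = triSchwartz g f h := by
  ext z
  simp only [triSchwartz_apply]
  ring

theorem triSchwartz_rotate (f g h : 𝓢(ℝ × ℝ, ℂ)) : triSchwartz f g h = triSchwartz h f g := by
  ext z
  simp only [triSchwartz_apply]
  ring

/-- The Gagliardo-Nirenberg-Sobolev inequality bounds `‖f g h‖_{L²}` by `L¹` norms such as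
`‖(∂f) g h‖_{L¹} ≤ ‖∂f‖_{L²} ‖g h‖_{L²}`, and once more it bounds `‖g h‖_{L²}`. -/
theorem exists_enorm_tri_le : ∃ C : ℝ≥0∞, C ≠ ∞ ∧ ∀ f g h : 𝓢(ℝ × ℝ, ℂ),
    ‖toL2 (triSchwartz f g h)‖ₑ ≤
      C * (sobolevNorm 1 (toL2 f) * sobolevNorm 1 (toL2 g) * sobolevNorm 1 (toL2 h)) := by
  obtain ⟨C, hC, hd⟩ := exists_enorm_deriv_le
  obtain ⟨D, hD, hm⟩ := exists_enorm_mul_le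
  refine ⟨3 * C * D, by finiteness, fun f g h => ?_⟩
  have key : ∀ (f' f g h : 𝓢(ℝ × ℝ, ℂ)), ‖toL2 f'‖ₑ ≤ C * sobolevNorm 1 (toL2 f) →
      ∫⁻ z, ‖triSchwartz f' g h z‖ₑ ≤ C * D *
        (sobolevNorm 1 (toL2 f) * sobolevNorm 1 (toL2 g) * sobolevNorm 1 (toL2 h)) := by
    intro f' f g h hf
    exact (lintegral_mulSchwartz_le _ _).trans
      ((mul_le_mul' hf (hm g h)).trans (le_of_eq (by ring)))
  have hx : ∫⁻ z, ‖derivX (triSchwartz f g h) z‖ₑ ≤ 3 * C * D *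
      (sobolevNorm 1 (toL2 f) * sobolevNorm 1 (toL2 g) * sobolevNorm 1 (toL2 h)) := by
    rw [derivX_triSchwartz, triSchwartz_comm f (derivX g), triSchwartz_rotate f g (derivX h)]
    refine (lintegral_add_schwartz_le _ _).trans ((add_le_add ((lintegral_add_schwartz_le _ _).trans
      (add_le_add (key _ f g h (hd f).1) (key _ g f h (hd g).1)))
      (key _ h f g (hd h).1)).trans (le_of_eq (by ring)))
  have hy : ∫⁻ z, ‖derivY (triSchwartz f g h) z‖ₑ ≤ 3 * C * D *
      (sobolevNorm 1 (toL2 f) * sobolevNorm 1 (toL2 g) * sobolevNorm 1 (toL2 h)) := by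
    rw [derivY_triSchwartz, triSchwartz_comm f (derivY g), triSchwartz_rotate f g (derivY h)]
    refine (lintegral_add_schwartz_le _ _).trans ((add_le_add ((lintegral_add_schwartz_le _ _).trans
      (add_le_add (key _ f g h (hd f).2.1) (key _ g f h (hd g).2.1)))
      (key _ h f g (hd h).2.1)).trans (le_of_eq (by ring)))
  refine le_of_sq_le_mul ((enorm_toL2_sq_le _).trans ((mul_le_mul' hx hy).trans ?_))
  exact le_of_eq (by ring)

/-- A common bound for the operators `∂_x`, `∂_y` and `y - ∂_y` on finitely many Sobolev spaces. -/
theorem exists_sobolevNorm_deriv_le (r : ℕ) : ∃ D : ℝ≥0∞, D ≠ ∞ ∧ ∀ i ≤ r, ∀ f : 𝓢(ℝ × ℝ, ℂ),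
    sobolevNorm (i + 1) (toL2 (derivX f)) ≤ D * sobolevNorm ((i + 1 : ℕ) + 1) (toL2 f) ∧
    sobolevNorm (i + 1) (toL2 (derivY f)) ≤ D * sobolevNorm ((i + 1 : ℕ) + 1) (toL2 f) ∧
    sobolevNorm (i + 1) (toL2 (create f)) ≤ D * sobolevNorm ((i + 1 : ℕ) + 1) (toL2 f) := by
  have hY := fun i : ℕ => sobolevNorm_derivY_le (r := (i : ℝ) + 1) (by positivity)
  choose C hC hCf using hY
  set c : ℕ → ℝ≥0∞ := fun i => 1 + C i + ENNReal.ofReal (√(2 * 3 ^ ((i : ℝ) + 1))) with hc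
  have hcle : ∀ i ≤ r, c i ≤ ∑ i ∈ Finset.range (r + 1), c i := fun i hi =>
    Finset.single_le_sum (f := c) (fun _ _ => zero_le) (Finset.mem_range.2 (by omega))
  refine ⟨∑ i ∈ Finset.range (r + 1), c i, ?_, fun i hi f => ?_⟩
  · refine (ENNReal.sum_lt_top.2 fun i _ => ?_).ne
    have := hC i
    exact lt_top_iff_ne_top.2 (by finiteness)
  · push_cast
    have h1 : 1 ≤ c i := le_self_add.trans le_self_add
    have h2 : C i ≤ c i := le_add_self.trans le_self_add
    have h3 : ENNReal.ofReal (√(2 * 3 ^ ((i : ℝ) + 1))) ≤ c i := le_add_self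
    exact ⟨(sobolevNorm_derivX_le _ f).trans (le_mul_of_one_le_left' (h1.trans (hcle i hi))),
      (hCf i f).trans (mul_le_mul_left (h2.trans (hcle i hi)) _),
      (sobolevNorm_create_le (by positivity) f).trans
        (mul_le_mul_left (h3.trans (hcle i hi)) _)⟩

/-- The tame trilinear estimate for Schwartz functions: the norm of a product in `ℋ^r` is bounded
by products of norms in `ℋ^{i+1}`, `ℋ^{j+1}` and `ℋ^{l+1}` with `i + j + l = r`. In the induction
on `r`, `∂_x` and `y - ∂_y` of a product are distributed over the factors, where the
multiplication by `y` goes to the first one. -/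
theorem exists_sobolevNorm_tri_le (r : ℕ) : ∃ C : ℝ≥0∞, C ≠ ∞ ∧
    ∀ (f g h : 𝓢(ℝ × ℝ, ℂ)) (B : ℝ≥0∞), (∀ i j l : ℕ, i + j + l = r →
      sobolevNorm (i + 1) (toL2 f) * sobolevNorm (j + 1) (toL2 g) *
        sobolevNorm (l + 1) (toL2 h) ≤ B) →
      sobolevNorm r (toL2 (triSchwartz f g h)) ≤ C * B := by
  induction r with
  | zero =>
    obtain ⟨C, hC, h⟩ := exists_enorm_tri_le
    refine ⟨C, hC, fun f g k B hB => ?_⟩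
    rw [Nat.cast_zero, sobolevNorm_zero]
    refine (h f g k).trans ?_
    gcongr
    have := hB 0 0 0 rfl
    simpa using this
  | succ r ih =>
    obtain ⟨C, hC, ih⟩ := ih
    obtain ⟨D, hD, hd⟩ := exists_sobolevNorm_deriv_le r
    refine ⟨6 * (C * D), by finiteness, fun f g h B hB => ?_⟩
    have h1 : ∀ f' : 𝓢(ℝ × ℝ, ℂ), (∀ i ≤ r, sobolevNorm (i + 1) (toL2 f') ≤
        D * sobolevNorm ((i + 1 : ℕ) + 1) (toL2 f)) →
        sobolevNorm r (toL2 (triSchwartz f' g h)) ≤ C * (D * B) := by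
      refine fun f' hf => ih _ _ _ _ fun i j l hijl => ?_
      calc _ ≤ D * sobolevNorm ((i + 1 : ℕ) + 1) (toL2 f) * sobolevNorm (j + 1) (toL2 g) *
            sobolevNorm (l + 1) (toL2 h) := by
            gcongr
            exact hf i (by omega)
        _ = D * (sobolevNorm ((i + 1 : ℕ) + 1) (toL2 f) * sobolevNorm (j + 1) (toL2 g) *
            sobolevNorm (l + 1) (toL2 h)) := by ring
        _ ≤ D * B := by
            gcongr
            exact hB (i + 1) j l (by omega)
    have h2 : ∀ g' : 𝓢(ℝ × ℝ, ℂ), (∀ i ≤ r, sobolevNorm (i + 1) (toL2 g') ≤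
        D * sobolevNorm ((i + 1 : ℕ) + 1) (toL2 g)) →
        sobolevNorm r (toL2 (triSchwartz f g' h)) ≤ C * (D * B) := by
      refine fun g' hg => ih _ _ _ _ fun i j l hijl => ?_
      calc _ ≤ sobolevNorm (i + 1) (toL2 f) * (D * sobolevNorm ((j + 1 : ℕ) + 1) (toL2 g)) *
            sobolevNorm (l + 1) (toL2 h) := by
            gcongr
            exact hg j (by omega)
        _ = D * (sobolevNorm (i + 1) (toL2 f) * sobolevNorm ((j + 1 : ℕ) + 1) (toL2 g) *
            sobolevNorm (l + 1) (toL2 h)) := by ring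
        _ ≤ D * B := by
            gcongr
            exact hB i (j + 1) l (by omega)
    have h3 : ∀ h' : 𝓢(ℝ × ℝ, ℂ), (∀ i ≤ r, sobolevNorm (i + 1) (toL2 h') ≤
        D * sobolevNorm ((i + 1 : ℕ) + 1) (toL2 h)) →
        sobolevNorm r (toL2 (triSchwartz f g h')) ≤ C * (D * B) := by
      refine fun h' hh => ih _ _ _ _ fun i j l hijl => ?_
      calc _ ≤ sobolevNorm (i + 1) (toL2 f) * sobolevNorm (j + 1) (toL2 g) *
            (D * sobolevNorm ((l + 1 : ℕ) + 1) (toL2 h)) := by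
            gcongr
            exact hh l (by omega)
        _ = D * (sobolevNorm (i + 1) (toL2 f) * sobolevNorm (j + 1) (toL2 g) *
            sobolevNorm ((l + 1 : ℕ) + 1) (toL2 h)) := by ring
        _ ≤ D * B := by
            gcongr
            exact hB i j (l + 1) (by omega)
    push_cast
    refine (sobolevNorm_succ_le r.cast_nonneg _).trans ?_
    rw [derivX_triSchwartz, create_triSchwartz, toL2_add, toL2_add, toL2_sub, toL2_sub]
    refine (add_le_add
      ((sobolevNorm_add_le _ _ _).trans (add_le_add ((sobolevNorm_add_le _ _ _).trans (add_le_add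
        (h1 _ fun i hi => (hd i hi f).1) (h2 _ fun i hi => (hd i hi g).1)))
        (h3 _ fun i hi => (hd i hi h).1)))
      ((sobolevNorm_sub_le _ _ _).trans (add_le_add ((sobolevNorm_sub_le _ _ _).trans (add_le_add
        (h1 _ fun i hi => (hd i hi f).2.2) (h2 _ fun i hi => (hd i hi g).2.1)))
        (h3 _ fun i hi => (hd i hi h).2.1)))).trans (le_of_eq ?_)
    ring

end PartialHarmonic

namespace PartialHarmonic

open scoped InnerProductSpace Topology SchwartzMap LineDeriv
open Filter SchwartzMap

/-! ### Density of Schwartz functions in the Sobolev spaces -/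

theorem potA_specEmbed {r : ℝ} (hr : 0 ≤ r) (k : ℕ) {c d : L2Line}
    (h : d =ᵐ[volume] fun ξ => ((lam (k, ξ) ^ (-(r / 2)) : ℝ) : ℂ) * c ξ) :
    potA r (specEmbed k c) = specEmbed k d := by
  refine spec_ext ?_
  have h2 : ∀ᵐ p ∂specMeasure, specTransform (specEmbed k d) p.1 p.2 =
      ((lam p ^ (-(r / 2)) : ℝ) : ℂ) * specTransform (specEmbed k c) p.1 p.2 := by
    rw [ae_specMeasure_iff]
    intro j
    simp only [specTransform_specEmbed]
    split_ifs with hj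
    · subst hj
      exact h
    · filter_upwards [Lp.coeFn_zero ℂ 2 (volume : Measure ℝ)] with ξ h0
      rw [h0]
      simp
  filter_upwards [h2, spec_potA hr (specEmbed k c), coeFn_spec (specEmbed k c),
    coeFn_spec (specEmbed k d)] with p h1 h3 h4 h5
  rw [h3, h4, h5, h1]

theorem specEmbed_toLp (k : ℕ) (G : 𝓢(ℝ, ℂ)) :
    specEmbed k (G.toLp 2 volume) = toL2 (tensorSchwartz (𝓕⁻ G) (hermiteSchwartz k)) := by
  rw [specEmbed_apply, toLp_fourierInv_eq, tensorHermiteLM_toLp]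

theorem contDiff_lam_rpow (k : ℕ) (s : ℝ) : ContDiff ℝ (⊤ : ℕ∞) fun ξ : ℝ => lam (k, ξ) ^ s := by
  refine ContDiff.rpow_const_of_ne ?_ fun ξ => (lam_pos (k, ξ)).ne'
  change ContDiff ℝ _ fun ξ : ℝ => (2 * Real.pi * ξ) ^ 2 + 2 * (k : ℝ) + 1
  fun_prop

/-- The elements of `L²` which `A^{-r/2}` maps to Schwartz functions. -/
noncomputable def schwartzDomain (r : ℝ) : Submodule ℂ L2Plane :=
  (LinearMap.range ((toLpCLM ℂ ℂ 2 (volume : Measure (ℝ × ℝ))) :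
    𝓢(ℝ × ℝ, ℂ) →ₗ[ℂ] L2Plane)).comap (potA r : L2Plane →ₗ[ℂ] L2Plane)

theorem mem_schwartzDomain {r : ℝ} {w : L2Plane} :
    w ∈ schwartzDomain r ↔ ∃ f, toL2 f = potA r w := Iff.rfl

/-- An element orthogonal to the `specEmbed k γ` with `γ` smooth and compactly supported has
vanishing transform. These lie in `schwartzDomain r`, because `λ^{-r/2} γ` is smooth and
compactly supported again. -/
theorem dense_schwartzDomain {r : ℝ} (hr : 0 ≤ r) : (schwartzDomain r).topologicalClosure = ⊤ := by
  rw [Submodule.topologicalClosure_eq_top_iff, Submodule.eq_bot_iff]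
  intro a ha
  have hk : ∀ k, specTransform a k = 0 := by
    intro k
    refine Lp.ext ?_
    have h0 : ∀ᵐ ξ : ℝ, specTransform a k ξ = 0 := by
      refine ae_eq_zero_of_integral_contDiff_smul_eq_zero (L2Line.locallyIntegrable _) ?_
      intro g hg hgc
      have hgc' : HasCompactSupport (fun x => (g x : ℂ)) := hgc.comp_left Complex.ofReal_zero
      have hg' : ContDiff ℝ (⊤ : ℕ∞) (fun x => (g x : ℂ)) := Complex.ofRealCLM.contDiff.comp hg
      have hGc : HasCompactSupport (fun x => ((lam (k, x) ^ (-(r / 2)) * g x : ℝ) : ℂ)) :=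
        (hgc.mul_left (f := fun x => lam (k, x) ^ (-(r / 2)))).comp_left Complex.ofReal_zero
      have hG : ContDiff ℝ (⊤ : ℕ∞) (fun x => ((lam (k, x) ^ (-(r / 2)) * g x : ℝ) : ℂ)) :=
        Complex.ofRealCLM.contDiff.comp ((contDiff_lam_rpow k _).mul hg)
      set γ := hgc'.toSchwartzMap hg'
      set Γ := hGc.toSchwartzMap hG
      have hmem : specEmbed k (γ.toLp 2 volume) ∈ schwartzDomain r := by
        refine mem_schwartzDomain.2 ⟨tensorSchwartz (𝓕⁻ Γ) (hermiteSchwartz k), ?_⟩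
        rw [← specEmbed_toLp]
        refine (potA_specEmbed hr k ?_).symm
        filter_upwards [γ.coeFn_toLp 2 volume, Γ.coeFn_toLp 2 volume] with ξ h1 h2
        rw [h1, h2]
        simp [γ, Γ]
      have h := (Submodule.mem_orthogonal _ _).1 ha _ hmem
      rw [inner_specEmbed, L2.inner_def] at h
      rw [← h]
      refine integral_congr_ae ?_
      filter_upwards [γ.coeFn_toLp 2 volume] with ξ h1
      rw [h1]
      simp [γ, mul_comm]
    filter_upwards [h0, Lp.coeFn_zero ℂ 2 (volume : Measure ℝ)] with ξ h1 h2
    rw [h1, h2]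
    rfl
  exact eq_zero_of_hermiteCoeff_eq_zero fun k =>
    (Lp.fourierTransformₗᵢ ℝ ℂ).map_eq_zero_iff.1 (hk k)

theorem exists_schwartz_sobolevNorm_sub_le {r : ℝ} (hr : 0 ≤ r) {u : L2Plane}
    (hu : sobolevNorm r u < ∞) {ε : ℝ≥0∞} (hε : ε ≠ 0) :
    ∃ f : 𝓢(ℝ × ℝ, ℂ), sobolevNorm r (u - toL2 f) ≤ ε := by
  obtain ⟨w, rfl⟩ := exists_potA_eq hr hu
  have hw : w ∈ closure (schwartzDomain r : Set L2Plane) := by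
    rw [← Submodule.topologicalClosure_coe, dense_schwartzDomain hr]
    trivial
  obtain ⟨w', hw', hd⟩ := EMetric.mem_closure_iff.1 hw ε (pos_iff_ne_zero.2 hε)
  obtain ⟨f, hf⟩ := mem_schwartzDomain.1 hw'
  refine ⟨f, ?_⟩
  rw [hf, ← map_sub, sobolevNorm_potA_self hr, ← edist_eq_enorm_sub]
  exact hd.le

/-! ### The cubic nonlinearity on Sobolev spaces -/

/-- Complex conjugation commutes with `∂_x` and `y - ∂_y`, which control the Sobolev norms. -/
theorem exists_sobolevNorm_conj_le (r : ℕ) : ∃ C : ℝ≥0∞, C ≠ ∞ ∧ ∀ f : 𝓢(ℝ × ℝ, ℂ),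
    sobolevNorm r (toL2 (conjSchwartz f)) ≤ C * sobolevNorm r (toL2 f) := by
  have hx : ∀ f : 𝓢(ℝ × ℝ, ℂ), derivX (conjSchwartz f) = conjSchwartz (derivX f) := by
    intro f
    ext ⟨x, y⟩
    exact (hasDerivAt_derivX _ x y).unique
      (Complex.conjCLE.toContinuousLinearMap.hasFDerivAt.comp_hasDerivAt x
        (hasDerivAt_derivX f x y))
  have hy : ∀ f : 𝓢(ℝ × ℝ, ℂ), derivY (conjSchwartz f) = conjSchwartz (derivY f) := by
    intro f
    ext ⟨x, y⟩
    exact (hasDerivAt_derivY _ x y).unique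
      (Complex.conjCLE.toContinuousLinearMap.hasFDerivAt.comp_hasDerivAt y
        (hasDerivAt_derivY f x y))
  have hc : ∀ f : 𝓢(ℝ × ℝ, ℂ), create (conjSchwartz f) = conjSchwartz (create f) := by
    intro f
    ext z
    simp [create, hy, mulY_apply]
  induction r with
  | zero =>
    refine ⟨1, by simp, fun f => ?_⟩
    rw [one_mul, Nat.cast_zero, sobolevNorm_zero, sobolevNorm_zero, enorm_toL2, enorm_toL2]
    refine eLpNorm_mono fun z => ?_
    simp
  | succ r ih =>
    obtain ⟨C, hC, ih⟩ := ih
    refine ⟨C * (1 + ENNReal.ofReal (√(2 * 3 ^ (r : ℝ)))), by finiteness, fun f => ?_⟩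
    push_cast
    calc _ ≤ _ := sobolevNorm_succ_le r.cast_nonneg _
      _ ≤ C * sobolevNorm r (toL2 (derivX f)) + C * sobolevNorm r (toL2 (create f)) := by
        rw [hx, hc]
        exact add_le_add (ih _) (ih _)
      _ ≤ C * sobolevNorm (r + 1) (toL2 f) +
          C * (ENNReal.ofReal (√(2 * 3 ^ (r : ℝ))) * sobolevNorm (r + 1) (toL2 f)) := by
        gcongr
        · exact sobolevNorm_derivX_le _ _
        · exact sobolevNorm_create_le r.cast_nonneg _
      _ = _ := by ring

theorem exists_seq_tendsto_ae_Lp {α : Type*} [MeasurableSpace α] {μ : Measure α}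
    {F : ℕ → Lp ℂ 2 μ} {G : Lp ℂ 2 μ} (h : Tendsto F atTop (𝓝 G)) :
    ∃ ns : ℕ → ℕ, StrictMono ns ∧ ∀ᵐ x ∂μ, Tendsto (fun n => F (ns n) x) atTop (𝓝 (G x)) :=
  (tendstoInMeasure_of_tendsto_Lp h).exists_seq_tendsto_ae

/-- Lower semicontinuity of the Sobolev norms with respect to convergence in `L²`. -/
theorem sobolevNorm_le_of_tendsto {r : ℝ} {p : ℕ → L2Plane} {q : L2Plane} {K : ℕ → ℝ≥0∞}
    {L : ℝ≥0∞} (hp : Tendsto p atTop (𝓝 q)) (hK : ∀ n, sobolevNorm r (p n) ≤ K n)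
    (hL : Tendsto K atTop (𝓝 L)) : sobolevNorm r q ≤ L := by
  have hs : Tendsto (fun n => spec (p n)) atTop (𝓝 (spec q)) := (spec.continuous.tendsto q).comp hp
  obtain ⟨ns, hns, hae⟩ := exists_seq_tendsto_ae_Lp hs
  have h1 := Lp.eLpNorm_lim_le_liminf_eLpNorm (p := 2)
    (f := fun n p' => ((lam p' ^ (r / 2) : ℝ) : ℂ) * spec (p (ns n)) p') (μ := specMeasure)
    (fun n => (measurable_lam_rpow _).aestronglyMeasurable.mul (Lp.aestronglyMeasurable _))
    (fun p' => ((lam p' ^ (r / 2) : ℝ) : ℂ) * spec q p')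
    (by filter_upwards [hae] with x hx using hx.const_mul _)
  rw [sobolevNorm_eq]
  refine h1.trans ?_
  simp_rw [← sobolevNorm_eq]
  have h2 : Tendsto (fun n => K (ns n)) atTop (𝓝 L) := hL.comp hns.tendsto_atTop
  rw [← h2.liminf_eq]
  exact liminf_le_liminf (Eventually.of_forall fun n => hK (ns n))

/-- The tame trilinear estimate for the product `f ḡ h` of Schwartz functions. -/
theorem exists_sobolevNorm_cubicSchwartz_le (r : ℕ) : ∃ C : ℝ≥0∞, C ≠ ∞ ∧
    ∀ (f g h : 𝓢(ℝ × ℝ, ℂ)) (B : ℝ≥0∞), (∀ i j l : ℕ, i + j + l = r →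
      sobolevNorm (i + 1) (toL2 f) * sobolevNorm (j + 1) (toL2 g) *
        sobolevNorm (l + 1) (toL2 h) ≤ B) →
      sobolevNorm r (toL2 (triSchwartz f (conjSchwartz g) h)) ≤ C * B := by
  obtain ⟨C, hC, h⟩ := exists_sobolevNorm_tri_le r
  choose D hD hDf using exists_sobolevNorm_conj_le
  have hcle : ∀ j ≤ r, D (j + 1) ≤ ∑ j ∈ Finset.range (r + 1), D (j + 1) := fun j hj =>
    Finset.single_le_sum (f := fun j => D (j + 1)) (fun _ _ => zero_le)
      (Finset.mem_range.2 (by omega))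
  set E := ∑ j ∈ Finset.range (r + 1), D (j + 1) with hE
  have hE' : E ≠ ∞ := (ENNReal.sum_lt_top.2 fun i _ => lt_top_iff_ne_top.2 (hD _)).ne
  refine ⟨C * E, by finiteness, fun f g k B hB => ?_⟩
  rw [mul_assoc]
  refine h _ _ _ _ fun i j l hijl => ?_
  have h1 := hDf (j + 1) g
  push_cast at h1
  calc _ ≤ sobolevNorm (i + 1) (toL2 f) * (E * sobolevNorm (j + 1) (toL2 g)) *
        sobolevNorm (l + 1) (toL2 k) := by
        gcongr
        exact h1.trans (by gcongr; exact hcle j (by omega))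
    _ = E * (sobolevNorm (i + 1) (toL2 f) * sobolevNorm (j + 1) (toL2 g) *
        sobolevNorm (l + 1) (toL2 k)) := by ring
    _ ≤ E * B := by
        gcongr
        exact hB i j l hijl

/-- Local Lipschitz continuity of `(f, g, h) ↦ f ḡ h` from `ℋ^1` to `L²`, by telescoping. -/
theorem enorm_cubicSchwartz_sub_le : ∃ C : ℝ≥0∞, C ≠ ∞ ∧ ∀ (f g h f' g' h' : 𝓢(ℝ × ℝ, ℂ))
    (M ε : ℝ≥0∞), sobolevNorm 1 (toL2 f) ≤ M → sobolevNorm 1 (toL2 g) ≤ M →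
      sobolevNorm 1 (toL2 h) ≤ M → sobolevNorm 1 (toL2 f') ≤ M → sobolevNorm 1 (toL2 g') ≤ M →
      sobolevNorm 1 (toL2 h') ≤ M → sobolevNorm 1 (toL2 f - toL2 f') ≤ ε →
      sobolevNorm 1 (toL2 g - toL2 g') ≤ ε → sobolevNorm 1 (toL2 h - toL2 h') ≤ ε →
      ‖toL2 (triSchwartz f (conjSchwartz g) h) - toL2 (triSchwartz f' (conjSchwartz g') h')‖ₑ ≤
        C * (3 * M ^ 2 * ε) := by
  obtain ⟨C, hC, key⟩ := exists_sobolevNorm_cubicSchwartz_le 0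
  refine ⟨C, hC, fun f g h f' g' h' M ε hf hg hh hf' hg' hh' hff hgg hhh => ?_⟩
  have e : triSchwartz f (conjSchwartz g) h - triSchwartz f' (conjSchwartz g') h' =
      triSchwartz (f - f') (conjSchwartz g) h + triSchwartz f' (conjSchwartz (g - g')) h +
        triSchwartz f' (conjSchwartz g') (h - h') := by
    ext z
    simp only [sub_apply, add_apply, triSchwartz_apply, conjSchwartz_apply, map_sub]
    ring
  have key' : ∀ (f g h : 𝓢(ℝ × ℝ, ℂ)) (a b c : ℝ≥0∞), sobolevNorm 1 (toL2 f) ≤ a →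
      sobolevNorm 1 (toL2 g) ≤ b → sobolevNorm 1 (toL2 h) ≤ c →
      ‖toL2 (triSchwartz f (conjSchwartz g) h)‖ₑ ≤ C * (a * b * c) := by
    intro f g h a b c ha hb hc
    rw [← sobolevNorm_zero]
    have := key f g h (a * b * c) fun i j l hijl => by
      obtain ⟨rfl, rfl, rfl⟩ : i = 0 ∧ j = 0 ∧ l = 0 := by omega
      simp only [Nat.cast_zero, zero_add]
      exact mul_le_mul' (mul_le_mul' ha hb) hc
    simpa using this
  rw [← toL2_sub, e, toL2_add, toL2_add]
  rw [← toL2_sub] at hff hgg hhh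
  calc _ ≤ C * (ε * M * M) + C * (M * ε * M) + C * (M * M * ε) :=
        (enorm_add_le _ _).trans (add_le_add ((enorm_add_le _ _).trans (add_le_add
          (key' _ _ _ _ _ _ hff hg hh) (key' _ _ _ _ _ _ hf' hgg hh)))
          (key' _ _ _ _ _ _ hf' hg' hhh))
    _ = _ := by ring

/-- The tame trilinear estimate for the product `u v̄ w` in Sobolev spaces. The products of
approximating Schwartz functions converge in `L²`, almost everywhere along a subsequence to the
pointwise product, and the estimate passes to the limit by lower semicontinuity. -/
theorem exists_cubic (r : ℕ) : ∃ C : ℝ≥0∞, C ≠ ∞ ∧ ∀ u v w : L2Plane,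
    sobolevNorm (r + 1) u < ∞ → sobolevNorm (r + 1) v < ∞ → sobolevNorm (r + 1) w < ∞ →
    ∃ q : L2Plane, (q =ᵐ[volume] fun z => u z * ((starRingEnd ℂ) (v z) * w z)) ∧
      ∀ B : ℝ≥0∞, (∀ i j l : ℕ, i + j + l = r →
        sobolevNorm (i + 1) u * sobolevNorm (j + 1) v * sobolevNorm (l + 1) w ≤ B) →
      sobolevNorm r q ≤ C * B := by
  obtain ⟨C, hC, hest⟩ := exists_sobolevNorm_cubicSchwartz_le r
  obtain ⟨C₀, hC₀, hlip⟩ := enorm_cubicSchwartz_sub_le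
  refine ⟨C, hC, fun u v w hu hv hw => ?_⟩
  set ε : ℕ → ℝ≥0∞ := fun n => ((n : ℝ≥0∞) + 1)⁻¹ with hε
  have hε1 : ∀ n, ε n ≤ 1 := fun n => ENNReal.inv_le_one.2 le_add_self
  have hε0 : Tendsto ε atTop (𝓝 0) := by
    have h1 : Tendsto (fun n : ℕ => ((n + 1 : ℕ) : ℝ≥0∞)⁻¹) atTop (𝓝 0) :=
      ENNReal.tendsto_inv_nat_nhds_zero.comp (tendsto_add_atTop_nat 1)
    simpa [hε] using h1
  have hεa : ∀ n N, N ≤ n → ε n ≤ ε N := fun n N h => by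
    exact ENNReal.inv_le_inv.2 (add_le_add_left (Nat.cast_le.2 h) 1)
  have hεne : ∀ n, ε n ≠ 0 := fun n => by simp [hε]
  have happ : ∀ u : L2Plane, sobolevNorm (r + 1) u < ∞ → ∃ f : ℕ → 𝓢(ℝ × ℝ, ℂ),
      (∀ n, sobolevNorm (r + 1) (u - toL2 (f n)) ≤ ε n) := fun u hu => by
    choose f hf using fun n => exists_schwartz_sobolevNorm_sub_le (by positivity) hu (hεne n)
    exact ⟨f, hf⟩
  obtain ⟨f, hf⟩ := happ u hu
  obtain ⟨g, hg⟩ := happ v hv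
  obtain ⟨h, hh⟩ := happ w hw
  have hLp : ∀ (u : L2Plane) (f : ℕ → 𝓢(ℝ × ℝ, ℂ)),
      (∀ n, sobolevNorm (r + 1) (u - toL2 (f n)) ≤ ε n) →
      Tendsto (fun n => toL2 (f n)) atTop (𝓝 u) := by
    intro u f hf
    rw [tendsto_iff_edist_tendsto_0]
    refine tendsto_of_tendsto_of_tendsto_of_le_of_le tendsto_const_nhds hε0
      (fun _ => zero_le) fun n => ?_
    rw [edist_comm, edist_eq_enorm_sub]
    exact (enorm_le_sobolevNorm (by positivity) _).trans (hf n)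
  have hbd : ∀ (u : L2Plane) (f : ℕ → 𝓢(ℝ × ℝ, ℂ)),
      (∀ n, sobolevNorm (r + 1) (u - toL2 (f n)) ≤ ε n) → ∀ n (s : ℝ), s ≤ r + 1 →
      sobolevNorm s (toL2 (f n)) ≤ sobolevNorm s u + ε n := by
    intro u f hf n s hs
    have h1 : toL2 (f n) = u - (u - toL2 (f n)) := by abel
    calc sobolevNorm s (toL2 (f n)) = sobolevNorm s (u - (u - toL2 (f n))) := by rw [← h1]
      _ ≤ sobolevNorm s u + sobolevNorm s (u - toL2 (f n)) := sobolevNorm_sub_le _ _ _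
      _ ≤ _ := by
        gcongr
        exact (sobolevNorm_mono hs _).trans (hf n)
  have hcau : ∀ (u : L2Plane) (f : ℕ → 𝓢(ℝ × ℝ, ℂ)),
      (∀ n, sobolevNorm (r + 1) (u - toL2 (f n)) ≤ ε n) → ∀ n m N, N ≤ n → N ≤ m →
      sobolevNorm 1 (toL2 (f n) - toL2 (f m)) ≤ 2 * ε N := by
    intro u f hf n m N hn hm
    have h1 : toL2 (f n) - toL2 (f m) = (u - toL2 (f m)) - (u - toL2 (f n)) := by abel
    have hr1 : (1 : ℝ) ≤ r + 1 := by simp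
    rw [h1, two_mul]
    refine (sobolevNorm_sub_le _ _ _).trans (add_le_add ?_ ?_)
    · exact ((sobolevNorm_mono hr1 _).trans (hf m)).trans (hεa m N hm)
    · exact ((sobolevNorm_mono hr1 _).trans (hf n)).trans (hεa n N hn)
  -- `M` bounds all norms which occur, also those of the approximations
  set M : ℝ≥0∞ := sobolevNorm (r + 1) u + sobolevNorm (r + 1) v + sobolevNorm (r + 1) w + 1
    with hM
  have hMtop : M ≠ ∞ := by
    have := hu.ne
    have := hv.ne
    have := hw.ne
    finiteness
  have hMu : ∀ s : ℝ, s ≤ r + 1 → sobolevNorm s u + 1 ≤ M := fun s hs => by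
    refine (add_le_add_left (sobolevNorm_mono hs u) 1).trans ?_
    rw [hM]
    gcongr
    rw [add_assoc]
    exact le_self_add
  have hMv : ∀ s : ℝ, s ≤ r + 1 → sobolevNorm s v + 1 ≤ M := fun s hs => by
    refine (add_le_add_left (sobolevNorm_mono hs v) 1).trans ?_
    rw [hM]
    gcongr
    exact le_add_self.trans le_self_add
  have hMw : ∀ s : ℝ, s ≤ r + 1 → sobolevNorm s w + 1 ≤ M := fun s hs => by
    refine (add_le_add_left (sobolevNorm_mono hs w) 1).trans ?_
    rw [hM]
    gcongr
    exact le_add_self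
  have hr1 : (1 : ℝ) ≤ r + 1 := by simp
  have hMf : ∀ n, sobolevNorm 1 (toL2 (f n)) ≤ M := fun n =>
    (hbd u f hf n 1 hr1).trans ((by gcongr; exact hε1 n : _ ≤ _).trans (hMu 1 hr1))
  have hMg : ∀ n, sobolevNorm 1 (toL2 (g n)) ≤ M := fun n =>
    (hbd v g hg n 1 hr1).trans ((by gcongr; exact hε1 n : _ ≤ _).trans (hMv 1 hr1))
  have hMh : ∀ n, sobolevNorm 1 (toL2 (h n)) ≤ M := fun n =>
    (hbd w h hh n 1 hr1).trans ((by gcongr; exact hε1 n : _ ≤ _).trans (hMw 1 hr1))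
  set p : ℕ → L2Plane := fun n => toL2 (triSchwartz (f n) (conjSchwartz (g n)) (h n)) with hp
  have hpc : CauchySeq p := by
    rw [EMetric.cauchySeq_iff_le_tendsto_0]
    refine ⟨fun N => C₀ * (3 * M ^ 2 * (2 * ε N)), fun n m N hn hm => ?_, ?_⟩
    · rw [edist_eq_enorm_sub]
      exact hlip _ _ _ _ _ _ M (2 * ε N) (hMf n) (hMg n) (hMh n) (hMf m) (hMg m) (hMh m)
        (hcau u f hf n m N hn hm) (hcau v g hg n m N hn hm) (hcau w h hh n m N hn hm)
    · have h1 : Tendsto (fun N => C₀ * (3 * M ^ 2 * 2) * ε N) atTop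
          (𝓝 (C₀ * (3 * M ^ 2 * 2) * 0)) :=
        ENNReal.Tendsto.const_mul hε0 (Or.inr (by finiteness))
      rw [mul_zero] at h1
      refine h1.congr fun N => by ring
  obtain ⟨q, hq⟩ := cauchySeq_tendsto_of_complete hpc
  refine ⟨q, ?_, fun B hB => ?_⟩
  · -- successive subsequences, along which the products and all three factors converge almost
    -- everywhere
    obtain ⟨n1, hn1, a1⟩ := exists_seq_tendsto_ae_Lp hq
    obtain ⟨n2, hn2, a2⟩ := exists_seq_tendsto_ae_Lp ((hLp u f hf).comp hn1.tendsto_atTop)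
    obtain ⟨n3, hn3, a3⟩ := exists_seq_tendsto_ae_Lp
      ((hLp v g hg).comp (hn1.comp hn2).tendsto_atTop)
    obtain ⟨n4, hn4, a4⟩ := exists_seq_tendsto_ae_Lp
      ((hLp w h hh).comp ((hn1.comp hn2).comp hn3).tendsto_atTop)
    have b : ∀ᵐ z : ℝ × ℝ, ∀ n, p n z = f n z * ((starRingEnd ℂ) (g n z) * h n z) :=
      ae_all_iff.2 fun n => coeFn_toL2 _
    have bf : ∀ᵐ z : ℝ × ℝ, ∀ n, toL2 (f n) z = f n z := ae_all_iff.2 fun n => coeFn_toL2 _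
    have bg : ∀ᵐ z : ℝ × ℝ, ∀ n, toL2 (g n) z = g n z := ae_all_iff.2 fun n => coeFn_toL2 _
    have bh : ∀ᵐ z : ℝ × ℝ, ∀ n, toL2 (h n) z = h n z := ae_all_iff.2 fun n => coeFn_toL2 _
    filter_upwards [a1, a2, a3, a4, b, bf, bg, bh] with z z1 z2 z3 z4 y1 y2 y3 y4
    simp only [Function.comp_apply, y1, y2, y3, y4] at z1 z2 z3 z4
    have t1 := z1.comp ((hn2.comp hn3).comp hn4).tendsto_atTop
    have t2 := z2.comp (hn3.comp hn4).tendsto_atTop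
    have t3 := z3.comp hn4.tendsto_atTop
    have t3' := (Complex.continuous_conj.tendsto _).comp t3
    exact tendsto_nhds_unique t1 (t2.mul (t3'.mul z4))
  · have hK : Tendsto (fun n => C * (B + 7 * M ^ 2 * ε n)) atTop (𝓝 (C * B)) := by
      have h1 : Tendsto (fun n => B + 7 * M ^ 2 * ε n) atTop (𝓝 (B + 7 * M ^ 2 * 0)) :=
        tendsto_const_nhds.add (ENNReal.Tendsto.const_mul hε0 (Or.inr (by finiteness)))
      rw [mul_zero, add_zero] at h1
      exact ENNReal.Tendsto.const_mul h1 (Or.inr hC)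
    refine sobolevNorm_le_of_tendsto hq (fun n => ?_) hK
    refine hest _ _ _ _ fun i j l hijl => ?_
    have hi : (i : ℝ) + 1 ≤ r + 1 := by
      have : i ≤ r := by omega
      have : (i : ℝ) ≤ r := by exact_mod_cast this
      linarith
    have hj : (j : ℝ) + 1 ≤ r + 1 := by
      have : j ≤ r := by omega
      have : (j : ℝ) ≤ r := by exact_mod_cast this
      linarith
    have hl : (l : ℝ) + 1 ≤ r + 1 := by
      have : l ≤ r := by omega
      have : (l : ℝ) ≤ r := by exact_mod_cast this
      linarith
    have h1 := hB i j l hijl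
    have ma := le_self_add.trans (hMu _ hi)
    have mb := le_self_add.trans (hMv _ hj)
    have mc := le_self_add.trans (hMw _ hl)
    have me : ε n ≤ M := (hε1 n).trans (le_add_self.trans (hMu _ hi))
    refine (mul_le_mul' (mul_le_mul' (hbd u f hf n _ hi) (hbd v g hg n _ hj))
      (hbd w h hh n _ hl)).trans ?_
    generalize sobolevNorm (i + 1) u = a at *
    generalize sobolevNorm (j + 1) v = b at *
    generalize sobolevNorm (l + 1) w = c at *
    calc (a + ε n) * (b + ε n) * (c + ε n)
        = a * b * c + (a * b + b * c + a * c + ε n * a + ε n * b + ε n * c + ε n * ε n) * ε n := by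
          ring
      _ ≤ B + (M * M + M * M + M * M + M * M + M * M + M * M + M * M) * ε n := by gcongr
      _ = B + 7 * M ^ 2 * ε n := by ring

end PartialHarmonic

namespace PartialHarmonic

open Filter
open scoped Topology

/-! ### The cubic term as a bounded trilinear map -/

open Classical in
/-- The product `u v̄ w`, if it is square integrable (and `0` otherwise). -/
noncomputable def cubic (u v w : L2Plane) : L2Plane :=
  if h : ∃ q : L2Plane, q =ᵐ[volume] fun z => u z * ((starRingEnd ℂ) (v z) * w z) then h.choose
  else 0

theorem cubic_eq {u v w q : L2Plane}
    (h : q =ᵐ[volume] fun z => u z * ((starRingEnd ℂ) (v z) * w z)) : cubic u v w = q := by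
  have hex : ∃ q : L2Plane, q =ᵐ[volume] fun z => u z * ((starRingEnd ℂ) (v z) * w z) := ⟨q, h⟩
  rw [cubic, dif_pos hex]
  exact Lp.ext (hex.choose_spec.trans h.symm)

theorem coeFn_cubic {r : ℕ} {u v w : L2Plane} (hu : sobolevNorm (r + 1) u < ∞)
    (hv : sobolevNorm (r + 1) v < ∞) (hw : sobolevNorm (r + 1) w < ∞) :
    cubic u v w =ᵐ[volume] fun z => u z * ((starRingEnd ℂ) (v z) * w z) := by
  obtain ⟨C, -, h⟩ := exists_cubic r
  obtain ⟨q, hq, -⟩ := h u v w hu hv hw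
  rw [cubic_eq hq]
  exact hq

theorem exists_sobolevNorm_cubic_le (r : ℕ) : ∃ C : ℝ≥0∞, C ≠ ∞ ∧ ∀ u v w : L2Plane,
    sobolevNorm (r + 1) u < ∞ → sobolevNorm (r + 1) v < ∞ → sobolevNorm (r + 1) w < ∞ →
    ∀ B : ℝ≥0∞, (∀ i j l : ℕ, i + j + l = r →
      sobolevNorm (i + 1) u * sobolevNorm (j + 1) v * sobolevNorm (l + 1) w ≤ B) →
    sobolevNorm r (cubic u v w) ≤ C * B := by
  obtain ⟨C, hC, h⟩ := exists_cubic r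
  refine ⟨C, hC, fun u v w hu hv hw B hB => ?_⟩
  obtain ⟨q, hq, hb⟩ := h u v w hu hv hw
  rw [cubic_eq hq]
  exact hb B hB

/-- In terms of `L²` functions `a, b, c`, the product of the elements `A^{-(r+1)/2} a`, … of
`ℋ^{r+1}` is bounded in `ℋ^r`. -/
theorem exists_sobolevNorm_cubic_potA_le (r : ℕ) : ∃ C : ℝ, 0 ≤ C ∧ ∀ a b c : L2Plane,
    sobolevNorm r (cubic (potA (r + 1) a) (potA (r + 1) b) (potA (r + 1) c)) ≤
      ENNReal.ofReal (C * ‖a‖ * ‖b‖ * ‖c‖) := by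
  obtain ⟨C, hC, h⟩ := exists_sobolevNorm_cubic_le r
  have hr : (0 : ℝ) ≤ r + 1 := by positivity
  refine ⟨C.toReal, ENNReal.toReal_nonneg, fun a b c => ?_⟩
  have hn : ∀ (i : ℕ) (a : L2Plane), i ≤ r → sobolevNorm (i + 1) (potA (r + 1) a) ≤ ‖a‖ₑ := by
    intro i a hi
    rw [← sobolevNorm_potA_self hr a]
    refine sobolevNorm_mono ?_ _
    have : (i : ℝ) ≤ r := by exact_mod_cast hi
    linarith
  refine (h _ _ _ (sobolevNorm_potA_lt_top hr le_rfl a) (sobolevNorm_potA_lt_top hr le_rfl b)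
    (sobolevNorm_potA_lt_top hr le_rfl c) (‖a‖ₑ * ‖b‖ₑ * ‖c‖ₑ) fun i j l hijl =>
      mul_le_mul' (mul_le_mul' (hn i a (by omega)) (hn j b (by omega)))
        (hn l c (by omega))).trans_eq ?_
  rw [ENNReal.ofReal_mul (by positivity), ENNReal.ofReal_mul (by positivity),
    ENNReal.ofReal_mul (by positivity), ENNReal.ofReal_toReal hC, ofReal_norm, ofReal_norm,
    ofReal_norm]
  ring

/-- The cubic term `u v̄ w` transported from `ℋ^{r+1}` and `ℋ^r` to `L²`; see `cubic_potA`.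
The left inverse of the injective map `A^{-r/2}` is only applied to elements of its range `ℋ^r`. -/
noncomputable def cubicPot (r : ℕ) (a b c : L2Plane) : L2Plane :=
  Function.invFun (potA r) (cubic (potA (r + 1) a) (potA (r + 1) b) (potA (r + 1) c))

theorem cubic_potA (r : ℕ) (a b c : L2Plane) :
    cubic (potA (r + 1) a) (potA (r + 1) b) (potA (r + 1) c) = potA r (cubicPot r a b c) := by
  obtain ⟨C, -, h⟩ := exists_sobolevNorm_cubic_potA_le r
  exact (Function.invFun_eq (exists_potA_eq r.cast_nonneg
    ((h a b c).trans_lt ENNReal.ofReal_lt_top))).symm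

theorem coeFn_cubicPot (r : ℕ) (a b c : L2Plane) :
    potA r (cubicPot r a b c) =ᵐ[volume] fun z => potA (r + 1) a z *
      ((starRingEnd ℂ) (potA (r + 1) b z) * potA (r + 1) c z) := by
  have hr : (0 : ℝ) ≤ r + 1 := by positivity
  rw [← cubic_potA]
  exact coeFn_cubic (sobolevNorm_potA_lt_top hr le_rfl a) (sobolevNorm_potA_lt_top hr le_rfl b)
    (sobolevNorm_potA_lt_top hr le_rfl c)

theorem cubicPot_eq {r : ℕ} {a b c d : L2Plane}
    (h : potA r d =ᵐ[volume] fun z => potA (r + 1) a z *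
      ((starRingEnd ℂ) (potA (r + 1) b z) * potA (r + 1) c z)) : cubicPot r a b c = d :=
  potA_injective r.cast_nonneg (Lp.ext ((coeFn_cubicPot r a b c).trans h.symm))

theorem coeFn_potA_add (r : ℝ) (a b : L2Plane) :
    potA r (a + b) =ᵐ[volume] fun z => potA r a z + potA r b z := by
  rw [map_add]
  exact Lp.coeFn_add _ _

theorem coeFn_potA_smul (r : ℝ) (x : ℝ) (a : L2Plane) :
    potA r (x • a) =ᵐ[volume] fun z => (x : ℂ) * potA r a z := by
  rw [(potA r).map_smul_of_tower x a]
  filter_upwards [Lp.coeFn_smul x (potA r a)] with z hz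
  rw [hz]
  simp

theorem cubicPot_add_left (r : ℕ) (a a' b c : L2Plane) :
    cubicPot r (a + a') b c = cubicPot r a b c + cubicPot r a' b c := by
  refine cubicPot_eq ?_
  filter_upwards [coeFn_potA_add r (cubicPot r a b c) (cubicPot r a' b c),
    coeFn_potA_add (r + 1) a a', coeFn_cubicPot r a b c, coeFn_cubicPot r a' b c] with z h1 h2 h3 h4
  rw [h1, h2, h3, h4]
  ring

theorem cubicPot_add_middle (r : ℕ) (a b b' c : L2Plane) :
    cubicPot r a (b + b') c = cubicPot r a b c + cubicPot r a b' c := by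
  refine cubicPot_eq ?_
  filter_upwards [coeFn_potA_add r (cubicPot r a b c) (cubicPot r a b' c),
    coeFn_potA_add (r + 1) b b', coeFn_cubicPot r a b c, coeFn_cubicPot r a b' c] with z h1 h2 h3 h4
  rw [h1, h2, h3, h4, map_add]
  ring

theorem cubicPot_add_right (r : ℕ) (a b c c' : L2Plane) :
    cubicPot r a b (c + c') = cubicPot r a b c + cubicPot r a b c' := by
  refine cubicPot_eq ?_
  filter_upwards [coeFn_potA_add r (cubicPot r a b c) (cubicPot r a b c'),
    coeFn_potA_add (r + 1) c c', coeFn_cubicPot r a b c, coeFn_cubicPot r a b c'] with z h1 h2 h3 h4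
  rw [h1, h2, h3, h4]
  ring

theorem cubicPot_smul_left (r : ℕ) (x : ℝ) (a b c : L2Plane) :
    cubicPot r (x • a) b c = x • cubicPot r a b c := by
  refine cubicPot_eq ?_
  filter_upwards [coeFn_potA_smul r x (cubicPot r a b c), coeFn_potA_smul (r + 1) x a,
    coeFn_cubicPot r a b c] with z h1 h2 h3
  rw [h1, h2, h3]
  ring

theorem cubicPot_smul_middle (r : ℕ) (x : ℝ) (a b c : L2Plane) :
    cubicPot r a (x • b) c = x • cubicPot r a b c := by
  refine cubicPot_eq ?_
  filter_upwards [coeFn_potA_smul r x (cubicPot r a b c), coeFn_potA_smul (r + 1) x b,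
    coeFn_cubicPot r a b c] with z h1 h2 h3
  rw [h1, h2, h3, map_mul, Complex.conj_ofReal]
  ring

theorem cubicPot_smul_right (r : ℕ) (x : ℝ) (a b c : L2Plane) :
    cubicPot r a b (x • c) = x • cubicPot r a b c := by
  refine cubicPot_eq ?_
  filter_upwards [coeFn_potA_smul r x (cubicPot r a b c), coeFn_potA_smul (r + 1) x c,
    coeFn_cubicPot r a b c] with z h1 h2 h3
  rw [h1, h2, h3]
  ring

/-- `cubicPot` is a bounded real trilinear map. -/
theorem exists_clm_cubicPot (r : ℕ) : ∃ Φ : L2Plane →L[ℝ] L2Plane →L[ℝ] L2Plane →L[ℝ] L2Plane,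
    ∀ a b c, Φ a b c = cubicPot r a b c := by
  obtain ⟨C, hC, h⟩ := exists_sobolevNorm_cubic_potA_le r
  have hb : ∀ a b c, ‖cubicPot r a b c‖ ≤ C * ‖a‖ * ‖b‖ * ‖c‖ := by
    intro a b c
    have h1 := h a b c
    rw [cubic_potA, sobolevNorm_potA_self r.cast_nonneg, ← ofReal_norm] at h1
    exact (ENNReal.ofReal_le_ofReal_iff (by positivity)).1 h1
  let Ψ : L2Plane → (L2Plane →L[ℝ] L2Plane →L[ℝ] L2Plane) := fun a =>
    (LinearMap.mk₂ ℝ (cubicPot r a) (cubicPot_add_middle r a) (fun x b c =>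
      cubicPot_smul_middle r x a b c) (cubicPot_add_right r a) (fun x b c =>
      cubicPot_smul_right r x a b c)).mkContinuous₂ (C * ‖a‖) (hb a)
  have hΨ : ∀ a b c, Ψ a b c = cubicPot r a b c := fun _ _ _ => rfl
  let Φ : L2Plane →ₗ[ℝ] (L2Plane →L[ℝ] L2Plane →L[ℝ] L2Plane) :=
    { toFun := Ψ
      map_add' := fun a a' => by
        ext1 b
        ext1 c
        simp only [add_apply, hΨ, cubicPot_add_left]
      map_smul' := fun x a => by
        ext1 b
        ext1 c
        simp only [smul_apply, hΨ, cubicPot_smul_left, RingHom.id_apply] }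
  have hΦ : ∀ a, ‖Φ a‖ ≤ C * ‖a‖ := fun a =>
    LinearMap.mkContinuous₂_norm_le _ (by positivity) (hb a)
  have hc : Continuous Φ := AddMonoidHomClass.continuous_of_bound Φ C hΦ
  exact ⟨⟨Φ, hc⟩, hΨ⟩

/-! ### Interpolation -/

/-- Chebyshev's integral inequality for the functions `λ^p` and `λ^q`, which are similarly
ordered. It follows from `(λ(x)^p - λ(y)^p) (λ(x)^q - λ(y)^q) ≥ 0` by integrating in `x` and `y`. -/
theorem lintegral_lam_mul_le {p q : ℝ} (hp : 0 ≤ p) (hq : 0 ≤ q) {f : ℕ × ℝ → ℝ≥0∞}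
    (hf : Measurable f) :
    (∫⁻ x, ENNReal.ofReal (lam x ^ p) * f x ∂specMeasure) *
      (∫⁻ x, ENNReal.ofReal (lam x ^ q) * f x ∂specMeasure) ≤
    (∫⁻ x, f x ∂specMeasure) * (∫⁻ x, ENNReal.ofReal (lam x ^ (p + q)) * f x ∂specMeasure) := by
  have hm : ∀ s : ℝ, Measurable fun x => ENNReal.ofReal (lam x ^ s) * f x := fun s =>
    (ENNReal.measurable_ofReal.comp (measurable_lam.pow_const s)).mul hf
  have hpt : ∀ x y, ENNReal.ofReal (lam x ^ p) * f x * (ENNReal.ofReal (lam y ^ q) * f y) +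
      ENNReal.ofReal (lam x ^ q) * f x * (ENNReal.ofReal (lam y ^ p) * f y) ≤
      f x * (ENNReal.ofReal (lam y ^ (p + q)) * f y) +
        ENNReal.ofReal (lam x ^ (p + q)) * f x * f y := by
    intro x y
    have hx := lam_pos x
    have hy := lam_pos y
    have key : lam x ^ p * lam y ^ q + lam x ^ q * lam y ^ p ≤
        lam y ^ (p + q) + lam x ^ (p + q) := by
      rw [Real.rpow_add hx, Real.rpow_add hy]
      rcases le_total (lam x) (lam y) with h | h
      · nlinarith [mul_nonneg (sub_nonneg.2 (Real.rpow_le_rpow hx.le h hp))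
          (sub_nonneg.2 (Real.rpow_le_rpow hx.le h hq))]
      · nlinarith [mul_nonneg (sub_nonneg.2 (Real.rpow_le_rpow hy.le h hp))
          (sub_nonneg.2 (Real.rpow_le_rpow hy.le h hq))]
    have key2 := ENNReal.ofReal_le_ofReal key
    rw [ENNReal.ofReal_add (by positivity) (by positivity),
      ENNReal.ofReal_add (by positivity) (by positivity), ENNReal.ofReal_mul (by positivity),
      ENNReal.ofReal_mul (by positivity)] at key2
    calc _ = (ENNReal.ofReal (lam x ^ p) * ENNReal.ofReal (lam y ^ q) +
          ENNReal.ofReal (lam x ^ q) * ENNReal.ofReal (lam y ^ p)) * (f x * f y) := by ring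
      _ ≤ (ENNReal.ofReal (lam y ^ (p + q)) + ENNReal.ofReal (lam x ^ (p + q))) * (f x * f y) := by
        gcongr
      _ = _ := by ring
  have hint : ∀ x, ENNReal.ofReal (lam x ^ p) * f x *
      (∫⁻ y, ENNReal.ofReal (lam y ^ q) * f y ∂specMeasure) +
      ENNReal.ofReal (lam x ^ q) * f x * (∫⁻ y, ENNReal.ofReal (lam y ^ p) * f y ∂specMeasure) ≤
      f x * (∫⁻ y, ENNReal.ofReal (lam y ^ (p + q)) * f y ∂specMeasure) +
        ENNReal.ofReal (lam x ^ (p + q)) * f x * (∫⁻ y, f y ∂specMeasure) := by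
    intro x
    rw [← lintegral_const_mul _ (hm q), ← lintegral_const_mul _ (hm p),
      ← lintegral_const_mul _ (hm (p + q)), ← lintegral_const_mul _ hf,
      ← lintegral_add_left ((hm q).const_mul _), ← lintegral_add_left ((hm (p + q)).const_mul _)]
    exact lintegral_mono fun y => hpt x y
  have h2 := lintegral_mono (μ := specMeasure) hint
  rw [lintegral_add_left ((hm p).mul_const _), lintegral_add_left (hf.mul_const _),
    lintegral_mul_const _ (hm p), lintegral_mul_const _ (hm q), lintegral_mul_const _ hf,
    lintegral_mul_const _ (hm (p + q))] at h2
  generalize (∫⁻ x, ENNReal.ofReal (lam x ^ p) * f x ∂specMeasure) = P at *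
  generalize (∫⁻ x, ENNReal.ofReal (lam x ^ q) * f x ∂specMeasure) = Q at *
  generalize (∫⁻ x, ENNReal.ofReal (lam x ^ (p + q)) * f x ∂specMeasure) = S at *
  generalize (∫⁻ x, f x ∂specMeasure) = Z at *
  rw [mul_comm Q P, mul_comm S Z, ← two_mul, ← two_mul] at h2
  exact (ENNReal.mul_le_mul_iff_right two_ne_zero ENNReal.ofNat_ne_top).1 h2

theorem enorm_lam_rpow_mul_sq (s : ℝ) (p : ℕ × ℝ) (z : ℂ) :
    ‖((lam p ^ (s / 2) : ℝ) : ℂ) * z‖ₑ ^ 2 = ENNReal.ofReal (lam p ^ s) * ‖z‖ₑ ^ 2 := by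
  have hp := lam_pos p
  rw [enorm_mul, mul_pow, ← ofReal_norm (E := ℂ), Complex.norm_real,
    Real.norm_of_nonneg (by positivity), ← ENNReal.ofReal_pow (by positivity),
    ← Real.rpow_natCast, ← Real.rpow_mul hp.le]
  congr 3
  push_cast
  ring

theorem sobolevNorm_sq_eq_lintegral (ρ : ℝ) (v : L2Plane) : sobolevNorm ρ v ^ 2 =
    ∫⁻ p, ENNReal.ofReal (lam p ^ ρ) * ‖spec v p‖ₑ ^ 2 ∂specMeasure := by
  rw [sobolevNorm_eq, enorm_sq_L2]
  exact lintegral_congr fun p => enorm_lam_rpow_mul_sq ρ p _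

/-- Log-convexity of the Sobolev norms, based at `ℋ^1`: a product of two norms is controlled by
moving all regularity to one factor. -/
theorem sobolevNorm_mul_le {p q : ℝ} (hp : 0 ≤ p) (hq : 0 ≤ q) (u : L2Plane) :
    sobolevNorm (p + 1) u * sobolevNorm (q + 1) u ≤
      sobolevNorm 1 u * sobolevNorm (p + q + 1) u := by
  have hm : Measurable fun x => ENNReal.ofReal (lam x ^ (1 : ℝ)) * ‖spec u x‖ₑ ^ 2 :=
    (ENNReal.measurable_ofReal.comp (measurable_lam.pow_const _)).mul
      ((Lp.stronglyMeasurable _).measurable.enorm.pow_const 2)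
  have hs : ∀ s : ℝ, sobolevNorm (s + 1) u ^ 2 = ∫⁻ x, ENNReal.ofReal (lam x ^ s) *
      (ENNReal.ofReal (lam x ^ (1 : ℝ)) * ‖spec u x‖ₑ ^ 2) ∂specMeasure := by
    intro s
    rw [sobolevNorm_sq_eq_lintegral]
    refine lintegral_congr fun x => ?_
    have hx := lam_pos x
    rw [← mul_assoc, ← ENNReal.ofReal_mul (by positivity), ← Real.rpow_add hx]
  have h1 : sobolevNorm 1 u ^ 2 =
      ∫⁻ x, ENNReal.ofReal (lam x ^ (1 : ℝ)) * ‖spec u x‖ₑ ^ 2 ∂specMeasure := by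
    have := hs 0
    simpa using this
  refine (ENNReal.pow_right_strictMono two_ne_zero).le_iff_le.1 ?_
  rw [mul_pow, mul_pow, hs, hs, hs, h1]
  exact lintegral_lam_mul_le hp hq hm

theorem sobolevNorm_mul_mul_le {p q r : ℝ} (hp : 0 ≤ p) (hq : 0 ≤ q) (hr : 0 ≤ r) (u : L2Plane) :
    sobolevNorm (p + 1) u * sobolevNorm (q + 1) u * sobolevNorm (r + 1) u ≤
      sobolevNorm 1 u ^ 2 * sobolevNorm (p + q + r + 1) u := by
  calc _ ≤ sobolevNorm 1 u * sobolevNorm (p + q + 1) u * sobolevNorm (r + 1) u := by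
        gcongr ?_ * _
        exact sobolevNorm_mul_le hp hq u
    _ = sobolevNorm 1 u * (sobolevNorm (p + q + 1) u * sobolevNorm (r + 1) u) := by ring
    _ ≤ sobolevNorm 1 u * (sobolevNorm 1 u * sobolevNorm (p + q + r + 1) u) := by
        gcongr _ * ?_
        exact sobolevNorm_mul_le (by positivity) hr u
    _ = _ := by ring

end PartialHarmonic

namespace PartialHarmonic

open Filter SchwartzMap
open scoped Topology SchwartzMap

/-! ### Bourgain spaces with `b > 1/2` embed into continuous functions with values in `ℋ^ρ` -/

theorem integrable_schwartz_smul {E : Type*} [NormedAddCommGroup E] [InnerProductSpace ℂ E]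
    (φ : 𝓢(ℝ, ℂ)) (U : Lp E 2 (volume : Measure ℝ)) :
    Integrable fun t => φ t • U t :=
  memLp_one_iff_integrable.1 ((Lp.memLp U).smul (φ.memLp 2 volume))

section Fourier

variable {E F : Type*} [NormedAddCommGroup E] [InnerProductSpace ℂ E] [CompleteSpace E]
  [NormedAddCommGroup F] [InnerProductSpace ℂ F] [CompleteSpace F]

/-- The multiplication formula for the Fourier transform of square integrable functions with
values in a Hilbert space. -/
theorem integral_schwartz_smul_eq (φ : 𝓢(ℝ, ℂ)) (U : Lp E 2 (volume : Measure ℝ)) :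
    ∫ t, φ t • U t = ∫ τ, 𝓕⁻ φ τ • (𝓕 U : Lp E 2 (volume : Measure ℝ)) τ := by
  have h := DFunLike.congr_fun (Lp.fourier_toTemperedDistribution_eq U) (𝓕⁻ φ)
  rw [TemperedDistribution.fourier_apply, Lp.toTemperedDistribution_apply,
    Lp.toTemperedDistribution_apply, FourierTransform.fourier_fourierInv_eq] at h
  exact h

/-- If the image under a bounded operator of the Fourier transform of `U` is integrable, the image
of `U` is given by Fourier inversion, hence bounded by the `L¹` norm. -/
theorem ae_enorm_le_lintegral_fourier (B : E →L[ℂ] F) (U : Lp E 2 (volume : Measure ℝ)) :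
    ∀ᵐ t : ℝ, ‖B (U t)‖ₑ ≤ ∫⁻ τ : ℝ, ‖B ((𝓕 U : Lp E 2 (volume : Measure ℝ)) τ)‖ₑ := by
  set V : Lp E 2 (volume : Measure ℝ) := 𝓕 U with hV
  by_cases hfin : ∫⁻ τ : ℝ, ‖B (V τ)‖ₑ = ∞
  · simp [hfin]
  have hG : Integrable fun τ => B (V τ) :=
    ⟨B.continuous.comp_aestronglyMeasurable (Lp.aestronglyMeasurable V), lt_top_iff_ne_top.2 hfin⟩
  have hL : Continuous fun p : ℝ × ℝ => (-innerₗ ℝ) p.1 p.2 := by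
    simp only [LinearMap.neg_apply, innerₗ_apply_apply]
    fun_prop
  have hcont : Continuous (𝓕⁻ fun τ => B (V τ)) :=
    VectorFourier.fourierIntegral_continuous Real.continuous_fourierChar hL hG
  have hloc : LocallyIntegrable fun t => B (U t) :=
    (B.comp_memLp' (Lp.memLp U)).locallyIntegrable one_le_two
  have hae : (fun t => B (U t)) =ᵐ[volume] 𝓕⁻ fun τ => B (V τ) := by
    refine ae_eq_of_integral_contDiff_smul_eq hloc hcont.locallyIntegrable fun g hg hgc => ?_
    have hgc' : HasCompactSupport (fun x => (g x : ℂ)) := hgc.comp_left Complex.ofReal_zero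
    have hg' : ContDiff ℝ _ (fun x => (g x : ℂ)) := Complex.ofRealCLM.contDiff.comp hg
    set φ : 𝓢(ℝ, ℂ) := hgc'.toSchwartzMap hg' with hφ
    have e1 : ∀ (x : ℝ) (y : F), g x • y = φ x • y := fun x y => by
      simp [hφ]
    simp_rw [e1]
    have e2 : ∫ t, φ t • B (U t) = B (∫ t, φ t • U t) := by
      rw [← B.integral_comp_comm (integrable_schwartz_smul φ U)]
      simp
    have e3 : B (∫ τ, 𝓕⁻ φ τ • V τ) = ∫ τ, 𝓕⁻ φ τ • B (V τ) := by
      rw [← B.integral_comp_comm (integrable_schwartz_smul _ V)]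
      simp
    rw [e2, integral_schwartz_smul_eq, ← hV, e3, SchwartzMap.fourierInv_coe]
    have := VectorFourier.integral_fourierIntegral_smul_eq_flip (L := -innerₗ ℝ)
      (μ := volume) (ν := volume) Real.continuous_fourierChar hL (φ.integrable (μ := volume)) hG
    have hflip : (-innerₗ ℝ : ℝ →ₗ[ℝ] ℝ →ₗ[ℝ] ℝ).flip = -innerₗ ℝ := by
      ext
      simp
    rw [hflip] at this
    exact this
  filter_upwards [hae] with t ht
  rw [ht]
  refine (enorm_integral_le_lintegral_enorm _).trans_eq (lintegral_congr fun τ => ?_)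
  rw [← ofReal_norm, Circle.norm_smul, ofReal_norm]

end Fourier

/-- The multiplier `A^{ρ/2}` restricted to the spectral shell `n ≤ A < n + 1`. On a shell the weight
of the Bourgain norm is comparable to a function of `τ` alone, so that Fourier inversion in time
can be applied to functions with values in `L²(ℝ²)`, shell by shell. -/
noncomputable def shellOp (ρ : ℝ) (n : ℕ) : L2Plane →L[ℂ] L2Plane :=
  mulOp fun p => if ⌊lam p⌋₊ = n then ((lam p ^ (ρ / 2) : ℝ) : ℂ) else 0

theorem isBddSymbol_shell {ρ : ℝ} (hρ : 0 ≤ ρ) (n : ℕ) :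
    IsBddSymbol fun p => if ⌊lam p⌋₊ = n then ((lam p ^ (ρ / 2) : ℝ) : ℂ) else 0 := by
  refine ⟨Measurable.ite ((Nat.measurable_floor.comp measurable_lam) (measurableSet_singleton n))
    (measurable_lam_rpow _) measurable_const, ((n : ℝ) + 1) ^ (ρ / 2), fun p => ?_⟩
  have hp := lam_pos p
  beta_reduce
  split_ifs with h
  · rw [Complex.norm_real, Real.norm_of_nonneg (by positivity)]
    refine Real.rpow_le_rpow hp.le ?_ (by positivity)
    rw [← h]
    exact (Nat.lt_floor_add_one _).le
  · rw [norm_zero]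
    positivity

theorem enorm_shellOp_sq {ρ : ℝ} (hρ : 0 ≤ ρ) (n : ℕ) (v : L2Plane) :
    ‖shellOp ρ n v‖ₑ ^ 2 = ∫⁻ p, (if ⌊lam p⌋₊ = n then
      ENNReal.ofReal (lam p ^ ρ) * ‖spec v p‖ₑ ^ 2 else 0) ∂specMeasure := by
  rw [shellOp, enorm_mulOp (isBddSymbol_shell hρ n), enorm_sq_L2]
  refine lintegral_congr fun p => ?_
  split_ifs with h
  · exact enorm_lam_rpow_mul_sq ρ p _
  · simp

theorem measurable_shell_integrand (ρ : ℝ) (n : ℕ) (v : L2Plane) :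
    Measurable fun p => if ⌊lam p⌋₊ = n then
      ENNReal.ofReal (lam p ^ ρ) * ‖spec v p‖ₑ ^ 2 else 0 :=
  Measurable.ite ((Nat.measurable_floor.comp measurable_lam) (measurableSet_singleton n))
    ((ENNReal.measurable_ofReal.comp (measurable_lam.pow_const _)).mul
      ((Lp.stronglyMeasurable _).measurable.enorm.pow_const 2)) measurable_const

/-- Each frequency lies in exactly one shell, so that a weighted sum over the shells is an
integral. -/
theorem tsum_mul_enorm_shellOp_sq {ρ : ℝ} (hρ : 0 ≤ ρ) (c : ℕ → ℝ≥0∞) (v : L2Plane) :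
    ∑' n, c n * ‖shellOp ρ n v‖ₑ ^ 2 = ∫⁻ p, c ⌊lam p⌋₊ *
      (ENNReal.ofReal (lam p ^ ρ) * ‖spec v p‖ₑ ^ 2) ∂specMeasure := by
  simp_rw [enorm_shellOp_sq hρ]
  have hc := fun n => (lintegral_const_mul (μ := specMeasure) (c n)
    (measurable_shell_integrand ρ n v)).symm
  rw [tsum_congr hc]
  rw [← lintegral_tsum fun n => ((measurable_shell_integrand ρ n v).const_mul _).aemeasurable]
  refine lintegral_congr fun p => ?_
  rw [tsum_eq_single ⌊lam p⌋₊ fun n hn => by rw [if_neg hn.symm, mul_zero], if_pos rfl]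

theorem tsum_enorm_shellOp_sq {ρ : ℝ} (hρ : 0 ≤ ρ) (v : L2Plane) :
    ∑' n, ‖shellOp ρ n v‖ₑ ^ 2 = sobolevNorm ρ v ^ 2 := by
  have := tsum_mul_enorm_shellOp_sq hρ (fun _ => 1) v
  simp only [one_mul] at this
  rw [this, sobolevNorm_sq_eq_lintegral]

/-- On the shell `n ≤ λ < n + 1` the weight `⟨τ - λ⟩` may be replaced by `⟨τ - n⟩`. -/
theorem tsum_weight_enorm_shellOp_sq_le {ρ b : ℝ} (hρ : 0 ≤ ρ) (hb : 0 ≤ b) (x : ℝ)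
    (v : L2Plane) :
    ∑' n : ℕ, ENNReal.ofReal ((1 + (x - n) ^ 2) ^ b) * ‖shellOp ρ n v‖ₑ ^ 2 ≤
      ENNReal.ofReal (3 ^ b) * ∑' k : ℕ, ∫⁻ ξ : ℝ,
        ENNReal.ofReal ((1 + symbolA ξ k ^ 2) ^ (ρ / 2) * (1 + (x - symbolA ξ k) ^ 2) ^ b) *
          ‖specTransform v k ξ‖ₑ ^ 2 := by
  have hmeas : Measurable fun p => ENNReal.ofReal ((1 + lam p ^ 2) ^ (ρ / 2) *
      (1 + (x - lam p) ^ 2) ^ b) * ‖specTransform v p.1 p.2‖ₑ ^ 2 :=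
    (ENNReal.measurable_ofReal.comp (((measurable_lam.pow_const 2).const_add 1 |>.pow_const _).mul
      ((measurable_lam.const_sub x |>.pow_const 2).const_add 1 |>.pow_const _))).mul
      ((measurable_specTransform v).enorm.pow_const 2)
  have hR := lintegral_specMeasure hmeas.aemeasurable
  change _ ≤ ENNReal.ofReal (3 ^ b) * ∑' k : ℕ, ∫⁻ ξ : ℝ,
        ENNReal.ofReal ((1 + lam (k, ξ) ^ 2) ^ (ρ / 2) * (1 + (x - lam (k, ξ)) ^ 2) ^ b) *
          ‖specTransform v k ξ‖ₑ ^ 2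
  rw [← hR, ← lintegral_const_mul _ hmeas, tsum_mul_enorm_shellOp_sq hρ]
  refine lintegral_mono_ae ?_
  filter_upwards [coeFn_spec v] with p hp
  rw [hp, ← mul_assoc, ← mul_assoc, ← ENNReal.ofReal_mul (by positivity),
    ← ENNReal.ofReal_mul (by positivity)]
  refine mul_le_mul_left (ENNReal.ofReal_le_ofReal ?_) _
  have h1 := one_le_lam p
  have hfl := Nat.floor_le (zero_le_one.trans h1)
  have hfl' := Nat.lt_floor_add_one (lam p)
  have e1 : (1 + (x - ⌊lam p⌋₊) ^ 2) ^ b ≤ 3 ^ b * (1 + (x - lam p) ^ 2) ^ b := by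
    rw [← Real.mul_rpow (by positivity) (by positivity)]
    refine Real.rpow_le_rpow (by positivity) ?_ hb
    -- `1 + (z + δ)² ≤ 3 (1 + z²)` for `z = x - λ` and `0 ≤ δ < 1`
    nlinarith [sq_nonneg (x - lam p - (lam p - ⌊lam p⌋₊))]
  have e2 : lam p ^ ρ ≤ (1 + lam p ^ 2) ^ (ρ / 2) := by
    have : lam p ^ ρ = (lam p ^ 2) ^ (ρ / 2) := by
      rw [← Real.rpow_natCast, ← Real.rpow_mul (by positivity)]
      congr 1
      push_cast
      ring
    rw [this]
    exact Real.rpow_le_rpow (by positivity) (by linarith) (by positivity)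
  calc _ ≤ 3 ^ b * (1 + (x - lam p) ^ 2) ^ b * (1 + lam p ^ 2) ^ (ρ / 2) := by gcongr
    _ = _ := by ring

/-- The integral of `⟨τ - n⟩^{-2b}` is finite for `b > 1/2`, uniformly in `n`. -/
theorem exists_lintegral_weight_le {b : ℝ} (hb : 1 / 2 < b) : ∃ K : ℝ≥0∞, K ≠ ∞ ∧ ∀ n : ℕ,
    ∫⁻ τ : ℝ, ENNReal.ofReal ((1 + (2 * Real.pi * τ - n) ^ 2) ^ (-b)) ≤ K := by
  have hint : Integrable (fun x : ℝ => ((1 : ℝ) + ‖x‖ ^ 2) ^ (-(2 * b) / 2)) volume :=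
    integrable_rpow_neg_one_add_norm_sq (by simp; linarith)
  refine ⟨∫⁻ x : ℝ, ENNReal.ofReal ((1 + x ^ 2) ^ (-b)), ?_, fun n => ?_⟩
  · have := hint.lintegral_lt_top
    simp only [Real.norm_eq_abs, sq_abs] at this
    rw [show -(2 * b) / 2 = -b by ring] at this
    exact this.ne
  · rw [← lintegral_sub_right_eq_self (fun x : ℝ => ENNReal.ofReal ((1 + x ^ 2) ^ (-b)))
      (n / (2 * Real.pi))]
    -- after a translation by `n / (2π)` the rescaled weight `⟨2πτ⟩^{-2b}` is at most `⟨τ⟩^{-2b}`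
    refine lintegral_mono fun τ => ENNReal.ofReal_le_ofReal ?_
    refine Real.rpow_le_rpow_of_nonpos (by positivity) ?_ (by linarith)
    have hpi := Real.pi_gt_three
    have e : 2 * Real.pi * τ - n = 2 * Real.pi * (τ - n / (2 * Real.pi)) := by
      field_simp
    rw [e, mul_pow]
    have : 1 ≤ (2 * Real.pi) ^ 2 := by nlinarith
    nlinarith [sq_nonneg (τ - n / (2 * Real.pi))]

/-- Cauchy-Schwarz with the weight `⟨τ - n⟩^b` bounds the shells of an element of a Bourgain space,
uniformly in time. -/
theorem exists_ae_enorm_shellOp_le {ρ b : ℝ} (hρ : 0 ≤ ρ) (hb : 1 / 2 < b)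
    {U : Lp L2Plane 2 (volume : Measure ℝ)} (hU : bourgainNorm ρ b U < ∞) :
    ∃ a : ℕ → ℝ≥0∞, ∑' n, a n ≠ ∞ ∧ ∀ n, ∀ᵐ t : ℝ, ‖shellOp ρ n (U t)‖ₑ ^ 2 ≤ a n := by
  obtain ⟨K, hK, hKb⟩ := exists_lintegral_weight_le hb
  set V : Lp L2Plane 2 (volume : Measure ℝ) := 𝓕 U with hV
  have hm : ∀ n, AEMeasurable (fun τ => ‖shellOp ρ n (V τ)‖ₑ) volume := fun n =>
    ((shellOp ρ n).continuous.comp_aestronglyMeasurable (Lp.aestronglyMeasurable V)).enorm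
  have hw : ∀ (n : ℕ) (s : ℝ), Measurable fun τ : ℝ =>
      ENNReal.ofReal ((1 + (2 * Real.pi * τ - n) ^ 2) ^ s) := fun n s => by
    fun_prop
  set J : ℕ → ℝ≥0∞ := fun n => ∫⁻ τ : ℝ, ENNReal.ofReal ((1 + (2 * Real.pi * τ - n) ^ 2) ^ b) *
    ‖shellOp ρ n (V τ)‖ₑ ^ 2 with hJ
  refine ⟨fun n => K * J n, ?_, fun n => ?_⟩
  · have hsum := lintegral_tsum (μ := volume) fun n =>
      (hw n b).aemeasurable.mul ((hm n).pow_const 2)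
    simp only [Pi.mul_apply] at hsum
    rw [ENNReal.tsum_mul_left, hJ, ← hsum]
    refine ENNReal.mul_ne_top hK (ne_top_of_le_ne_top ?_ (lintegral_mono fun τ =>
      tsum_weight_enorm_shellOp_sq_le hρ (by linarith) (2 * Real.pi * τ) (V τ)))
    rw [lintegral_const_mul' _ _ ENNReal.ofReal_ne_top]
    refine ENNReal.mul_ne_top ENNReal.ofReal_ne_top fun h => hU.ne ?_
    rw [bourgainNorm, ← hV, h, ENNReal.top_rpow_of_pos (by norm_num)]
  · filter_upwards [ae_enorm_le_lintegral_fourier (shellOp ρ n) U] with t ht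
    refine (pow_le_pow_left' ht 2).trans ?_
    rw [← hV]
    have e : ∀ τ : ℝ, ‖shellOp ρ n (V τ)‖ₑ =
        ENNReal.ofReal ((1 + (2 * Real.pi * τ - n) ^ 2) ^ (-b / 2)) *
        (ENNReal.ofReal ((1 + (2 * Real.pi * τ - n) ^ 2) ^ (b / 2)) * ‖shellOp ρ n (V τ)‖ₑ) := by
      intro τ
      rw [← mul_assoc, ← ENNReal.ofReal_mul (by positivity), ← Real.rpow_add (by positivity)]
      ring_nf
      simp
    have hs : ∀ (τ s : ℝ), ENNReal.ofReal ((1 + (2 * Real.pi * τ - n) ^ 2) ^ (s / 2)) ^ 2 =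
        ENNReal.ofReal ((1 + (2 * Real.pi * τ - n) ^ 2) ^ s) := by
      intro τ s
      rw [← ENNReal.ofReal_pow (by positivity), ← Real.rpow_natCast,
        ← Real.rpow_mul (by positivity)]
      congr 2
      push_cast
      ring
    have hcs := ENNReal.lintegral_mul_le_Lp_mul_Lq volume Real.HolderConjugate.two_two
      (hw n (-b / 2)).aemeasurable ((hw n (b / 2)).aemeasurable.mul (hm n))
    simp only [Pi.mul_apply, ENNReal.rpow_two, mul_pow, hs] at hcs
    simp_rw [← e] at hcs
    refine (pow_le_pow_left' hcs 2).trans ?_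
    rw [mul_pow, ← ENNReal.rpow_natCast, ← ENNReal.rpow_natCast, ← ENNReal.rpow_mul,
      ← ENNReal.rpow_mul]
    norm_num
    exact mul_le_mul_left (hKb n) _

/-- A function which is continuous in `L²` and belongs to a Bourgain space with `b > 1/2` is
continuous with values in `ℋ^ρ`. Each shell is continuous, and the squares of the norms of the
shells are dominated by a summable sequence, uniformly in time. -/
theorem exists_continuousOn_potA {ρ b T : ℝ} (hρ : 0 ≤ ρ) (hb : 1 / 2 < b) {u : ℝ → L2Plane}
    (hu : MemBourgain ρ b T u) (hc : ContinuousOn u (Ioo (-T) T)) :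
    ∃ w : ℝ → L2Plane, ContinuousOn w (Ioo (-T) T) ∧ ∀ t ∈ Ioo (-T) T, u t = potA ρ (w t) := by
  obtain ⟨U, hU, hUu⟩ := hu
  obtain ⟨a, ha, hb⟩ := exists_ae_enorm_shellOp_le hρ hb hU
  have hshell : ∀ n, ContinuousOn (fun t => shellOp ρ n (u t)) (Ioo (-T) T) := fun n =>
    (shellOp ρ n).continuous.comp_continuousOn hc
  have hle : ∀ n, ∀ t ∈ Ioo (-T) T, ‖shellOp ρ n (u t)‖ₑ ^ 2 ≤ a n := by
    intro n
    -- the bound holds almost everywhere in time, hence everywhere by continuity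
    have hae : (fun t => max (‖shellOp ρ n (u t)‖ₑ ^ 2) (a n)) =ᵐ[volume.restrict (Ioo (-T) T)]
        fun _ => a n := by
      filter_upwards [hUu, ae_restrict_of_ae (hb n)] with t h1 h2
      rw [← h1]
      exact max_eq_right h2
    have hcont : ContinuousOn (fun t => max (‖shellOp ρ n (u t)‖ₑ ^ 2) (a n)) (Ioo (-T) T) :=
      ContinuousOn.sup ((ENNReal.continuous_pow 2).comp_continuousOn (hshell n).enorm)
        continuousOn_const
    have := Measure.eqOn_open_of_ae_eq hae isOpen_Ioo hcont continuousOn_const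
    exact fun t ht => max_eq_right_iff.1 (this ht)
  have hfin : ∀ t ∈ Ioo (-T) T, sobolevNorm ρ (u t) < ∞ := by
    intro t ht
    have : sobolevNorm ρ (u t) ^ 2 ≠ ∞ := by
      rw [← tsum_enorm_shellOp_sq hρ]
      exact ne_top_of_le_ne_top ha (ENNReal.tsum_le_tsum fun n => hle n t ht)
    exact lt_top_iff_ne_top.2 fun h => this (by rw [h]; simp)
  have hex : ∀ t, ∃ w, t ∈ Ioo (-T) T → u t = potA ρ w := by
    intro t
    by_cases ht : t ∈ Ioo (-T) T
    · obtain ⟨w, hw⟩ := exists_potA_eq hρ (hfin t ht)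
      exact ⟨w, fun _ => hw.symm⟩
    · exact ⟨0, fun h => absurd h ht⟩
  choose w hw using hex
  refine ⟨w, fun t₀ ht₀ => ?_, hw⟩
  have hsq : ∀ t ∈ Ioo (-T) T, edist (w t) (w t₀) ^ 2 =
      ∑' n, ‖shellOp ρ n (u t) - shellOp ρ n (u t₀)‖ₑ ^ 2 := by
    intro t ht
    simp_rw [← map_sub]
    rw [tsum_enorm_shellOp_sq hρ, hw t ht, hw t₀ ht₀, ← map_sub, sobolevNorm_potA_self hρ,
      edist_eq_enorm_sub]
  have hlim : Tendsto (fun t => ∑' n, ‖shellOp ρ n (u t) - shellOp ρ n (u t₀)‖ₑ ^ 2)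
      (𝓝[Ioo (-T) T] t₀) (𝓝 0) := by
    simp_rw [← lintegral_count]
    rw [← lintegral_zero (μ := (Measure.count : Measure ℕ))]
    refine tendsto_lintegral_filter_of_dominated_convergence (fun n => 4 * a n)
      (Eventually.of_forall fun t => measurable_from_nat) ?_ ?_
      (Eventually.of_forall fun n => ?_)
    · filter_upwards [self_mem_nhdsWithin] with t ht
      refine Eventually.of_forall fun n => ?_
      have h1 := enorm_sub_le (a := shellOp ρ n (u t)) (b := shellOp ρ n (u t₀))
      calc ‖shellOp ρ n (u t) - shellOp ρ n (u t₀)‖ₑ ^ 2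
          ≤ (2 * max ‖shellOp ρ n (u t)‖ₑ ‖shellOp ρ n (u t₀)‖ₑ) ^ 2 := by
            refine pow_le_pow_left' (h1.trans ?_) 2
            rw [two_mul]
            exact add_le_add (le_max_left _ _) (le_max_right _ _)
        _ = 4 * max ‖shellOp ρ n (u t)‖ₑ ‖shellOp ρ n (u t₀)‖ₑ ^ 2 := by ring
        _ ≤ 4 * a n := by
            gcongr
            rcases max_choice ‖shellOp ρ n (u t)‖ₑ ‖shellOp ρ n (u t₀)‖ₑ with h | h <;> rw [h]
            exacts [hle n t ht, hle n t₀ ht₀]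
    · rw [lintegral_count, ENNReal.tsum_mul_left]
      exact ENNReal.mul_ne_top ENNReal.ofNat_ne_top ha
    · have h1 : Tendsto (fun t => ‖shellOp ρ n (u t) - shellOp ρ n (u t₀)‖ₑ ^ 2)
          (𝓝[Ioo (-T) T] t₀) (𝓝 (‖shellOp ρ n (u t₀) - shellOp ρ n (u t₀)‖ₑ ^ 2)) :=
        (ENNReal.continuous_pow 2).continuousAt.tendsto.comp
          ((hshell n t₀ ht₀).sub continuousWithinAt_const).enorm
      simpa using h1
  rw [ContinuousWithinAt, tendsto_iff_edist_tendsto_0]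
  refine tendsto_of_sq_tendsto_zero (hlim.congr' ?_)
  filter_upwards [self_mem_nhdsWithin] with t ht
  exact (hsq t ht).symm

end PartialHarmonic

namespace PartialHarmonic

open Filter
open scoped Topology

/-! ### Continuity and differentiability in time with values in `ℋ^r` -/

/-- `v` is continuous on `I` with values in `ℋ^r`; equivalently, `A^{r/2} v` is continuous. -/
def SobolevContinuousOn (r : ℝ) (I : Set ℝ) (v : ℝ → L2Plane) : Prop :=
  ∃ w : ℝ → L2Plane, ContinuousOn w I ∧ ∀ t ∈ I, v t = potA r (w t)

/-- On the open set `I`, `v` is differentiable as a function with values in `ℋ^r`, and `v'` is its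
derivative; equivalently, `A^{r/2} v` has the derivative `A^{r/2} v'`. -/
def SobolevHasDerivOn (r : ℝ) (I : Set ℝ) (v v' : ℝ → L2Plane) : Prop :=
  ∃ w w' : ℝ → L2Plane, ∀ t ∈ I,
    v t = potA r (w t) ∧ HasDerivAt w (w' t) t ∧ v' t = potA r (w' t)

variable {r r' : ℝ} {I : Set ℝ}

namespace SobolevContinuousOn

variable {v₁ v₂ : ℝ → L2Plane}

theorem congr (h : SobolevContinuousOn r I v₁) (he : ∀ t ∈ I, v₂ t = v₁ t) :
    SobolevContinuousOn r I v₂ := by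
  obtain ⟨w, hw, hv⟩ := h
  exact ⟨w, hw, fun t ht => (he t ht).trans (hv t ht)⟩

theorem mono (h : SobolevContinuousOn r I v₁) (hr' : 0 ≤ r') (hr : r' ≤ r) :
    SobolevContinuousOn r' I v₁ := by
  obtain ⟨w, hw, hv⟩ := h
  refine ⟨fun t => potA (r - r') (w t), (potA (r - r')).continuous.comp_continuousOn hw,
    fun t ht => ?_⟩
  rw [hv t ht, potA_potA hr' (by linarith), add_sub_cancel]

theorem continuousOn (h : SobolevContinuousOn r I v₁) : ContinuousOn v₁ I := by
  obtain ⟨w, hw, hv⟩ := h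
  exact ((potA r).continuous.comp_continuousOn hw).congr hv

theorem sobolevNorm_lt_top (h : SobolevContinuousOn r I v₁) (hr : 0 ≤ r) {t : ℝ} (ht : t ∈ I) :
    sobolevNorm r (v₁ t) < ∞ := by
  obtain ⟨w, -, hv⟩ := h
  rw [hv t ht]
  exact sobolevNorm_potA_lt_top hr le_rfl _

theorem zero : SobolevContinuousOn r I fun _ => 0 :=
  ⟨fun _ => 0, continuousOn_const, fun _ _ => (map_zero _).symm⟩

theorem add (h₁ : SobolevContinuousOn r I v₁) (h₂ : SobolevContinuousOn r I v₂) :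
    SobolevContinuousOn r I fun t => v₁ t + v₂ t := by
  obtain ⟨w₁, hw₁, hv₁⟩ := h₁
  obtain ⟨w₂, hw₂, hv₂⟩ := h₂
  exact ⟨fun t => w₁ t + w₂ t, hw₁.add hw₂, fun t ht => by
    beta_reduce
    rw [hv₁ t ht, hv₂ t ht, map_add]⟩

theorem const_smul (h : SobolevContinuousOn r I v₁) (c : ℂ) :
    SobolevContinuousOn r I fun t => c • v₁ t := by
  obtain ⟨w, hw, hv⟩ := h
  exact ⟨fun t => c • w t, hw.const_smul c, fun t ht => by
    beta_reduce
    rw [hv t ht, map_smul]⟩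

theorem listSum {ι : Type*} (l : List ι) {f : ι → ℝ → L2Plane}
    (h : ∀ p ∈ l, SobolevContinuousOn r I (f p)) :
    SobolevContinuousOn r I fun t => (l.map fun p => f p t).sum := by
  induction l with
  | nil => simpa using zero
  | cons a l ih =>
    simp only [List.map_cons, List.sum_cons]
    exact (h a (by simp)).add (ih fun p hp => h p (by simp [hp]))

theorem powA_one (h : SobolevContinuousOn (r + 2) I v₁) (hr : 0 ≤ r) :
    SobolevContinuousOn r I fun t => powA 1 (v₁ t) := by
  obtain ⟨w, hw, hv⟩ := h
  refine ⟨w, hw, fun t ht => ?_⟩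
  beta_reduce
  have := powA_potA 1 hr (w t)
  rw [hv t ht, ← this]
  norm_num

theorem cubic {n : ℕ} {v₃ : ℝ → L2Plane} (h₁ : SobolevContinuousOn (n + 1) I v₁)
    (h₂ : SobolevContinuousOn (n + 1) I v₂) (h₃ : SobolevContinuousOn (n + 1) I v₃) :
    SobolevContinuousOn n I fun t => cubic (v₁ t) (v₂ t) (v₃ t) := by
  obtain ⟨w₁, hw₁, hv₁⟩ := h₁
  obtain ⟨w₂, hw₂, hv₂⟩ := h₂
  obtain ⟨w₃, hw₃, hv₃⟩ := h₃
  obtain ⟨Φ, hΦ⟩ := exists_clm_cubicPot n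
  refine ⟨fun t => Φ (w₁ t) (w₂ t) (w₃ t),
    ((Φ.continuous.comp_continuousOn hw₁).clm_apply hw₂).clm_apply hw₃, fun t ht => ?_⟩
  beta_reduce
  rw [hv₁ t ht, hv₂ t ht, hv₃ t ht, cubic_potA, hΦ]

end SobolevContinuousOn

namespace SobolevHasDerivOn

variable {v₁ v₂ v₁' v₂' : ℝ → L2Plane}

theorem congr (h : SobolevHasDerivOn r I v₁ v₁') (he : ∀ t ∈ I, v₂ t = v₁ t)
    (he' : ∀ t ∈ I, v₂' t = v₁' t) : SobolevHasDerivOn r I v₂ v₂' := by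
  obtain ⟨w, w', hw⟩ := h
  exact ⟨w, w', fun t ht => ⟨(he t ht).trans (hw t ht).1, (hw t ht).2.1,
    (he' t ht).trans (hw t ht).2.2⟩⟩

theorem hasDerivAt (h : SobolevHasDerivOn r I v₁ v₁') (hI : IsOpen I) {t : ℝ} (ht : t ∈ I) :
    HasDerivAt v₁ (v₁' t) t := by
  obtain ⟨w, w', hw⟩ := h
  rw [(hw t ht).2.2]
  refine (((potA r).restrictScalars ℝ).hasFDerivAt.comp_hasDerivAt t
    (hw t ht).2.1).congr_of_eventuallyEq ?_
  filter_upwards [hI.mem_nhds ht] with x hx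
  exact (hw x hx).1

theorem zero : SobolevHasDerivOn r I (fun _ => 0) fun _ => 0 :=
  ⟨fun _ => 0, fun _ => 0, fun t _ => ⟨(map_zero _).symm, hasDerivAt_const t 0, (map_zero _).symm⟩⟩

theorem add (h₁ : SobolevHasDerivOn r I v₁ v₁') (h₂ : SobolevHasDerivOn r I v₂ v₂') :
    SobolevHasDerivOn r I (fun t => v₁ t + v₂ t) fun t => v₁' t + v₂' t := by
  obtain ⟨w₁, w₁', hw₁⟩ := h₁
  obtain ⟨w₂, w₂', hw₂⟩ := h₂
  refine ⟨fun t => w₁ t + w₂ t, fun t => w₁' t + w₂' t, fun t ht => ?_⟩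
  obtain ⟨a1, a2, a3⟩ := hw₁ t ht
  obtain ⟨b1, b2, b3⟩ := hw₂ t ht
  exact ⟨by beta_reduce; rw [a1, b1, map_add], a2.add b2, by beta_reduce; rw [a3, b3, map_add]⟩

theorem const_smul (h : SobolevHasDerivOn r I v₁ v₁') (c : ℂ) :
    SobolevHasDerivOn r I (fun t => c • v₁ t) fun t => c • v₁' t := by
  obtain ⟨w, w', hw⟩ := h
  refine ⟨fun t => c • w t, fun t => c • w' t, fun t ht => ?_⟩
  obtain ⟨a1, a2, a3⟩ := hw t ht
  exact ⟨by beta_reduce; rw [a1, map_smul], a2.const_smul c, by beta_reduce; rw [a3, map_smul]⟩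

theorem listSum {ι : Type*} (l : List ι) {f f' : ι → ℝ → L2Plane}
    (h : ∀ p ∈ l, SobolevHasDerivOn r I (f p) (f' p)) :
    SobolevHasDerivOn r I (fun t => (l.map fun p => f p t).sum)
      fun t => (l.map fun p => f' p t).sum := by
  induction l with
  | nil => simpa using zero
  | cons a l ih =>
    simp only [List.map_cons, List.sum_cons]
    exact (h a (by simp)).add (ih fun p hp => h p (by simp [hp]))

theorem powA_one (h : SobolevHasDerivOn (r + 2) I v₁ v₁') (hr : 0 ≤ r) :
    SobolevHasDerivOn r I (fun t => powA 1 (v₁ t)) fun t => powA 1 (v₁' t) := by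
  obtain ⟨w, w', hw⟩ := h
  have hp : ∀ x, powA 1 (potA (r + 2) x) = potA r x := fun x => by
    simpa using powA_potA 1 hr x
  refine ⟨w, w', fun t ht => ?_⟩
  obtain ⟨a1, a2, a3⟩ := hw t ht
  exact ⟨by beta_reduce; rw [a1, hp], a2, by beta_reduce; rw [a3, hp]⟩

set_option maxSynthPendingDepth 3 in
/-- The product rule for a bounded trilinear map. -/
theorem hasDerivAt_trilinear {E : Type*} [NormedAddCommGroup E] [NormedSpace ℝ E]
    (Φ : E →L[ℝ] E →L[ℝ] E →L[ℝ] E) {a b c : ℝ → E} {a' b' c' : E} {t : ℝ}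
    (ha : HasDerivAt a a' t) (hb : HasDerivAt b b' t) (hc : HasDerivAt c c' t) :
    HasDerivAt (fun t => Φ (a t) (b t) (c t))
      (Φ a' (b t) (c t) + Φ (a t) b' (c t) + Φ (a t) (b t) c') t := by
  have h := (((hasDerivAt_const t Φ).clm_apply ha).clm_apply hb).clm_apply hc
  simpa using h

/-- The product rule for `u v̄ w`, with the loss of one derivative that the product incurs. -/
theorem cubic {n : ℕ} {v₃ v₃' : ℝ → L2Plane} (h₁ : SobolevHasDerivOn (n + 1) I v₁ v₁')
    (h₂ : SobolevHasDerivOn (n + 1) I v₂ v₂') (h₃ : SobolevHasDerivOn (n + 1) I v₃ v₃') :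
    SobolevHasDerivOn n I (fun t => cubic (v₁ t) (v₂ t) (v₃ t)) fun t =>
      cubic (v₁' t) (v₂ t) (v₃ t) + cubic (v₁ t) (v₂' t) (v₃ t) + cubic (v₁ t) (v₂ t) (v₃' t) := by
  obtain ⟨w₁, w₁', hw₁⟩ := h₁
  obtain ⟨w₂, w₂', hw₂⟩ := h₂
  obtain ⟨w₃, w₃', hw₃⟩ := h₃
  obtain ⟨Φ, hΦ⟩ := exists_clm_cubicPot n
  refine ⟨fun t => Φ (w₁ t) (w₂ t) (w₃ t), fun t => Φ (w₁' t) (w₂ t) (w₃ t) +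
    Φ (w₁ t) (w₂' t) (w₃ t) + Φ (w₁ t) (w₂ t) (w₃' t), fun t ht => ?_⟩
  obtain ⟨a1, a2, a3⟩ := hw₁ t ht
  obtain ⟨b1, b2, b3⟩ := hw₂ t ht
  obtain ⟨c1, c2, c3⟩ := hw₃ t ht
  refine ⟨by beta_reduce; rw [a1, b1, c1, cubic_potA, hΦ], ?_, ?_⟩
  · exact hasDerivAt_trilinear Φ a2 b2 c2
  · simp only [a1, b1, c1, a3, b3, c3, cubic_potA, hΦ, map_add]

end SobolevHasDerivOn

/-! ### The time derivatives of a solution -/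

/-- The list of the triples `(a, b, c)` which occur as orders of differentiation in
`∂_t^m (v₁ v₂ v₃) = ∑ ∂_t^a v₁ ∂_t^b v₂ ∂_t^c v₃`, with multiplicity. -/
def leibnizTriples : ℕ → List (ℕ × ℕ × ℕ)
  | 0 => [(0, 0, 0)]
  | m + 1 => (leibnizTriples m).flatMap fun p =>
      [(p.1 + 1, p.2.1, p.2.2), (p.1, p.2.1 + 1, p.2.2), (p.1, p.2.1, p.2.2 + 1)]

theorem add_add_of_mem_leibnizTriples {m : ℕ} {p : ℕ × ℕ × ℕ} (hp : p ∈ leibnizTriples m) :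
    p.1 + p.2.1 + p.2.2 = m := by
  induction m generalizing p with
  | zero =>
    simp only [leibnizTriples, List.mem_singleton] at hp
    simp [hp]
  | succ m ih =>
    simp only [leibnizTriples, List.mem_flatMap, List.mem_cons, List.not_mem_nil, or_false] at hp
    obtain ⟨q, hq, rfl | rfl | rfl⟩ := hp <;> have := ih hq <;> dsimp only <;> omega

/-- The `m`-th time derivative of `|u|² u`, in terms of the time derivatives `v a` of `u`. -/
noncomputable def cubicSum (v : ℕ → L2Plane) (m : ℕ) : L2Plane :=
  ((leibnizTriples m).map fun p => cubic (v p.1) (v p.2.1) (v p.2.2)).sum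

theorem cubicSum_succ (v : ℕ → L2Plane) (m : ℕ) : cubicSum v (m + 1) =
    ((leibnizTriples m).map fun p => cubic (v (p.1 + 1)) (v p.2.1) (v p.2.2) +
      cubic (v p.1) (v (p.2.1 + 1)) (v p.2.2) + cubic (v p.1) (v p.2.1) (v (p.2.2 + 1))).sum := by
  rw [cubicSum, leibnizTriples]
  induction leibnizTriples m with
  | nil => rfl
  | cons a l ih =>
    rw [List.flatMap_cons, List.map_append, List.sum_append, ih, List.map_cons, List.sum_cons]
    simp only [List.map_cons, List.map_nil, List.sum_cons, List.sum_nil]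
    abel

/-- `e^{itA} b(t)` is differentiable where `b` is, if `b(t)` belongs to the domain of `A`. -/
theorem hasDerivAt_expA_apply {b : ℝ → L2Plane} {b' c : L2Plane} {t₀ : ℝ}
    (hb : HasDerivAt b b' t₀) (hc : b t₀ = potA 2 c) :
    HasDerivAt (fun t => expA t (b t)) (expA t₀ b' + expA t₀ (Complex.I • c)) t₀ := by
  have h1 : HasDerivAt (fun t => expA t (b t - b t₀)) (expA t₀ b') t₀ := by
    rw [hasDerivAt_iff_tendsto_slope]
    have h2 : Tendsto (fun t => (t, slope b t₀ t)) (𝓝[≠] t₀) (𝓝 (t₀, b')) :=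
      (tendsto_id'.2 nhdsWithin_le_nhds).prodMk_nhds (hasDerivAt_iff_tendsto_slope.1 hb)
    refine ((continuous_expA_uncurry.tendsto (t₀, b')).comp h2).congr fun t => ?_
    simp only [Function.comp_apply, slope, vsub_eq_sub, sub_self, map_zero, sub_zero]
    rw [(expA t).map_smul_of_tower]
  refine (h1.add (hasDerivAt_expA c t₀)).congr_of_eventuallyEq (Eventually.of_forall fun t => ?_)
  simp only [Pi.add_apply]
  rw [← hc, ← map_add, sub_add_cancel]

/-- The integral equation, differentiated once. Here `u = e^{itA} b(t)` with
`b(t) = φ + c ∫_0^t e^{-iτA} F(τ) dτ`, and `b` is differentiable. That `b(t)` lies in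
the domain of `A` is not seen from the integral, but follows from `u(t) ∈ ℋ^{n+2}`. -/
theorem sobolevHasDerivOn_of_duhamel {n : ℕ} {c : ℂ} {T : ℝ} (hT : 0 < T) {φ : L2Plane}
    {u F : ℝ → L2Plane} (hu : SobolevContinuousOn (n + 2) (Ioo (-T) T) u)
    (hF : SobolevContinuousOn (n + 1) (Ioo (-T) T) F)
    (h : ∀ t ∈ Ioo (-T) T, u t = groupA t φ + c • ∫ τ in (0 : ℝ)..t, groupA (t - τ) (F τ)) :
    SobolevHasDerivOn n (Ioo (-T) T) u fun t => Complex.I • powA 1 (u t) + c • F t := by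
  obtain ⟨w, hw, huw⟩ := hu
  obtain ⟨G, hG, hFG⟩ := hF.mono n.cast_nonneg (by linarith)
  have hn : (0 : ℝ) ≤ n := n.cast_nonneg
  have h0 : (0 : ℝ) ∈ Ioo (-T) T := ⟨by linarith, hT⟩
  have hsub : ∀ t ∈ Ioo (-T) T, uIcc 0 t ⊆ Ioo (-T) T := fun t ht =>
    (ordConnected_Ioo).uIcc_subset h0 ht
  have hu' : ∀ t ∈ Ioo (-T) T, u t = potA n (potA 2 (w t)) := fun t ht => by
    rw [huw t ht, potA_potA hn zero_le_two]
  have hφ : φ = potA n (potA 2 (w 0)) := by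
    have := h 0 h0
    rw [intervalIntegral.integral_same, smul_zero, add_zero, groupA_eq, expA_zero] at this
    rw [← this, hu' 0 h0]
  have hE : ContinuousOn (fun τ => expA (-τ) (G τ)) (Ioo (-T) T) := by
    have hp : ContinuousOn (fun τ => ((-τ, G τ) : ℝ × L2Plane)) (Ioo (-T) T) :=
      continuousOn_neg.prodMk hG
    have hg : Continuous (Function.uncurry fun (t : ℝ) (x : L2Plane) => expA t x) :=
      continuous_expA_uncurry
    have := hg.comp_continuousOn hp
    exact this
  have hEi : ∀ t ∈ Ioo (-T) T, IntervalIntegrable (fun τ => expA (-τ) (G τ)) volume 0 t :=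
    fun t ht => (hE.mono (hsub t ht)).intervalIntegrable
  obtain ⟨b, hb⟩ : ∃ b : ℝ → L2Plane, ∀ t, b t =
      potA 2 (w 0) + c • ∫ τ in (0 : ℝ)..t, expA (-τ) (G τ) := ⟨_, fun _ => rfl⟩
  have hab : ∀ t ∈ Ioo (-T) T, potA 2 (w t) = expA t (b t) := by
    intro t ht
    refine potA_injective hn ?_
    rw [← hu' t ht, h t ht, groupA_eq, hb, map_add, map_add, ← expA_potA hn, ← hφ, map_smul,
      map_smul]
    congr 2
    have e1 : ∫ τ in (0 : ℝ)..t, groupA (t - τ) (F τ) =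
        ∫ τ in (0 : ℝ)..t, ((potA n).comp (expA t)) (expA (-τ) (G τ)) := by
      refine intervalIntegral.integral_congr fun τ hτ => ?_
      simp only [ContinuousLinearMap.comp_apply]
      rw [groupA_eq, hFG τ (hsub t ht hτ), sub_eq_add_neg, expA_add, expA_potA hn, expA_potA hn]
    rw [e1, ContinuousLinearMap.intervalIntegral_comp_comm _ (hEi t ht)]
    rfl
  refine ⟨fun t => potA 2 (w t), fun t => Complex.I • w t + c • G t, fun t ht => ⟨hu' t ht, ?_, ?_⟩⟩
  · have hbd : HasDerivAt b (c • expA (-t) (G t)) t := by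
      have h1 := intervalIntegral.integral_hasDerivAt_right (hEi t ht)
        (hE.stronglyMeasurableAtFilter isOpen_Ioo t ht) (hE.continuousAt (isOpen_Ioo.mem_nhds ht))
      rw [funext hb]
      exact (h1.const_smul c).const_add _
    have hbt : b t = potA 2 (expA (-t) (w t)) := by
      rw [← expA_potA zero_le_two, hab t ht, ← expA_add, neg_add_cancel, expA_zero]
    have key := hasDerivAt_expA_apply hbd hbt
    have hinv : ∀ x, expA t (expA (-t) x) = x := fun x => by
      rw [← expA_add, add_neg_cancel, expA_zero]
    rw [map_smul, map_smul, hinv, hinv, add_comm] at key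
    refine key.congr_of_eventuallyEq ?_
    filter_upwards [isOpen_Ioo.mem_nhds ht] with x hx
    exact hab x hx
  · have hp : powA 1 (potA (n + 2) (w t)) = potA n (w t) := by
      simpa using powA_potA 1 hn (w t)
    beta_reduce
    rw [huw t ht, hp, hFG t ht, map_add, map_smul, map_smul]

/-- The time derivatives of a solution, up to the order `k` for data in `ℋ^ρ` with `2k ≤ ρ`:
each is obtained by formally differentiating the equation. -/
theorem IsLocalSolution.iteratedDeriv_succ_eq {σ b T : ℝ} {ρ : ℕ} (hT : 0 < T) {φ : L2Plane}
    {u : ℝ → L2Plane} (hu : IsLocalSolution σ ρ b T φ u)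
    (hcont : SobolevContinuousOn ρ (Ioo (-T) T) u) (m : ℕ) (hm : 2 * m + 2 ≤ ρ) :
    (∀ t ∈ Ioo (-T) T, iteratedDeriv (m + 1) u t = Complex.I • powA 1 (iteratedDeriv m u t) +
      ((σ : ℂ) * Complex.I) • cubicSum (fun a => iteratedDeriv a u t) m) ∧
    ∀ r : ℕ, r + 2 * m + 2 ≤ ρ →
      SobolevHasDerivOn r (Ioo (-T) T) (iteratedDeriv m u) (iteratedDeriv (m + 1) u) := by
  have hcast : ∀ i j : ℕ, i ≤ j → (i : ℝ) ≤ j := fun i j h => by exact_mod_cast h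
  -- it suffices to identify the derivative, which then is the next iterated derivative
  have hstep : ∀ (m : ℕ) (v' : ℝ → L2Plane), 2 * m + 2 ≤ ρ → (∀ r : ℕ, r + 2 * m + 2 ≤ ρ →
      SobolevHasDerivOn r (Ioo (-T) T) (iteratedDeriv m u) v') →
      (∀ t ∈ Ioo (-T) T, iteratedDeriv (m + 1) u t = v' t) ∧ ∀ r : ℕ, r + 2 * m + 2 ≤ ρ →
      SobolevHasDerivOn r (Ioo (-T) T) (iteratedDeriv m u) (iteratedDeriv (m + 1) u) := by
    intro m v' hm h
    have he : ∀ t ∈ Ioo (-T) T, iteratedDeriv (m + 1) u t = v' t := fun t ht => by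
      rw [iteratedDeriv_succ]
      exact ((h 0 (by omega)).hasDerivAt isOpen_Ioo ht).deriv
    exact ⟨he, fun r hr => (h r hr).congr (fun _ _ => rfl) he⟩
  induction m using Nat.strong_induction_on with
  | _ m ih =>
  refine hstep m _ hm fun r hr => ?_
  cases m with
  | zero =>
    obtain ⟨F, hF, hduh⟩ := hu.duhamel
    have hFc : ∀ t ∈ Ioo (-T) T, cubic (u t) (u t) (u t) = F t := fun t ht => by
      refine cubic_eq ?_
      filter_upwards [hF t ht] with z hz
      rw [hz, ← mul_assoc, Complex.mul_conj']
      push_cast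
      rfl
    have hur : ∀ i : ℕ, i ≤ ρ → SobolevContinuousOn i (Ioo (-T) T) u := fun i hi =>
      hcont.mono i.cast_nonneg (hcast _ _ hi)
    have hu1 : SobolevContinuousOn ((r + 1 : ℕ) + 1) (Ioo (-T) T) u := by
      exact_mod_cast hur (r + 2) (by omega)
    have hFs : SobolevContinuousOn (r + 1) (Ioo (-T) T) F := by
      exact_mod_cast (hu1.cubic hu1 hu1).congr fun t ht => (hFc t ht).symm
    have hd := sobolevHasDerivOn_of_duhamel hT (by exact_mod_cast hur (r + 2) (by omega)) hFs
      fun t ht => (hduh t ht).2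
    rw [iteratedDeriv_zero]
    refine hd.congr (fun _ _ => rfl) fun t ht => ?_
    simp [cubicSum, leibnizTriples, hFc t ht]
  | succ m =>
    obtain ⟨heq, -⟩ := ih m (by omega) (by omega)
    have hder : ∀ a i : ℕ, a ≤ m → i + 2 * m + 2 ≤ ρ → SobolevHasDerivOn i (Ioo (-T) T)
        (iteratedDeriv a u) (iteratedDeriv (a + 1) u) := fun a i ha hi =>
      (ih a (by omega) (by omega)).2 i (by omega)
    have h1 : SobolevHasDerivOn (r + 2) (Ioo (-T) T) (iteratedDeriv m u)
        (iteratedDeriv (m + 1) u) := by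
      exact_mod_cast hder m (r + 2) le_rfl (by omega)
    have h2 : ∀ a ≤ m, SobolevHasDerivOn (r + 1) (Ioo (-T) T) (iteratedDeriv a u)
        (iteratedDeriv (a + 1) u) := fun a ha => by
      exact_mod_cast hder a (r + 1) ha (by omega)
    have hsum := SobolevHasDerivOn.listSum (leibnizTriples m) fun p hp => by
      have := add_add_of_mem_leibnizTriples hp
      exact (h2 p.1 (by omega)).cubic (h2 p.2.1 (by omega)) (h2 p.2.2 (by omega))
    refine (((h1.powA_one r.cast_nonneg).const_smul Complex.I).add
      (hsum.const_smul ((σ : ℂ) * Complex.I))).congr (fun t ht => ?_) fun t _ => ?_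
    · exact heq t ht
    · rw [cubicSum_succ]

/-- Each time derivative costs two derivatives in space; also the derivative of the highest order
`m = ρ / 2` is continuous, as the differentiated equation shows. -/
theorem IsLocalSolution.sobolevContinuousOn_iteratedDeriv {σ b T : ℝ} {ρ : ℕ} (hT : 0 < T)
    {φ : L2Plane} {u : ℝ → L2Plane} (hu : IsLocalSolution σ ρ b T φ u)
    (hcont : SobolevContinuousOn ρ (Ioo (-T) T) u) (m r : ℕ) (hr : r + 2 * m ≤ ρ) :
    SobolevContinuousOn r (Ioo (-T) T) (iteratedDeriv m u) := by
  induction m using Nat.strong_induction_on generalizing r with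
  | _ m ih =>
  cases m with
  | zero =>
    rw [iteratedDeriv_zero]
    exact hcont.mono r.cast_nonneg (by exact_mod_cast hr)
  | succ m =>
    have h1 : SobolevContinuousOn (r + 2) (Ioo (-T) T) (iteratedDeriv m u) := by
      exact_mod_cast ih m (by omega) (r + 2) (by omega)
    have h2 : ∀ a ≤ m, SobolevContinuousOn (r + 1) (Ioo (-T) T) (iteratedDeriv a u) :=
      fun a ha => by exact_mod_cast ih a (by omega) (r + 1) (by omega)
    have hsum := SobolevContinuousOn.listSum (leibnizTriples m) fun p hp => by
      have := add_add_of_mem_leibnizTriples hp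
      exact (h2 p.1 (by omega)).cubic (h2 p.2.1 (by omega)) (h2 p.2.2 (by omega))
    exact (((h1.powA_one r.cast_nonneg).const_smul Complex.I).add
      (hsum.const_smul ((σ : ℂ) * Complex.I))).congr
      (hu.iteratedDeriv_succ_eq hT hcont m (by omega)).1

theorem IsLocalSolution.contDiffOn {σ b T : ℝ} {ρ k : ℕ} (hT : 0 < T)
    {φ : L2Plane} {u : ℝ → L2Plane} (hu : IsLocalSolution σ ρ b T φ u)
    (hcont : SobolevContinuousOn ρ (Ioo (-T) T) u) (hk : 2 * k ≤ ρ) :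
    ContDiffOn ℝ k u (Ioo (-T) T) := by
  have he : ∀ m, EqOn (iteratedDerivWithin m u (Ioo (-T) T)) (iteratedDeriv m u) (Ioo (-T) T) :=
    fun m => iteratedDerivWithin_of_isOpen isOpen_Ioo
  refine contDiffOn_of_continuousOn_differentiableOn_deriv (n := (k : ℕ∞)) (fun m hm => ?_)
    fun m hm => ?_
  · have hm' : m ≤ k := by exact_mod_cast hm
    exact (hu.sobolevContinuousOn_iteratedDeriv hT hcont m 0 (by omega)).continuousOn.congr (he m)
  · have hm' : m < k := by exact_mod_cast hm
    intro t ht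
    exact ((((hu.iteratedDeriv_succ_eq hT hcont m (by omega)).2 0 (by omega)).hasDerivAt
      isOpen_Ioo ht).differentiableAt.differentiableWithinAt).congr (he m) (he m ht)

end PartialHarmonic

namespace PartialHarmonic

/-! ### Estimates for the time derivatives -/

theorem spec_powA {k : ℕ} {u : L2Plane} (hu : sobolevNorm (2 * k) u < ∞) :
    spec (powA k u) =ᵐ[specMeasure] fun p => ((lam p : ℝ) : ℂ) ^ k * spec u p := by
  obtain ⟨w, rfl⟩ := exists_potA_eq (by positivity) hu
  have h := powA_potA k le_rfl w
  rw [zero_add, potA_zero] at h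
  rw [h]
  filter_upwards [spec_potA (r := 2 * k) (by positivity) w] with p hp
  rw [hp, ← mul_assoc]
  have e : ((lam p : ℝ) : ℂ) ^ k = ((lam p ^ (k : ℝ) : ℝ) : ℂ) := by
    rw [Real.rpow_natCast, Complex.ofReal_pow]
  rw [e, show (2 * (k : ℝ) / 2) = k by ring, lam_rpow_mul_neg, one_mul]

theorem sobolevNorm_powA {k : ℕ} {u : L2Plane} (hu : sobolevNorm (2 * k) u < ∞) (r : ℝ) :
    sobolevNorm r (powA k u) = sobolevNorm (r + 2 * k) u := by
  rw [sobolevNorm_eq, sobolevNorm_eq]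
  refine eLpNorm_congr_ae ?_
  filter_upwards [spec_powA hu] with p hp
  rw [hp, ← mul_assoc, ← Complex.ofReal_pow, ← Complex.ofReal_mul, ← Real.rpow_natCast,
    ← Real.rpow_add (lam_pos p)]
  congr 4
  ring

theorem powA_zero (u : L2Plane) : powA 0 u = u := by
  have h := powA_potA 0 le_rfl u
  simpa [potA_zero] using h

/-- The remainder `v_m - c A^m u` is well defined in the domain of `A`, and applying `A` to it
gives the linear part of the next remainder. -/
theorem powA_one_sub_powA {m : ℕ} {v u : L2Plane} (c : ℂ) (hv : sobolevNorm 2 v < ∞)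
    (hu : sobolevNorm (2 * m + 2) u < ∞) :
    sobolevNorm 2 (v - c • powA m u) < ∞ ∧
      powA 1 v - c • powA (m + 1) u = powA 1 (v - c • powA m u) := by
  have hu' : sobolevNorm (2 * (m + 1 : ℕ)) u < ∞ := by
    convert! hu using 2
    push_cast
    ring
  have hum : sobolevNorm (2 * m) u < ∞ := (sobolevNorm_mono (by linarith) u).trans_lt hu
  have hA : sobolevNorm 2 (powA m u) < ∞ := by
    rw [sobolevNorm_powA hum, add_comm]
    exact hu
  have hd : sobolevNorm 2 (v - c • powA m u) < ∞ := by
    refine (sobolevNorm_sub_le _ _ _).trans_lt ?_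
    rw [sobolevNorm_smul]
    exact ENNReal.add_lt_top.2 ⟨hv, ENNReal.mul_lt_top enorm_lt_top hA⟩
  have e2 : (2 * (1 : ℕ) : ℝ) = 2 := by norm_num
  refine ⟨hd, spec_ext ?_⟩
  rw [map_sub, map_smul]
  have h5 : spec (v - c • powA m u) =ᵐ[specMeasure] fun p => spec v p - c * spec (powA m u) p := by
    rw [map_sub, map_smul]
    filter_upwards [Lp.coeFn_sub (spec v) (c • spec (powA m u)), Lp.coeFn_smul c (spec (powA m u))]
      with p h1 h2
    rw [h1, Pi.sub_apply, h2]
    rfl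
  filter_upwards [Lp.coeFn_sub (spec (powA 1 v)) (c • spec (powA (m + 1) u)),
    Lp.coeFn_smul c (spec (powA (m + 1) u)), spec_powA (k := 1) (e2 ▸ hv),
    spec_powA hu', spec_powA (k := 1) (e2 ▸ hd),
    spec_powA hum, h5] with p h1 h2 h3 h4 h6 h7 h8
  rw [h1, Pi.sub_apply, h2, Pi.smul_apply, h3, h4, h6, h8, h7, smul_eq_mul]
  ring

theorem sobolevNorm_listSum_le {ι : Type*} (r : ℝ) (l : List ι) (f : ι → L2Plane) {B : ℝ≥0∞}
    (h : ∀ p ∈ l, sobolevNorm r (f p) ≤ B) : sobolevNorm r (l.map f).sum ≤ l.length * B := by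
  induction l with
  | nil =>
    have := sobolevNorm_smul r 0 0
    simp at this
    simp [this]
  | cons a l ih =>
    rw [List.map_cons, List.sum_cons, List.length_cons]
    push_cast
    rw [add_mul, one_mul, add_comm ((l.length : ℝ≥0∞) * B)]
    exact (sobolevNorm_add_le _ _ _).trans (add_le_add (h a (by simp))
      (ih fun p hp => h p (by simp [hp])))

/-- The values at one time of the derivatives `∂_t^m u`, `m ≤ k`, of a solution with values in
`ℋ^ρ`: `v m` belongs to `ℋ^{ρ - 2m}`, and the `v m` are related by the differentiated equation. -/
structure IsDerivSequence (c : ℂ) (ρ k : ℕ) (v : ℕ → L2Plane) : Prop where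
  lt_top : ∀ m ≤ k, ∀ r : ℕ, r + 2 * m ≤ ρ → sobolevNorm r (v m) < ∞
  succ : ∀ m < k, v (m + 1) = Complex.I • powA 1 (v m) + c • cubicSum v m

/-- The bound of the remainder implies that of the derivative itself. -/
theorem IsDerivSequence.sobolevNorm_le {c : ℂ} {ρ k : ℕ} {v : ℕ → L2Plane}
    (hv : IsDerivSequence c ρ k v) {m r : ℕ} (hr : r + 2 * m ≤ ρ) {C : ℝ≥0∞}
    (h : sobolevNorm r (v m - Complex.I ^ m • powA m (v 0)) ≤
      C * sobolevNorm (r + 2 * m - 1) (v 0)) :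
    sobolevNorm r (v m) ≤ (C + 1) * sobolevNorm (r + 2 * m) (v 0) := by
  have hfin : sobolevNorm (2 * m) (v 0) < ∞ := by
    exact_mod_cast hv.lt_top 0 (Nat.zero_le k) (2 * m) (by omega)
  have e : v m = (v m - Complex.I ^ m • powA m (v 0)) + Complex.I ^ m • powA m (v 0) := by abel
  have hI : ‖Complex.I ^ m‖ₑ = 1 := by
    rw [← ofReal_norm]
    simp
  calc sobolevNorm r (v m) = sobolevNorm r
        ((v m - Complex.I ^ m • powA m (v 0)) + Complex.I ^ m • powA m (v 0)) := by rw [← e]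
    _ ≤ C * sobolevNorm (r + 2 * m - 1) (v 0) + sobolevNorm (r + 2 * m) (v 0) := by
      refine (sobolevNorm_add_le _ _ _).trans (add_le_add h ?_)
      rw [sobolevNorm_smul, hI, one_mul, sobolevNorm_powA hfin]
    _ ≤ C * sobolevNorm (r + 2 * m) (v 0) + sobolevNorm (r + 2 * m) (v 0) := by
      gcongr
      exact sobolevNorm_mono (by linarith) _
    _ = _ := by ring

/-- By interpolation with the bound `R` in `ℋ^1`, each term of the `m`-th derivative of `|u|² u` is
bounded by a single factor `‖u‖_{ℋ^{r + 2m + 1}}`. -/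
theorem exists_sobolevNorm_cubicSum_le (m r : ℕ) {R D : ℝ≥0∞} (hR : R ≠ ∞) (hD : D ≠ ∞) :
    ∃ C : ℝ≥0∞, C ≠ ∞ ∧ ∀ v : ℕ → L2Plane, sobolevNorm 1 (v 0) ≤ R →
      (∀ a ≤ m, sobolevNorm (r + 1) (v a) < ∞) →
      (∀ a ≤ m, ∀ i ≤ r, sobolevNorm (i + 1) (v a) ≤ D * sobolevNorm (i + 1 + 2 * a) (v 0)) →
      sobolevNorm r (cubicSum v m) ≤ C * sobolevNorm (r + 2 * m + 1) (v 0) := by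
  obtain ⟨K, hK, hcub⟩ := exists_sobolevNorm_cubic_le r
  refine ⟨(leibnizTriples m).length * (K * (D ^ 3 * R ^ 2)), by finiteness,
    fun v hvR hfin hvD => ?_⟩
  rw [mul_assoc]
  refine sobolevNorm_listSum_le _ _ _ fun p hp => ?_
  have hsum := add_add_of_mem_leibnizTriples hp
  rw [mul_assoc]
  refine hcub _ _ _ (hfin _ (by omega)) (hfin _ (by omega)) (hfin _ (by omega)) _
    fun i j l hijl => ?_
  have hint := sobolevNorm_mul_mul_le (p := i + 2 * p.1) (q := j + 2 * p.2.1) (r := l + 2 * p.2.2)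
    (by positivity) (by positivity) (by positivity) (v 0)
  have e : (i + 2 * p.1 + (j + 2 * p.2.1) + (l + 2 * p.2.2) + 1 : ℝ) = r + 2 * m + 1 := by
    rw [← hijl, ← hsum]
    push_cast
    ring
  rw [e] at hint
  calc _ ≤ (D * sobolevNorm (i + 1 + 2 * p.1) (v 0)) * (D * sobolevNorm (j + 1 + 2 * p.2.1) (v 0)) *
        (D * sobolevNorm (l + 1 + 2 * p.2.2) (v 0)) :=
        mul_le_mul' (mul_le_mul' (hvD _ (by omega) _ (by omega)) (hvD _ (by omega) _ (by omega)))
          (hvD _ (by omega) _ (by omega))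
    _ = D ^ 3 * (sobolevNorm (i + 2 * p.1 + 1) (v 0) * sobolevNorm (j + 2 * p.2.1 + 1) (v 0) *
        sobolevNorm (l + 2 * p.2.2 + 1) (v 0)) := by
      rw [add_right_comm, add_right_comm (j : ℝ), add_right_comm (l : ℝ)]
      ring
    _ ≤ D ^ 3 * (R ^ 2 * sobolevNorm (r + 2 * m + 1) (v 0)) :=
      mul_le_mul_right (hint.trans (by gcongr)) _
    _ = _ := by ring

/-- The main part of `∂_t^m u` is `i^m A^m u`; the remainder is of lower order by one. By the
differentiated equation the remainder of order `m + 1` is `i A` applied to that of order `m`, plus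
derivatives of the cubic term. -/
theorem exists_sobolevNorm_sub_le (m : ℕ) {R : ℝ≥0∞} (hR : R ≠ ∞) (r : ℕ) :
    ∃ C : ℝ≥0∞, C ≠ ∞ ∧ ∀ (c : ℂ) (ρ k : ℕ) (v : ℕ → L2Plane), ‖c‖ₑ = 1 →
      IsDerivSequence c ρ k v → sobolevNorm 1 (v 0) ≤ R → m ≤ k → r + 2 * m ≤ ρ →
      sobolevNorm r (v m - Complex.I ^ m • powA m (v 0)) ≤
        C * sobolevNorm (r + 2 * m - 1) (v 0) := by
  induction m using Nat.strong_induction_on generalizing r with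
  | _ m ih =>
  cases m with
  | zero =>
    refine ⟨0, by simp, fun c ρ k v _ _ _ _ _ => ?_⟩
    have := sobolevNorm_smul r 0 0
    simp at this
    simp [powA_zero, this]
  | succ m =>
    choose! C hC hest using ih
    -- `D` is one bound for all the constants given by induction
    set D : ℝ≥0∞ := ∑ a ∈ Finset.range (m + 1), ∑ i ∈ Finset.range (r + 1), (C a (i + 1) + 1)
      with hDdef
    have hD : D ≠ ∞ := by
      refine ENNReal.sum_ne_top.2 fun a ha => ENNReal.sum_ne_top.2 fun i _ => ?_
      exact ENNReal.add_ne_top.2 ⟨hC a (by simpa using ha) _, ENNReal.one_ne_top⟩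
    have hDle : ∀ a ≤ m, ∀ i ≤ r, C a (i + 1) + 1 ≤ D := by
      intro a ha i hi
      refine le_trans ?_ (Finset.single_le_sum (f := fun a => ∑ i ∈ Finset.range (r + 1),
        (C a (i + 1) + 1)) (fun _ _ => zero_le) (Finset.mem_range.2 (Nat.lt_succ_of_le ha)))
      exact Finset.single_le_sum (f := fun i => C a (i + 1) + 1) (fun _ _ => zero_le)
        (Finset.mem_range.2 (Nat.lt_succ_of_le hi))
    obtain ⟨K, hK, hsum⟩ := exists_sobolevNorm_cubicSum_le m r hR hD
    refine ⟨C m (r + 2) + K, ENNReal.add_ne_top.2 ⟨hC m (by omega) _, hK⟩,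
      fun c ρ k v hc hv hvR hm hr => ?_⟩
    have h2 : sobolevNorm 2 (v m) < ∞ := by
      exact_mod_cast hv.lt_top m (by omega) 2 (by omega)
    have hu : sobolevNorm (2 * m + 2) (v 0) < ∞ := by
      exact_mod_cast hv.lt_top 0 (by omega) (2 * m + 2) (by omega)
    obtain ⟨hd2, he2⟩ := powA_one_sub_powA (Complex.I ^ m) h2 hu
    have hd2' : sobolevNorm (2 * (1 : ℕ)) (v m - Complex.I ^ m • powA m (v 0)) < ∞ := by
      norm_num
      exact hd2
    have e : v (m + 1) - Complex.I ^ (m + 1) • powA (m + 1) (v 0) =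
        Complex.I • powA 1 (v m - Complex.I ^ m • powA m (v 0)) + c • cubicSum v m := by
      rw [← he2, hv.succ m (by omega), smul_sub, smul_smul, pow_succ']
      abel
    have hI : ‖Complex.I‖ₑ = 1 := by
      rw [← ofReal_norm]
      simp
    have er : (r + 2 * (m + 1 : ℕ) - 1 : ℝ) = r + 2 * m + 1 := by
      push_cast
      ring
    have h1 := hest m (by omega) (r + 2) c ρ k v hc hv hvR (by omega) (by omega)
    have h3 : ((r + 2 : ℕ) + 2 * m - 1 : ℝ) = r + 2 * m + 1 := by
      push_cast
      ring
    rw [h3] at h1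
    rw [e, er, add_mul]
    refine (sobolevNorm_add_le _ _ _).trans (add_le_add ?_ ?_)
    · rw [sobolevNorm_smul, hI, one_mul, sobolevNorm_powA hd2']
      exact_mod_cast h1
    · rw [sobolevNorm_smul, hc, one_mul]
      refine hsum v hvR (fun a ha => ?_) fun a ha i hi => ?_
      · exact_mod_cast hv.lt_top a (by omega) (r + 1) (by omega)
      · have h4 := hv.sobolevNorm_le (r := i + 1) (by omega)
          (hest a (by omega) (i + 1) c ρ k v hc hv hvR (by omega) (by omega))
        push_cast at h4
        exact h4.trans (mul_le_mul_left (hDle a ha i hi) _)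

/-- Interpolation between `ℋ^{2k}` and `L²`, in the form that allows to absorb the first term. -/
theorem exists_sobolevNorm_sub_one_le (k : ℕ) {ε : ℝ} (hε : 0 < ε) :
    ∃ C : ℝ≥0∞, C ≠ ∞ ∧ ∀ u : L2Plane, sobolevNorm (2 * k - 1) u ≤
      ENNReal.ofReal ε * sobolevNorm (2 * k) u + C * ‖u‖ₑ := by
  -- for `λ ≥ M` one has `λ^{-1} ≤ ε²`, and for `λ ≤ M` the power of `λ` is bounded
  set M : ℝ := (ε ^ 2)⁻¹ with hM
  have hM0 : 0 < M := by positivity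
  refine ⟨ENNReal.ofReal (M ^ k), ENNReal.ofReal_ne_top, fun u => ?_⟩
  have hpt : ∀ p, lam p ^ (2 * k - 1 : ℝ) ≤ ε ^ 2 * lam p ^ (2 * k : ℝ) + (M ^ k) ^ 2 := by
    intro p
    have hp := lam_pos p
    rcases le_total M (lam p) with h | h
    · have h1 : lam p ^ (2 * k - 1 : ℝ) = (lam p)⁻¹ * lam p ^ (2 * k : ℝ) := by
        rw [← Real.rpow_neg_one, ← Real.rpow_add hp]
        ring_nf
      have h2 : (lam p)⁻¹ ≤ ε ^ 2 := inv_le_of_inv_le₀ (by positivity) h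
      rw [h1]
      exact (mul_le_mul_of_nonneg_right h2 (by positivity)).trans (le_add_of_nonneg_right
        (by positivity))
    · have h1 : lam p ^ (2 * k - 1 : ℝ) ≤ lam p ^ (2 * k : ℝ) :=
        Real.rpow_le_rpow_of_exponent_le (one_le_lam p) (by linarith)
      have h2 : lam p ^ (2 * k : ℝ) = (lam p ^ k) ^ 2 := by
        rw [← pow_mul, ← Real.rpow_natCast]
        congr 1
        push_cast
        ring
      have h3 : (lam p ^ k) ^ 2 ≤ (M ^ k) ^ 2 := by gcongr
      have h4 : 0 ≤ ε ^ 2 * lam p ^ (2 * k : ℝ) := by positivity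
      linarith
  refine (ENNReal.pow_right_strictMono two_ne_zero).le_iff_le.1 ?_
  calc sobolevNorm (2 * k - 1) u ^ 2
      ≤ ∫⁻ p, (ENNReal.ofReal (ε ^ 2) * (ENNReal.ofReal (lam p ^ (2 * k : ℝ)) * ‖spec u p‖ₑ ^ 2) +
          ENNReal.ofReal ((M ^ k) ^ 2) * ‖spec u p‖ₑ ^ 2) ∂specMeasure := by
        rw [sobolevNorm_sq_eq_lintegral]
        refine lintegral_mono fun p => ?_
        have hp := lam_pos p
        rw [← mul_assoc, ← add_mul, ← ENNReal.ofReal_mul (by positivity),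
          ← ENNReal.ofReal_add (by positivity) (by positivity)]
        gcongr
        exact hpt p
    _ = (ENNReal.ofReal ε * sobolevNorm (2 * k) u) ^ 2 + (ENNReal.ofReal (M ^ k) * ‖u‖ₑ) ^ 2 := by
        have hmeas : Measurable fun p => ‖spec u p‖ₑ ^ 2 :=
          (Lp.stronglyMeasurable _).measurable.enorm.pow_const 2
        have hmeas' : Measurable fun p => ENNReal.ofReal (lam p ^ (2 * k : ℝ)) * ‖spec u p‖ₑ ^ 2 :=
          (ENNReal.measurable_ofReal.comp (measurable_lam.pow_const _)).mul hmeas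
        rw [lintegral_add_left (hmeas'.const_mul _), lintegral_const_mul _ hmeas',
          lintegral_const_mul _ hmeas, ← sobolevNorm_sq_eq_lintegral, ← enorm_sq_L2,
          ← Lp.enorm_def, spec.enorm_map, ENNReal.ofReal_pow hε.le,
          ENNReal.ofReal_pow (by positivity), mul_pow, mul_pow]
    _ ≤ _ := by
        rw [add_sq, add_right_comm]
        exact le_self_add

/-- The estimates for the `k`-th derivative at one time, with a constant that depends only on `k`,
`s` and the bound in `ℋ^1`. In the lower bound of the `k`-th derivative the remainder is absorbed by
the main part. -/
theorem exists_le_of_isDerivSequence (k s : ℕ) {R : ℝ≥0∞} (hR : R ≠ ∞) :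
    ∃ C : ℝ≥0∞, C ≠ ∞ ∧ C ≠ 0 ∧ ∀ (c : ℂ) (v : ℕ → L2Plane), ‖c‖ₑ = 1 →
      IsDerivSequence c (2 * k + s) k v → sobolevNorm 1 (v 0) ≤ R →
      sobolevNorm s (v k - Complex.I ^ k • powA k (v 0)) ≤
        C * sobolevNorm (s + 2 * k - 1) (v 0) ∧
      ‖v k‖ₑ ≤ C * sobolevNorm (2 * k) (v 0) ∧
      sobolevNorm (2 * k) (v 0) ≤ C * (‖v k‖ₑ + ‖v 0‖ₑ) := by
  obtain ⟨C₁, hC₁, h₁⟩ := exists_sobolevNorm_sub_le k hR s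
  obtain ⟨C₀, hC₀, h₀⟩ := exists_sobolevNorm_sub_le k hR 0
  -- small enough for half of the main part to remain after the absorption
  have hε : 0 < 1 / (2 * (C₀.toReal + 1)) := by positivity
  have hεC : C₀ * ENNReal.ofReal (1 / (2 * (C₀.toReal + 1))) ≤ 2⁻¹ := by
    have h2 : (2⁻¹ : ℝ≥0∞) = ENNReal.ofReal 2⁻¹ := by
      rw [ENNReal.ofReal_inv_of_pos two_pos, ENNReal.ofReal_ofNat]
    nth_rewrite 1 [← ENNReal.ofReal_toReal hC₀]
    rw [← ENNReal.ofReal_mul ENNReal.toReal_nonneg, h2]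
    refine ENNReal.ofReal_le_ofReal ?_
    rw [mul_one_div, div_le_iff₀ (by positivity)]
    linarith
  obtain ⟨C₂, hC₂, h₂⟩ := exists_sobolevNorm_sub_one_le k hε
  refine ⟨C₁ + (C₀ + 1) + (2 + 2 * (C₀ * C₂)), by finiteness, by simp, fun c v hc hv hvR => ?_⟩
  have hb₀ := h₀ c _ k v hc hv hvR le_rfl (by omega)
  have hle := hv.sobolevNorm_le (r := 0) (by omega) hb₀
  have hfin : sobolevNorm (2 * k) (v 0) < ∞ := by
    exact_mod_cast hv.lt_top 0 (Nat.zero_le k) (2 * k) (by omega)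
  simp only [Nat.cast_zero, zero_add, sobolevNorm_zero] at hb₀ hle
  refine ⟨(h₁ c _ k v hc hv hvR le_rfl (by omega)).trans ?_, hle.trans ?_, ?_⟩
  · exact mul_le_mul_left (le_self_add.trans le_self_add) _
  · exact mul_le_mul_left (le_add_self.trans le_self_add) _
  · have hI : ‖Complex.I ^ k‖ₑ = 1 := by
      rw [← ofReal_norm]
      simp
    have hA : sobolevNorm (2 * k) (v 0) = ‖Complex.I ^ k • powA k (v 0)‖ₑ := by
      rw [enorm_smul, hI, one_mul, ← sobolevNorm_zero, sobolevNorm_powA hfin, zero_add]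
    have key : sobolevNorm (2 * k) (v 0) ≤
        (‖v k‖ₑ + C₀ * C₂ * ‖v 0‖ₑ) + 2⁻¹ * sobolevNorm (2 * k) (v 0) := by
      calc sobolevNorm (2 * k) (v 0)
          = ‖v k - (v k - Complex.I ^ k • powA k (v 0))‖ₑ := by rw [hA, sub_sub_cancel]
        _ ≤ ‖v k‖ₑ + C₀ * sobolevNorm (2 * k - 1) (v 0) :=
          enorm_sub_le.trans (add_le_add le_rfl hb₀)
        _ ≤ ‖v k‖ₑ + C₀ * (ENNReal.ofReal (1 / (2 * (C₀.toReal + 1))) *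
            sobolevNorm (2 * k) (v 0) + C₂ * ‖v 0‖ₑ) := by
          gcongr
          exact h₂ _
        _ = ‖v k‖ₑ + C₀ * C₂ * ‖v 0‖ₑ + C₀ * ENNReal.ofReal (1 / (2 * (C₀.toReal + 1))) *
            sobolevNorm (2 * k) (v 0) := by ring
        _ ≤ _ := by gcongr
    have habs : sobolevNorm (2 * k) (v 0) ≤ 2 * (‖v k‖ₑ + C₀ * C₂ * ‖v 0‖ₑ) := by
      have hX := hfin.ne
      generalize sobolevNorm (2 * k) (v 0) = X at key hX ⊢
      generalize ‖v k‖ₑ + C₀ * C₂ * ‖v 0‖ₑ = Y at key ⊢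
      have hhalf : 2⁻¹ * X ≤ Y := by
        refine ENNReal.le_of_add_le_add_right (a := 2⁻¹ * X) (by finiteness) ?_
        rwa [← add_mul, ENNReal.inv_two_add_inv_two, one_mul]
      calc X = 2 * (2⁻¹ * X) := by
            rw [← mul_assoc, ENNReal.mul_inv_cancel two_ne_zero ENNReal.ofNat_ne_top, one_mul]
        _ ≤ 2 * Y := by gcongr
    calc _ ≤ 2 * (‖v k‖ₑ + C₀ * C₂ * ‖v 0‖ₑ) := habs
      _ = 2 * ‖v k‖ₑ + 2 * (C₀ * C₂) * ‖v 0‖ₑ := by ring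
      _ ≤ (2 + 2 * (C₀ * C₂)) * ‖v k‖ₑ + (2 + 2 * (C₀ * C₂)) * ‖v 0‖ₑ := by
        gcongr
        · exact le_self_add
        · exact le_add_self
      _ = (2 + 2 * (C₀ * C₂)) * (‖v k‖ₑ + ‖v 0‖ₑ) := by ring
      _ ≤ _ := mul_le_mul_left le_add_self _

end PartialHarmonic

theorem mainTheorem8 (k s : ℕ) (R : ℝ) (hR : 0 < R) :
    ∃ C : ℝ, 0 < C ∧
      ∀ (σ : ℝ), (σ = 1 ∨ σ = -1) →
      ∀ (T : ℝ), 0 < T → ∀ (b : ℝ), 1 / 2 < b →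
      ∀ (φ : PartialHarmonic.L2Plane) (u : ℝ → PartialHarmonic.L2Plane),
        PartialHarmonic.sobolevNorm (2 * k + s) φ < ∞ →
        PartialHarmonic.sobolevNorm 1 φ < ENNReal.ofReal R →
        PartialHarmonic.IsLocalSolution σ (2 * k + s) b T φ u →
        (⨆ t ∈ Ioo (-T) T, PartialHarmonic.sobolevNorm 1 (u t)) < ENNReal.ofReal R →
        ContDiffOn ℝ k u (Ioo (-T) T) ∧
        ∀ t ∈ Ioo (-T) T,
          PartialHarmonic.sobolevNorm (2 * k + s) (u t) < ∞ ∧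
          PartialHarmonic.sobolevNorm s
              (iteratedDeriv k u t - Complex.I ^ k • PartialHarmonic.powA k (u t)) ≤
            ENNReal.ofReal C * PartialHarmonic.sobolevNorm (s + 2 * k - 1) (u t) ∧
          ‖iteratedDeriv k u t‖ₑ ≤
            ENNReal.ofReal C * PartialHarmonic.sobolevNorm (2 * k) (u t) ∧
          PartialHarmonic.sobolevNorm (2 * k) (u t) ≤
            ENNReal.ofReal C * (‖iteratedDeriv k u t‖ₑ + ‖u t‖ₑ) := by
  obtain ⟨C, hC, hC0, hest⟩ := PartialHarmonic.exists_le_of_isDerivSequence k s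
    (ENNReal.ofReal_ne_top (r := R))
  refine ⟨C.toReal, ENNReal.toReal_pos hC0 hC, fun σ hσ T hT b hb φ u _ _ hu hsup => ?_⟩
  rw [ENNReal.ofReal_toReal hC]
  have hcast : (2 * k + s : ℝ) = ((2 * k + s : ℕ) : ℝ) := by push_cast; rfl
  rw [hcast] at hu ⊢
  have hcont : PartialHarmonic.SobolevContinuousOn (2 * k + s : ℕ) (Ioo (-T) T) u :=
    PartialHarmonic.exists_continuousOn_potA (Nat.cast_nonneg _) hb hu.mem hu.continuousOn
  refine ⟨hu.contDiffOn hT hcont (by omega), fun t ht =>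
    ⟨hcont.sobolevNorm_lt_top (Nat.cast_nonneg _) ht, ?_⟩⟩
  have hc : ‖(σ : ℂ) * Complex.I‖ₑ = 1 := by
    rw [← ofReal_norm]
    rcases hσ with rfl | rfl <;> simp
  have hv : PartialHarmonic.IsDerivSequence ((σ : ℂ) * Complex.I) (2 * k + s) k
      fun m => iteratedDeriv m u t :=
    ⟨fun m _ r hr => (hu.sobolevContinuousOn_iteratedDeriv hT hcont m r hr).sobolevNorm_lt_top
      r.cast_nonneg ht, fun m hm => (hu.iteratedDeriv_succ_eq hT hcont m (by omega)).1 t ht⟩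
  have hR1 : PartialHarmonic.sobolevNorm 1 (iteratedDeriv 0 u t) ≤ ENNReal.ofReal R := by
    rw [iteratedDeriv_zero]
    exact (le_iSup₂ (f := fun t (_ : t ∈ Ioo (-T) T) => PartialHarmonic.sobolevNorm 1 (u t))
      t ht).trans hsup.le
  have := hest _ _ hc hv hR1
  simpa only [iteratedDeriv_zero] using this
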